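/- **Setting.** Write $r\cdot z=\sum_i r_iz_i$, $|r|$ for the Euclidean norm, $\exp$ for the coordinatewise exponential, $\mathrm{ReLog}\,Z=(\log|Z_1|,\dots,\log|Z_d|)$, $T_{\mathbb R}=(\mathbb R/2\pi\mathbb Z)^d$. The amoeba of a Laurent polynomial $G$ is $\mathrm{ReLog}$ of its zero set in $(\mathbb C\setminus\{0\})^d$. For a germ $g$ analytic at $z$, $\hom(g,z)$ is the lowest-degree nonzero homogeneous part of the Taylor series of $g(z+\cdot)$. A homogeneous polynomial $A$ is hyperbolic in direction $v\in\mathbb R^d$ if $A(v)\ne0$ and for each $x\in\mathbb R^d$ all roots $t$ of $A(x+tv)$ are real. For a component $B$ of the complement of the amoeba of $G$ and $x\in\partial B$, let $\tan_x(B)=\{v: x+\epsilon v\in B\text{ for all small }\epsilon>0\}$ and, for $y\in T_{\mathbb R}$, let $K(y)$ be the connected component, containing $\tan_x(B)$, of the set of directions in which $\hom(G\circ\exp,x+iy)$ is hyperbolic ($K(y)=\mathbb R^d$ if $G(\exp(x+iy))\neq0$). **Hypotheses (quadratic point hypotheses).** 1. $F=P_0F_1^{s_1}\cdots F_m^{s_m}$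 with $F_j$ Laurent polynomials in $d$ variables, pairwise without common factor, and $s_j\in\mathbb R\setminus\{0,1,2,\dots\}$. 2. $B$ is a component of the complement of the amoeba of $G=\prod_jF_j$; branches of $\log(F_j\circ\exp)$ are fixed on $B+i\mathbb R^d$, they define the powers $F_j^{s_j}$, and $F(Z)=\sum_{k\in\mathbb Z^d}a_kZ^k$ on $\mathrm{ReLog}^{-1}(B)$. 3. $r_0\in(\mathbb R^d)^*$ is proper: $r_0\cdot x$ has a maximum on $\overline B$, attained at a unique point $x_{\max}$. The function $P_0$ is analytic at every point of $\mathrm{ReLog}^{-1}(B\cup\{x_{\max}\})$. Below, $K(y)$ is formed with $x=x_{\max}$. 4. The set $W=W(r_0)$ of all $y\in T_{\mathbb R}$ with $G(\exp(x_{\max}+iy))=0$ and $r_0\cdot v\le0$ for all $v\in K(y)$ is finite and nonempty. 5. For each $w\in W$, put $z_w=x_{\max}+iw$. Among the $F_j$ vanishing at $\exp z_w$ at most one, called $Q$ (with exponent $-s$; $s=0$ if there is none), has as homogeneous part $\hom(Q\circ\exp,z_w)$ a nonzero constant times an irreducible real quadratic form of signature $(1,-1,\dots,-1)$; all others, called $H_1,\dots,H_k$,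 have linear homogeneous part $\hom(H_i\circ\exp,z_w)$ and exponent $-n_i$ with $n_i$ a positive integer. Let $P$ be the product of $P_0$ with the $F_j^{s_j}$ for which $F_j(\exp z_w)\ne0$, so $F=P/(Q^s\prod_iH_i^{n_i})$, and write $p=P\circ\exp$, $q=Q\circ\exp$, $h_i=H_i\circ\exp$ (all depending on $w$). **Theorem (localization).** Assume these hypotheses and let $U_w$ ($w\in W$) be any pairwise disjoint open neighborhoods in $T_{\mathbb R}$ of the points of $W$. Then $\tan_{x_{\max}}(B)\neq\emptyset$, and there is a smooth map $\eta:T_{\mathbb R}\to\mathbb R^d$ with $\eta(y)\in K(y)$ for all $y$ and $r_0\cdot\eta(y)=|r_0|$ for $y\notin\bigcup_wU_w$. For every such $\eta$ there is an open conical neighborhood $\mathcal N$ of $r_0$ such that for every $u\in\tan_{x_{\max}}(B)$ and all sufficiently small $\epsilon>0$ the following holds. With $$\Phi_t(y)=x_{\max}+iy+\epsilon[(1-t)u+t\,\eta(y)],\qquad 0\le t\le1,$$ the map $\Phi_0$ takes values in $B+i\mathbb R^d$, $P_0$ is analytic at all points $\exp\Phi_t(y)$, no $F_j\circ\exp$ vanishes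 at any $\Phi_t(y)$, and so the branches of $\log(F_j\circ\exp)$ continue along the homotopy from $\Phi_0$ to $\Phi_1$. Let $\mathcal C_w$ be the chain given by the restriction of $\Phi_1$ to $\overline{U_w}$ and, using the continued branches, put $$\mathrm{contrib}(w)=\Big(\frac1{2\pi i}\Big)^d\int_{\mathcal C_w}e^{-r\cdot z}\frac{p(z)}{q(z)^s\prod_{i=1}^kh_i(z)^{n_i}}\,dz .$$ Then there are $\beta>0$ and $R$ such that for all $r\in\mathbb Z^d\cap\mathcal N$ with $|r|\ge R$ $$\Big|a_r-\sum_{w\in W(r_0)}\mathrm{contrib}(w)\Big|\le e^{-\beta|r|}\,e^{-r\cdot x_{\max}} .$$ -/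

import Mathlib

open scoped ContDiff Topology

noncomputable section

namespace QuadPoint

/-! ### Vectors, exponentials, Laurent polynomials -/

/-- The pairing `r · x` of a dual vector with a real vector. -/
def pair {d : ℕ} (r x : Fin d → ℝ) : ℝ := ∑ i, r i * x i

/-- The pairing `r · z` of a real dual vector with a complex vector. -/
def pairC {d : ℕ} (r : Fin d → ℝ) (z : Fin d → ℂ) : ℂ := ∑ i, (r i : ℂ) * z i

/-- The Euclidean length `|r|`. -/
def len {d : ℕ} (r : Fin d → ℝ) : ℝ := Real.sqrt (∑ i, r i ^ 2)

/-- An integer vector regarded as a real vector. -/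
def intVec {d : ℕ} (k : Fin d → ℤ) : Fin d → ℝ := fun i => (k i : ℝ)

/-- The complex vector `x + i y`. -/
def cvec {d : ℕ} (x y : Fin d → ℝ) : Fin d → ℂ := fun i => (x i : ℂ) + (y i : ℂ) * Complex.I

/-- The coordinatewise exponential. -/
def cexp {d : ℕ} (z : Fin d → ℂ) : Fin d → ℂ := fun i => Complex.exp (z i)

/-- The coordinatewise log-modulus map. -/
def reLog {d : ℕ} (Z : Fin d → ℂ) : Fin d → ℝ := fun i => Real.log ‖Z i‖

/-- Complex Laurent polynomials in `d` variables: finitely supported families of coefficients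
indexed by exponents in `ℤ ^ d`, with the convolution product. -/
abbrev Laurent (d : ℕ) : Type := AddMonoidAlgebra ℂ (Fin d → ℤ)

/-- The value of a Laurent polynomial at a point (with nonzero coordinates). -/
def leval {d : ℕ} (F : Laurent d) (Z : Fin d → ℂ) : ℂ :=
  F.coeff.sum fun k c => c * ∏ i, Z i ^ (k i)

/-- The function `f = F ∘ exp`. -/
def logf {d : ℕ} (F : Laurent d) (z : Fin d → ℂ) : ℂ := leval F (cexp z)

/-- The amoeba of a Laurent polynomial: the image under `reLog` of its zero set in the
complex torus. -/
def amoeba {d : ℕ} (F : Laurent d) : Set (Fin d → ℝ) :=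
  {x | ∃ Z : Fin d → ℂ, (∀ i, Z i ≠ 0) ∧ leval F Z = 0 ∧ reLog Z = x}

/-- `B` is a connected component of the complement of the amoeba of `F`. -/
def IsAmoebaComplComponent {d : ℕ} (F : Laurent d) (B : Set (Fin d → ℝ)) : Prop :=
  ∃ x ∈ (amoeba F)ᶜ, B = connectedComponentIn (amoeba F)ᶜ x

/-- The tube `B + i ℝ^d`. -/
def tube {d : ℕ} (B : Set (Fin d → ℝ)) : Set (Fin d → ℂ) := {z | (fun i => (z i).re) ∈ B}

/-- The half-open cube `[0, 2π)^d`, a set of representatives of the torus `(ℝ / 2πℤ)^d`. -/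
def cube (d : ℕ) : Set (Fin d → ℝ) := Set.univ.pi fun _ => Set.Ico 0 (2 * Real.pi)

/-! ### Homogeneous parts, hyperbolicity, cones -/

/-- The degree `n` part, evaluated at `w`, of the Taylor expansion of `f (z + ·)` at the origin,
i.e. the coefficient of `t ^ n` in `f (z + t w)`. -/
def taylorPart {d : ℕ} (f : (Fin d → ℂ) → ℂ) (z : Fin d → ℂ) (n : ℕ) (w : Fin d → ℂ) : ℂ :=
  iteratedDeriv n (fun t : ℂ => f (z + t • w)) 0 / (n.factorial : ℂ)

/-- The degree of vanishing of an analytic germ: the least degree of a nonzero homogeneous part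
of the power series of `f (z + ·)`. -/
def vanishDeg {d : ℕ} (f : (Fin d → ℂ) → ℂ) (z : Fin d → ℂ) : ℕ :=
  sInf {n : ℕ | ∃ w, taylorPart f z n w ≠ 0}

/-- The leading homogeneous part `hom (f, z)`. -/
def homPart {d : ℕ} (f : (Fin d → ℂ) → ℂ) (z : Fin d → ℂ) : (Fin d → ℂ) → ℂ :=
  taylorPart f z (vanishDeg f z)

/-- Hyperbolicity of a homogeneous polynomial function `A` in the real direction `v`: `A v ≠ 0`,
and for real `x` all roots of `t ↦ A (x + t v)` are real.  (A nonzero constant is hyperbolic in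
every direction.) -/
def IsHyperbolic {d : ℕ} (A : (Fin d → ℂ) → ℂ) (v : Fin d → ℝ) : Prop :=
  A (fun i => (v i : ℂ)) ≠ 0 ∧
    ∀ (x : Fin d → ℝ) (t : ℂ), A (fun i => (x i : ℂ) + t * (v i : ℂ)) = 0 → t.im = 0

/-- The (open) tangent cone to `B` at `x`. -/
def tanCone {d : ℕ} (B : Set (Fin d → ℝ)) (x : Fin d → ℝ) : Set (Fin d → ℝ) :=
  {v | ∀ᶠ ε : ℝ in 𝓝[>] 0, x + ε • v ∈ B}

/-- The cone `K^{f,B}(exp (x + i y))`: the connected component, in the set of directions of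
hyperbolicity of `hom (f, x + i y)`, that contains the tangent cone to `B` at `x`.
It is all of `ℝ^d` if `f (x + i y) ≠ 0`. -/
def hypCone {d : ℕ} (G : Laurent d) (B : Set (Fin d → ℝ)) (x y : Fin d → ℝ) :
    Set (Fin d → ℝ) :=
  ⋃ u ∈ tanCone B x, connectedComponentIn {v | IsHyperbolic (homPart (logf G) (cvec x y)) v} u

/-- The set `W(r)` of logarithmic minimal critical points, each represented by its representative
in `[0, 2π)^d`: those `y` for which `exp (x + i y)` is a zero of `G` and `r` lies in the normal
cone `N^*(exp (x + i y))`, the dual of `-K^{f,B}(exp (x + i y))`. -/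
def critW {d : ℕ} (G : Laurent d) (B : Set (Fin d → ℝ)) (x r : Fin d → ℝ) :
    Set (Fin d → ℝ) :=
  {y | y ∈ cube d ∧ logf G (cvec x y) = 0 ∧ ∀ v ∈ hypCone G B x y, pair r v ≤ 0}

/-- `r` is a proper direction for `B` with dual point `x`: the maximum of `r ·` over the closure
of `B` exists and is attained at `x` only. -/
def IsProperDirection {d : ℕ} (B : Set (Fin d → ℝ)) (r x : Fin d → ℝ) : Prop :=
  x ∈ closure B ∧ ∀ x' ∈ closure B, x' ≠ x → pair r x' < pair r x

/-- The standard Lorentzian quadratic form `x_1^2 - x_2^2 - ⋯ - x_d^2`. -/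
def lorentz {d : ℕ} (x : Fin d → ℝ) : ℝ :=
  ∑ i : Fin d, if (i : ℕ) = 0 then x i ^ 2 else -(x i ^ 2)

/-- `A` is, up to a nonzero constant factor, an irreducible real quadratic form of signature
`(1, -1, …, -1)`, i.e. of the form `lorentz ∘ M⁻¹` for an invertible linear map `M`. -/
def IsLorentzQuadratic {d : ℕ} (A : (Fin d → ℂ) → ℂ) : Prop :=
  ∃ (p : MvPolynomial (Fin d) ℝ) (c : ℂ) (M : (Fin d → ℝ) ≃ₗ[ℝ] (Fin d → ℝ)),
    Irreducible p ∧ (∀ x, MvPolynomial.eval x p = lorentz (M.symm x)) ∧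
      c ≠ 0 ∧ ∀ w, A w = c * MvPolynomial.aeval w p

/-! ### The hypotheses -/

/-- The quadratic point hypotheses for the quasirational function `F = P₀ ∏ F_j ^ s_j`.

* `ℓ j` is the branch of `log (F_j ∘ exp)` over the tube `B + iℝ^d` that defines
  `F_j ^ s_j = exp (s_j ℓ_j)` there;
* `a` is the family of Laurent coefficients of `F` over `B`;
* at a critical point `w`, `qi w` is the index of the factor with a quadratic leading part
  (`none` if there is none, the case `s = 0`), and the other factors vanishing there
  have linear leading part and occur with exponent `-(nn w j)`, `nn w j` a positive integer. -/
structure Hyps {d m : ℕ} (P₀ : (Fin d → ℂ) → ℂ) (F : Fin m → Laurent d) (s : Fin m → ℝ)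
    (B : Set (Fin d → ℝ)) (ℓ : Fin m → (Fin d → ℂ) → ℂ) (a : (Fin d → ℤ) → ℂ)
    (r xmax : Fin d → ℝ) (qi : (Fin d → ℝ) → Option (Fin m))
    (nn : (Fin d → ℝ) → Fin m → ℕ) : Prop where
  exponent_not_nat : ∀ j, ∀ k : ℕ, s j ≠ (k : ℝ)
  coprime : Pairwise fun i j => IsRelPrime (F i) (F j)
  component : IsAmoebaComplComponent (∏ j, F j) B
  numerator_analytic : ∀ Z : Fin d → ℂ, (∀ i, Z i ≠ 0) → (reLog Z ∈ B ∨ reLog Z = xmax) →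
    AnalyticAt ℂ P₀ Z
  branch_analytic : ∀ j, AnalyticOnNhd ℂ (ℓ j) (tube B)
  branch_exp : ∀ j, ∀ z ∈ tube B, Complex.exp (ℓ j z) = logf (F j) z
  laurent : ∀ z ∈ tube B,
    HasSum (fun k : Fin d → ℤ => a k * Complex.exp (pairC (intVec k) z))
      (P₀ (cexp z) * ∏ j, Complex.exp ((s j : ℂ) * ℓ j z))
  proper : IsProperDirection B r xmax
  crit_finite : (critW (∏ j, F j) B xmax r).Finite
  crit_nonempty : (critW (∏ j, F j) B xmax r).Nonempty
  quadratic : ∀ w ∈ critW (∏ j, F j) B xmax r, ∀ j, qi w = some j →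
    logf (F j) (cvec xmax w) = 0 ∧ IsLorentzQuadratic (homPart (logf (F j)) (cvec xmax w))
  linear : ∀ w ∈ critW (∏ j, F j) B xmax r, ∀ j, qi w ≠ some j →
    logf (F j) (cvec xmax w) = 0 →
      vanishDeg (logf (F j)) (cvec xmax w) = 1 ∧ 0 < nn w j ∧ s j = -(nn w j : ℝ)

/-! ### The local chains -/

/-- A subset of `ℝ^d` that is invariant under `2πℤ^d`, i.e. the preimage of a subset of
the torus `(ℝ / 2πℤ)^d`. -/
def IsPeriodicSet {d : ℕ} (U : Set (Fin d → ℝ)) : Prop :=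
  ∀ (y : Fin d → ℝ) (k : Fin d → ℤ), y + (2 * Real.pi) • intVec k ∈ U ↔ y ∈ U

/-- `(U w)` is a family of pairwise disjoint open neighborhoods, in the torus, of the points
`w ∈ W` (each given by its periodic preimage in `ℝ^d`). -/
structure IsNbhdFamily {d : ℕ} (W : Set (Fin d → ℝ))
    (U : (Fin d → ℝ) → Set (Fin d → ℝ)) : Prop where
  isOpen : ∀ w ∈ W, IsOpen (U w)
  mem : ∀ w ∈ W, w ∈ U w
  periodic : ∀ w ∈ W, IsPeriodicSet (U w)
  disjoint : W.PairwiseDisjoint U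

/-- `η` is a smooth vector field on the torus (a smooth `2πℤ^d`-periodic map) with
`η y ∈ K^{f,B}(exp (x + i y))` everywhere and `(r / |r|) · η y = 1` outside the neighborhoods
`U w`, `w ∈ W`. -/
structure IsDeformField {d : ℕ} (G : Laurent d) (B : Set (Fin d → ℝ)) (x r : Fin d → ℝ)
    (W : Set (Fin d → ℝ)) (U : (Fin d → ℝ) → Set (Fin d → ℝ))
    (η : (Fin d → ℝ) → (Fin d → ℝ)) : Prop where
  smooth : ContDiff ℝ ∞ η
  periodic : ∀ (y : Fin d → ℝ) (k : Fin d → ℤ), η (y + (2 * Real.pi) • intVec k) = η y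
  mem_cone : ∀ y, η y ∈ hypCone G B x y
  pair_eq : ∀ y, (∀ w ∈ W, y ∉ U w) → pair r (η y) = len r

/-- The homotopy `Φ_t(y) = x + i y + ε [(1 - t) u + t η(y)]`. -/
def homotopy {d : ℕ} (x u : Fin d → ℝ) (η : (Fin d → ℝ) → (Fin d → ℝ)) (ε t : ℝ)
    (y : Fin d → ℝ) : Fin d → ℂ :=
  cvec (x + ε • ((1 - t) • u + t • η y)) y

/-- `L` is the continuation along the homotopy `Φ_t`, `0 ≤ t ≤ 1`, of the branch `ℓ` of
`log f`: `L` is continuous, is a logarithm of `f (Φ_t(y))`, and agrees with `ℓ` at `t = 0`.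
(In particular `f (Φ_t(y)) ≠ 0`.) -/
structure IsContinuedLog {d : ℕ} (f ℓ : (Fin d → ℂ) → ℂ) (Φ : ℝ → (Fin d → ℝ) → (Fin d → ℂ))
    (L : ℝ → (Fin d → ℝ) → ℂ) : Prop where
  continuousOn : ContinuousOn (fun ty : ℝ × (Fin d → ℝ) => L ty.1 ty.2)
    (Set.Icc 0 1 ×ˢ Set.univ)
  exp_eq : ∀ t ∈ Set.Icc (0 : ℝ) 1, ∀ y, Complex.exp (L t y) = f (Φ t y)
  initial : ∀ y, L 0 y = ℓ (Φ 0 y)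

open Classical in
/-- The function `P ∘ exp / ((Q ∘ exp) ^ s ∏ (H_j ∘ exp) ^ n_j)` at the point `z` near `z₀`, where
`P` is the product of `P₀` with the `F_j ^ s_j` such that `F_j` is nonzero at `exp z₀`, `Q` is the
factor with index `q` (if any, with `s = -s_q`), and the `H_j` are the other factors vanishing at
`exp z₀`, with `n_j = -s_j`.  The numbers `lam j` are the logarithms of `F_j (exp z)` that fix
the branches of the powers. -/
def localIntegrand {d m : ℕ} (P₀ : (Fin d → ℂ) → ℂ) (F : Fin m → Laurent d) (s : Fin m → ℝ)
    (q : Option (Fin m)) (n : Fin m → ℕ) (z₀ z : Fin d → ℂ) (lam : Fin m → ℂ) : ℂ :=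
  (P₀ (cexp z) * ∏ j with logf (F j) z₀ ≠ 0, Complex.exp ((s j : ℂ) * lam j)) /
    ((∏ j with q = some j, Complex.exp (((-s j : ℝ) : ℂ) * lam j)) *
      ∏ j with logf (F j) z₀ = 0 ∧ q ≠ some j, logf (F j) z ^ n j)

/-- The integral `∫_C g dz` of a `d`-form `g dz_1 ∧ ⋯ ∧ dz_d` over the chain parametrized by the
restriction of a map `Φ` to the subset `V` of the torus (`V` is a periodic set, and
`g y` is the value of the coefficient at the point `Φ y`). -/
def chainIntegral {d : ℕ} (Φ : (Fin d → ℝ) → (Fin d → ℂ)) (V : Set (Fin d → ℝ))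
    (g : (Fin d → ℝ) → ℂ) : ℂ :=
  ∫ y in V ∩ cube d, g y * (Matrix.of fun i j : Fin d => fderiv ℝ Φ y (Pi.single j 1) i).det

/-- `contrib(w)` at the dual vector `k`: `(1 / 2πi)^d` times the integral of
`exp (-k · z) p(z) / (q(z)^s ∏ h_j(z)^(n_j)) dz` over the local chain `C_w`, which is the
restriction of `Φ_1` to the closure of the neighborhood `Uw` of `w`. -/
def contrib {d m : ℕ} (P₀ : (Fin d → ℂ) → ℂ) (F : Fin m → Laurent d) (s : Fin m → ℝ)
    (q : Option (Fin m)) (n : Fin m → ℕ) (z₀ : Fin d → ℂ) (Φ₁ : (Fin d → ℝ) → (Fin d → ℂ))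
    (L₁ : Fin m → (Fin d → ℝ) → ℂ) (Uw : Set (Fin d → ℝ)) (k : Fin d → ℝ) : ℂ :=
  (1 / (2 * Real.pi * Complex.I)) ^ d *
    chainIntegral Φ₁ (closure Uw) fun y =>
      Complex.exp (-pairC k (Φ₁ y)) *
        localIntegrand P₀ F s q n z₀ (Φ₁ y) fun j => L₁ j y

/-- An open conical neighborhood of `r`. -/
def IsConicalNbhd {d : ℕ} (N : Set (Fin d → ℝ)) (r : Fin d → ℝ) : Prop :=
  IsOpen N ∧ r ∈ N ∧ ∀ v ∈ N, ∀ c : ℝ, 0 < c → c • v ∈ N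

end QuadPoint

end

/-!
Write `f = G ∘ exp` for `G = ∏ F_j`. The coefficient `a_k` is a Cauchy integral over a torus in the
tube over `B`, and the theorem holds because this torus can be pushed along the homotopy `Φ` to one
on which the integrand is exponentially small away from the critical points. What has to be shown is
that the directions `η y` exist and that `f` has no zeros along the homotopy.

The absence of zeros rests on one principle, `ne_zero_of_ne_zero_frontier`: in a connected family of
holomorphic functions without zeros on the boundary of a fixed region, either no member or every
member has a zero in the region. It yields

* Hurwitz' theorem in the form `IsLeadingPart.isHyperbolic`: directions in which `f` has no zeros near
  a point are directions of hyperbolicity of its leading homogeneous part there; in particular the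
  tangent cone of `B` lies in each cone `K y`;
* Gårding's convexity of the cones of hyperbolicity, `isHyperbolic_add`;
* local hyperbolicity, `IsLeadingPart.exists_ne_zero`: as `f` has no zeros over `B`, it has none near
  the base point over the cone spanned by a tangent direction of `B` and a neighborhood of any
  direction in `K y`.

The last fact gives both the semicontinuity of `y ↦ K y`
(`IsAmoebaComplComponent.eventually_mem_hypCone`) and, by compactness of the torus, the absence of
zeros along the homotopy for small `ε` (`eventually_logf_homotopy_ne_zero`). The component `B` is
convex by the three lines theorem for `1 / f` (`IsAmoebaComplComponent.convex`), so its tangent cones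
are nonempty and behave like those of a convex set. At noncritical `y` some direction of `K y` pairs
positively with `r`, and can be scaled to `r · v = |r|`. Semicontinuity and convexity then allow a
partition of unity on the torus to glue such directions to `η` (`exists_smooth_periodic_selection`).

The branches of the logarithms continue along the homotopy as integrals of logarithmic derivatives
(`contLog`). Each of them may change over a period, but the product of the powers with `P₀` does not
(`continued_product_periodic`), since on the tube it is the sum of a Laurent series. The integrals over
the two ends of the homotopy agree by the divergence theorem on `[0, 1] × [0, 2π] ^ d`
(`integral_deformation`): the faces in the torus directions cancel by periodicity, and the divergence
vanishes by Cramer's rule and the symmetry of second derivatives. Finally, at points `y` outside the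
neighborhoods `U w` the relation `r · η y = |r|` bounds the integrand by a multiple of
`exp (-k · x_max - ε |k| / 2)` for `k` in a conical neighborhood of `r`. This also covers the
boundaries of the `U w`, which may have positive measure (`norm_integral_cube_sub_sum_le`).

The local integrand at a critical point groups the factors by whether they vanish there. Since the
exponents of the vanishing factors are `-s` and `-n_i`, it is the continued product of all the powers
(`localIntegrand_eq`), so that each local contribution is the integral of `F` over a part of the
deformed torus.
-/

open scoped ContDiff Topology

noncomputable section

namespace QuadPoint

/-! ### Exponential sums -/

section ExponentialSums

variable {d : ℕ}

/-- The character `k ↦ exp (k · z)` of `ℤ ^ d`. -/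
def expChar (z : Fin d → ℂ) : Multiplicative (Fin d → ℤ) →* ℂ where
  toFun k := Complex.exp (pairC (intVec k.toAdd) z)
  map_one' := by simp [pairC, intVec]
  map_mul' k l := by
    simp [pairC, intVec, ← Complex.exp_add, add_mul, Finset.sum_add_distrib]

theorem logf_eq_sum (F : Laurent d) (z : Fin d → ℂ) :
    logf F z = ∑ k ∈ F.coeff.support, F.coeff k * Complex.exp (pairC (intVec k) z) := by
  simp only [logf, leval, cexp, Finsupp.sum, pairC, intVec, Complex.exp_sum]
  refine Finset.sum_congr rfl fun k _ => ?_
  congr 1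
  refine Finset.prod_congr rfl fun i _ => ?_
  rw [← Complex.exp_int_mul]
  simp

theorem logf_eq_lift (F : Laurent d) (z : Fin d → ℂ) :
    logf F z = AddMonoidAlgebra.lift ℂ ℂ _ (expChar z) F := by
  rw [AddMonoidAlgebra.lift_apply, logf_eq_sum]
  rfl

theorem logf_prod {ι : Type*} (S : Finset ι) (F : ι → Laurent d) (z : Fin d → ℂ) :
    logf (∏ j ∈ S, F j) z = ∏ j ∈ S, logf (F j) z := by
  simp only [logf_eq_lift, map_prod]

theorem differentiable_logf (F : Laurent d) : Differentiable ℂ (logf F) := by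
  have : logf F = fun z => ∑ k ∈ F.coeff.support,
      F.coeff k * Complex.exp (pairC (intVec k) z) := funext (logf_eq_sum F)
  rw [this]
  unfold pairC
  fun_prop

theorem continuous_logf (F : Laurent d) : Continuous (logf F) :=
  (differentiable_logf F).continuous

theorem cvec_add_period (x y : Fin d → ℝ) (k : Fin d → ℤ) :
    cexp (cvec x (y + (2 * Real.pi) • intVec k)) = cexp (cvec x y) := by
  funext i
  simp only [cexp, cvec, Pi.add_apply, Pi.smul_apply, intVec, smul_eq_mul]
  rw [Complex.exp_eq_exp_iff_exists_int]
  exact ⟨k i, by push_cast; ring⟩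

theorem logf_periodic (F : Laurent d) (x y : Fin d → ℝ) (k : Fin d → ℤ) :
    logf F (cvec x (y + (2 * Real.pi) • intVec k)) = logf F (cvec x y) := by
  simp only [logf, cvec_add_period]

/-- The `n`-th Taylor remainder of the exponential divided by `ζ ^ n`. -/
def expTail (n : ℕ) : ℂ → ℂ := (Function.swap dslope 0)^[n] Complex.exp

theorem differentiable_expTail (n : ℕ) : Differentiable ℂ (expTail n) := by
  induction n with
  | zero => exact Complex.differentiable_exp
  | succ n ih =>
    have h : expTail (n + 1) = dslope (expTail n) 0 := by
      simp only [expTail, Function.iterate_succ_apply', Function.swap]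
    rw [h, ← differentiableOn_univ]
    exact (Complex.differentiableOn_dslope Filter.univ_mem).2 ih.differentiableOn

theorem expTail_zero (n : ℕ) : expTail n 0 = 1 / (n.factorial : ℂ) := by
  have h1 : HasFPowerSeriesAt Complex.exp (NormedSpace.expSeries ℂ ℂ) 0 := by
    rw [Complex.exp_eq_exp_ℂ]
    exact NormedSpace.exp_hasFPowerSeriesAt_zero
  have h := h1.has_fpower_series_iterate_dslope_fslope n
  have := h.coeff_zero ![]
  have h2 : expTail n 0 = (FormalMultilinearSeries.fslope^[n] (NormedSpace.expSeries ℂ ℂ)).coeff 0 := by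
    rw [FormalMultilinearSeries.coeff, expTail, ← this]
    congr 1
    exact Subsingleton.elim _ _
  rw [h2, FormalMultilinearSeries.coeff_iterate_fslope]
  simp [FormalMultilinearSeries.coeff, NormedSpace.expSeries]

theorem exp_eq_sum_add_expTail (n : ℕ) (ζ : ℂ) :
    Complex.exp ζ = ∑ j ∈ Finset.range n, ζ ^ j / (j.factorial : ℂ) + ζ ^ n * expTail n ζ := by
  induction n with
  | zero => simp [expTail]
  | succ n ih =>
    have h : ζ * expTail (n + 1) ζ = expTail n ζ - expTail n 0 := by
      have := sub_smul_dslope (expTail n) 0 ζ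
      simpa [expTail, Function.iterate_succ_apply', Function.swap] using this
    rw [Finset.sum_range_succ, pow_succ, mul_assoc, h, expTail_zero, ih]
    ring

theorem taylorPart_logf (F : Laurent d) (z : Fin d → ℂ) (n : ℕ) (w : Fin d → ℂ) :
    taylorPart (logf F) z n w = ∑ k ∈ F.coeff.support,
      F.coeff k * Complex.exp (pairC (intVec k) z) *
        (pairC (intVec k) w ^ n / (n.factorial : ℂ)) := by
  have h : (fun t : ℂ => logf F (z + t • w)) = fun t : ℂ => ∑ k ∈ F.coeff.support,
      (F.coeff k * Complex.exp (pairC (intVec k) z)) *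
        Complex.exp (pairC (intVec k) w * t) := by
    funext t
    rw [logf_eq_sum]
    refine Finset.sum_congr rfl fun k _ => ?_
    rw [mul_assoc, ← Complex.exp_add]
    congr 2
    simp only [pairC, Pi.add_apply, Pi.smul_apply, smul_eq_mul, mul_add, Finset.sum_add_distrib,
      Finset.sum_mul]
    congr 1
    exact Finset.sum_congr rfl fun i _ => by ring
  rw [taylorPart, h, iteratedDeriv_fun_sum, Finset.sum_div]
  · refine Finset.sum_congr rfl fun k _ => ?_
    rw [iteratedDeriv_const_mul_field, iteratedDeriv_cexp_const_mul]
    simp [mul_div_assoc]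
  · intro k _
    fun_prop

/-- The expansion of an exponential sum up to its leading homogeneous part: `A` is the homogeneous
part of degree `n` of `f (z₀ + ·)`, and `f (z₀ + ε w) / ε ^ n` extends continuously to `ε = 0`, with
value `A w`. -/
structure IsLeadingPart (f : (Fin d → ℂ) → ℂ) (z₀ : Fin d → ℂ) (n : ℕ)
    (A : (Fin d → ℂ) → ℂ) (g : ℂ × (Fin d → ℂ) → ℂ) : Prop where
  differentiable : Differentiable ℂ A
  homogeneous : ∀ (c : ℂ) w, A (c • w) = c ^ n * A w
  nontrivial : ∃ w, A w ≠ 0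
  continuous : Continuous g
  differentiable_right : ∀ ε : ℂ, Differentiable ℂ fun w => g (ε, w)
  expansion : ∀ (ε : ℂ) w, f (z₀ + ε • w) = ε ^ n * g (ε, w)
  leading : ∀ w, g (0, w) = A w

theorem exists_isLeadingPart (F : Laurent d) (hF : ∃ z, logf F z ≠ 0) (z₀ : Fin d → ℂ) :
    ∃ g, IsLeadingPart (logf F) z₀ (vanishDeg (logf F) z₀) (homPart (logf F) z₀) g := by
  have hne : {n : ℕ | ∃ w, taylorPart (logf F) z₀ n w ≠ 0}.Nonempty := by
    by_contra hcon
    obtain ⟨z, hz⟩ := hF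
    apply hz
    have h0 : ∀ n, taylorPart (logf F) z₀ n (z - z₀) = 0 := by
      intro n
      by_contra h
      exact hcon ⟨n, z - z₀, h⟩
    have hd : Differentiable ℂ fun t : ℂ => logf F (z₀ + t • (z - z₀)) :=
      (differentiable_logf F).comp (by fun_prop)
    have h1 := Complex.taylorSeries_eq_of_entire' 0 1 hd
    have h2 : logf F z = ∑' n : ℕ, (n.factorial : ℂ)⁻¹ *
        iteratedDeriv n (fun t : ℂ => logf F (z₀ + t • (z - z₀))) 0 * (1 - 0) ^ n := by
      rw [h1]
      simp
    rw [h2]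
    refine (tsum_congr fun n => ?_).trans tsum_zero
    have := h0 n
    rw [taylorPart] at this
    rw [inv_mul_eq_div, this, zero_mul]
  set n := vanishDeg (logf F) z₀ with hn
  have hlow : ∀ j < n, ∀ w, taylorPart (logf F) z₀ j w = 0 := by
    intro j hj w
    by_contra h
    exact Nat.notMem_of_lt_sInf hj ⟨w, h⟩
  have hA : ∀ w, homPart (logf F) z₀ w = ∑ k ∈ F.coeff.support,
      F.coeff k * Complex.exp (pairC (intVec k) z₀) *
        (pairC (intVec k) w ^ n / (n.factorial : ℂ)) := fun w => taylorPart_logf F z₀ n w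
  refine ⟨fun p => ∑ k ∈ F.coeff.support, F.coeff k * Complex.exp (pairC (intVec k) z₀) *
    (pairC (intVec k) p.2 ^ n * expTail n (p.1 * pairC (intVec k) p.2)), ?_, ?_, ?_, ?_, ?_, ?_, ?_⟩
  · rw [show homPart (logf F) z₀ = _ from funext hA]
    unfold pairC
    fun_prop
  · intro c w
    rw [hA, hA, Finset.mul_sum]
    refine Finset.sum_congr rfl fun k _ => ?_
    have : pairC (intVec k) (c • w) = c * pairC (intVec k) w := by
      simp only [pairC, Pi.smul_apply, smul_eq_mul, Finset.mul_sum]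
      exact Finset.sum_congr rfl fun i _ => by ring
    rw [this, mul_pow]
    ring
  · exact Nat.sInf_mem hne
  · have := (differentiable_expTail n).continuous
    unfold pairC
    fun_prop
  · intro ε
    have := differentiable_expTail n
    unfold pairC
    fun_prop
  · intro ε w
    have hp : ∀ k : Fin d → ℤ, pairC (intVec k) (z₀ + ε • w) =
        pairC (intVec k) z₀ + ε * pairC (intVec k) w := by
      intro k
      simp only [pairC, Pi.add_apply, Pi.smul_apply, smul_eq_mul, mul_add, Finset.sum_add_distrib,
        Finset.mul_sum]
      congr 1
      exact Finset.sum_congr rfl fun i _ => by ring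
    have h0 : ∑ k ∈ F.coeff.support, F.coeff k * Complex.exp (pairC (intVec k) z₀) *
        ∑ j ∈ Finset.range n, (ε * pairC (intVec k) w) ^ j / (j.factorial : ℂ) = 0 := by
      simp only [Finset.mul_sum]
      rw [Finset.sum_comm]
      refine Finset.sum_eq_zero fun j hj => ?_
      have := hlow j (Finset.mem_range.1 hj) w
      rw [taylorPart_logf] at this
      calc _ = ε ^ j * ∑ k ∈ F.coeff.support, F.coeff k * Complex.exp (pairC (intVec k) z₀) *
            (pairC (intVec k) w ^ j / (j.factorial : ℂ)) := by
            rw [Finset.mul_sum]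
            refine Finset.sum_congr rfl fun k _ => ?_
            rw [mul_pow]
            ring
        _ = 0 := by rw [this, mul_zero]
    rw [logf_eq_sum, ← sub_zero (∑ k ∈ _, _), ← h0, ← Finset.sum_sub_distrib, Finset.mul_sum]
    refine Finset.sum_congr rfl fun k _ => ?_
    rw [hp, Complex.exp_add, exp_eq_sum_add_expTail n (ε * pairC (intVec k) w), mul_pow]
    ring
  · intro w
    rw [hA]
    refine Finset.sum_congr rfl fun k _ => ?_
    simp only [zero_mul, expTail_zero]
    ring

end ExponentialSums

/-! ### Persistence of the absence of zeros -/

section Persistence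

/-- If a connected family of holomorphic functions has no zeros on the boundary of a bounded
region, and one member has no zeros in the region, then none has: by the minimum modulus
principle, zero-free members stay bounded away from zero. -/
theorem ne_zero_of_ne_zero_frontier {X : Type*} [TopologicalSpace X] {S : Set X}
    (hS : IsPreconnected S) {U : Set ℂ} (hU : Bornology.IsBounded U) {g : X × ℂ → ℂ}
    (hg : Continuous g) (hd : ∀ x, Differentiable ℂ fun ζ => g (x, ζ))
    (hfr : ∀ x ∈ S, ∀ ζ ∈ frontier U, g (x, ζ) ≠ 0) {x₀ : X} (hx₀ : x₀ ∈ S)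
    (h₀ : ∀ ζ ∈ closure U, g (x₀, ζ) ≠ 0) : ∀ x ∈ S, ∀ ζ ∈ closure U, g (x, ζ) ≠ 0 := by
  have hK : IsCompact (closure U) := hU.isCompact_closure
  have hF : IsCompact (frontier U) := hK.of_isClosed_subset isClosed_frontier
    frontier_subset_closure
  have hopen : IsOpen {x | ∀ ζ ∈ closure U, g (x, ζ) ≠ 0} := by
    rw [isOpen_iff_mem_nhds]
    intro x hx
    exact hK.eventually_forall_of_forall_eventually fun ζ hζ =>
      hg.continuousAt.eventually_ne (hx ζ hζ)
  refine hS.subset_of_closure_inter_subset hopen ⟨x₀, hx₀, h₀⟩ ?_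
  rintro x ⟨hxc, hxS⟩ ζ₀ hζ₀
  obtain ⟨c, hc, hcx⟩ := hF.exists_forall_le' (f := fun ζ => ‖g (x, ζ)‖) (a := 0)
    (by fun_prop) fun ζ hζ => norm_pos_iff.2 (hfr x hxS ζ hζ)
  have hev : ∀ᶠ x' in 𝓝 x, ∀ ζ ∈ frontier U, c / 2 < ‖g (x', ζ)‖ :=
    hF.eventually_forall_of_forall_eventually fun ζ hζ =>
      hg.norm.continuousAt.eventually (lt_mem_nhds (by
        have := hcx ζ hζ
        show c / 2 < ‖g (x, ζ)‖
        linarith))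
  -- At zero-free members near `x`, the maximum principle for the inverse gives a bound that does
  -- not depend on the member and hence passes to the limit `x`.
  have hfreq : ∃ᶠ x' in 𝓝 x, c / 2 ≤ ‖g (x', ζ₀)‖ := by
    refine ((mem_closure_iff_frequently.1 hxc).and_eventually hev).mono ?_
    rintro x' ⟨hx', hx'f⟩
    have hdc : DiffContOnCl ℂ (fun ζ => (g (x', ζ))⁻¹) U :=
      (hd x').diffContOnCl.inv hx'
    have := Complex.norm_le_of_forall_mem_frontier_norm_le hU hdc (C := (c / 2)⁻¹)
      (fun ζ hζ => by
        rw [norm_inv]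
        exact inv_anti₀ (by positivity) (hx'f ζ hζ).le) hζ₀
    rw [norm_inv] at this
    exact (inv_le_inv₀ (norm_pos_iff.2 (hx' _ hζ₀)) (by positivity)).1 this
  have : c / 2 ≤ ‖g (x, ζ₀)‖ := by
    have hcl : IsClosed {x' | c / 2 ≤ ‖g (x', ζ₀)‖} :=
      isClosed_le continuous_const (by fun_prop)
    exact hcl.mem_of_frequently_of_tendsto hfreq Filter.tendsto_id
  exact norm_pos_iff.1 (by linarith)

/-- The right half of the open disc of radius `R` about the origin. -/
def halfDisc (R : ℝ) : Set ℂ := {s | 0 < s.re} ∩ Metric.ball 0 R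

theorem isBounded_halfDisc (R : ℝ) : Bornology.IsBounded (halfDisc R) :=
  Metric.isBounded_ball.subset Set.inter_subset_right

theorem of_mem_closure_halfDisc {R : ℝ} {s : ℂ} (hs : s ∈ closure (halfDisc R)) :
    0 ≤ s.re ∧ ‖s‖ ≤ R := by
  have h := closure_inter_subset_inter_closure _ _ hs
  rw [Complex.closure_setOfPred_lt_re] at h
  exact ⟨h.1, by simpa using Metric.closure_ball_subset_closedBall h.2⟩

theorem of_mem_frontier_halfDisc {R : ℝ} (hR : R ≠ 0) {s : ℂ} (hs : s ∈ frontier (halfDisc R)) :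
    s.re = 0 ∨ (0 ≤ s.re ∧ ‖s‖ = R) := by
  rcases frontier_inter_subset _ _ hs with h | h
  · rw [Complex.frontier_setOfPred_lt_re] at h
    exact Or.inl h.1
  · rw [Complex.closure_setOfPred_lt_re, frontier_ball _ hR] at h
    exact Or.inr ⟨h.1, by simpa using h.2⟩

end Persistence

/-! ### Hyperbolic homogeneous polynomials -/

section Hyperbolic

variable {d : ℕ}

/-- The inclusion of `ℝ ^ d` in `ℂ ^ d`. -/
def toC (v : Fin d → ℝ) : Fin d → ℂ := fun i => (v i : ℂ)

@[fun_prop]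
theorem continuous_toC : Continuous (toC (d := d)) := by
  unfold toC
  fun_prop

@[simp] theorem toC_add (v w : Fin d → ℝ) : toC (v + w) = toC v + toC w := by
  ext i; simp [toC]

@[simp] theorem toC_sub (v w : Fin d → ℝ) : toC (v - w) = toC v - toC w := by
  ext i; simp [toC]

@[simp] theorem toC_smul (c : ℝ) (v : Fin d → ℝ) : toC (c • v) = (c : ℂ) • toC v := by
  ext i; simp [toC]

@[simp] theorem toC_zero : toC (0 : Fin d → ℝ) = 0 := by
  ext i; simp [toC]

/-- A complex vector is the sum of its real part and `i` times its imaginary part. -/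
theorem eq_cvec (w : Fin d → ℂ) : w = cvec (fun i => (w i).re) fun i => (w i).im := by
  ext i; simp [cvec]

variable {A : (Fin d → ℂ) → ℂ} {n : ℕ}

theorem IsHyperbolic.ne_zero {v : Fin d → ℝ} (h : IsHyperbolic A v) : A (toC v) ≠ 0 := h.1

/-- A homogeneous polynomial is hyperbolic in direction `v` iff it has no zeros over `v`. -/
theorem isHyperbolic_iff (hA : ∀ (c : ℂ) w, A (c • w) = c ^ n * A w) (v : Fin d → ℝ) :
    IsHyperbolic A v ↔ ∀ y, A (toC v + Complex.I • toC y) ≠ 0 := by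
  constructor
  · rintro ⟨h0, h⟩ y hy
    have h1 := h y (-Complex.I) (by
      have := hA (-Complex.I) (toC v + Complex.I • toC y)
      rw [hy, mul_zero] at this
      rw [← this]
      congr 1
      ext i
      simp only [toC, Pi.smul_apply, Pi.add_apply, smul_eq_mul]
      linear_combination (y i : ℂ) * Complex.I_mul_I)
    simp at h1
  · intro h
    refine ⟨by
      have h0 := h 0
      rwa [toC_zero, smul_zero, add_zero] at h0, fun x t ht => ?_⟩
    by_contra him
    apply h ((-1 / t.im) • (x + t.re • v))
    have hi : (t.im : ℂ) ≠ 0 := by exact_mod_cast him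
    have := hA ((Complex.I * t.im)⁻¹) (fun i => (x i : ℂ) + t * (v i : ℂ))
    rw [ht, mul_zero] at this
    rw [← this]
    congr 1
    ext i
    simp only [toC, Pi.smul_apply, Pi.add_apply, smul_eq_mul, Complex.ofReal_mul,
      Complex.ofReal_add, Complex.ofReal_div, Complex.ofReal_neg, Complex.ofReal_one]
    have htt := (Complex.re_add_im t).symm
    generalize t.re = a at htt ⊢
    generalize t.im = b at htt hi ⊢
    have hI := Complex.I_ne_zero
    rw [htt]
    field_simp
    linear_combination (-(x i : ℂ) - a * v i) * Complex.I_sq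

/-- On a connected set `S` of directions of hyperbolicity, `A` has no zero on the segments between
points of `S`. The segment is covered by the disc in the complex line through its ends that has it
as diameter: as one end moves in `S` from the other, hyperbolicity excludes zeros on the circle. -/
theorem ne_zero_of_mem_segment (hd : Differentiable ℂ A)
    (hA : ∀ (c : ℂ) w, A (c • w) = c ^ n * A w) {S : Set (Fin d → ℝ)} (hS : IsPreconnected S)
    (hyp : ∀ v ∈ S, IsHyperbolic A v) {v₁ v₂ : Fin d → ℝ} (h₁ : v₁ ∈ S) (h₂ : v₂ ∈ S)
    {t : ℝ} (ht : t ∈ Set.Icc (0 : ℝ) 1) :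
    A (((1 - t : ℝ) : ℂ) • toC v₁ + (t : ℂ) • toC v₂) ≠ 0 := by
  have hg : Continuous fun p : (Fin d → ℝ) × ℂ =>
      A ((1 - p.2) • toC p.1 + p.2 • toC v₂) := by
    have := hd.continuous
    fun_prop
  have key := ne_zero_of_ne_zero_frontier hS (U := Metric.ball (1 / 2 : ℂ) (1 / 2))
    Metric.isBounded_ball hg (fun x => hd.comp (by dsimp only; fun_prop)) ?_ h₂ ?_ v₁ h₁ (t : ℂ) ?_
  · simpa using key
  · intro v hv ζ hζ
    rw [frontier_ball _ (by norm_num), mem_sphere_iff_norm] at hζ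
    by_cases h1 : ζ = 1
    · subst h1
      simpa using (hyp v₂ h₂).ne_zero
    have h1' : (1 - ζ) ≠ 0 := sub_ne_zero.2 (Ne.symm h1)
    by_cases hz : ζ = 0
    · subst hz
      simpa using (hyp v hv).ne_zero
    intro h0
    have him : ζ.im ≠ 0 := by
      intro him
      have hre : ζ = (ζ.re : ℂ) := by
        apply Complex.ext <;> simp [him]
      rw [hre, show ((ζ.re : ℂ) - 1 / 2) = ((ζ.re - 1 / 2 : ℝ) : ℂ) by push_cast; ring,
        Complex.norm_real, Real.norm_eq_abs] at hζ
      rcases (abs_eq (by norm_num)).1 hζ with h | h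
      · exact h1 (by rw [hre, show ζ.re = 1 by linarith]; simp)
      · exact hz (by rw [hre, show ζ.re = 0 by linarith]; simp)
    -- A zero at `ζ` gives the real root `q = ζ / (1 - ζ)` of `A (v + q v₂)`, so `ζ = q / (1 + q)`
    -- is real, but the circle meets the reals only at `0` and `1`.
    have h2 := (hyp v₂ h₂).2 v (ζ / (1 - ζ)) (by
      have := hA ((1 - ζ)⁻¹) ((1 - ζ) • toC v + ζ • toC v₂)
      rw [h0, mul_zero] at this
      rw [← this]
      congr 1
      ext i
      simp only [toC, Pi.smul_apply, Pi.add_apply, smul_eq_mul]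
      field_simp)
    have h3 : ζ = (ζ / (1 - ζ)) * (1 - ζ) := by field_simp
    set q := ζ / (1 - ζ) with hq
    have h4 : ζ * (1 + q) = q := by linear_combination h3
    have h5 := congrArg Complex.im h4
    have h6 := congrArg Complex.re h4
    simp only [Complex.mul_im, Complex.mul_re, Complex.add_re, Complex.add_im, h2,
      Complex.one_re, Complex.one_im] at h5 h6
    have h7 : 1 + q.re = 0 := by
      have : ζ.im * (1 + q.re) = 0 := by linarith
      exact (mul_eq_zero.1 this).resolve_left him
    rw [h7] at h6
    simp at h6
    linarith
  · intro ζ _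
    have : (1 - ζ) • toC v₂ + ζ • toC v₂ = toC v₂ := by
      rw [← add_smul]; simp
    show A ((1 - ζ) • toC v₂ + ζ • toC v₂) ≠ 0
    rw [this]
    exact (hyp v₂ h₂).1
  · rw [closure_ball _ (by norm_num), mem_closedBall_iff_norm,
      show ((t : ℂ) - 1 / 2) = ((t - 1 / 2 : ℝ) : ℂ) by push_cast; ring,
      Complex.norm_real, Real.norm_eq_abs, abs_le]
    constructor <;> linarith [ht.1, ht.2]

/-- No zeros on the cone over `v₁` and `v₂` whose first coefficient ranges over the closed right half
plane: real coefficients are covered by the segment, the others by hyperbolicity in direction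
`v₁`. -/
theorem ne_zero_of_nonneg_comb (hd : Differentiable ℂ A)
    (hA : ∀ (c : ℂ) w, A (c • w) = c ^ n * A w) {S : Set (Fin d → ℝ)} (hS : IsPreconnected S)
    (hyp : ∀ v ∈ S, IsHyperbolic A v) {v₁ v₂ : Fin d → ℝ} (h₁ : v₁ ∈ S) (h₂ : v₂ ∈ S)
    {σ : ℂ} {τ : ℝ} (hσ : 0 ≤ σ.re) (hτ : 0 ≤ τ) (hne : σ ≠ 0 ∨ τ ≠ 0) :
    A (σ • toC v₁ + (τ : ℂ) • toC v₂) ≠ 0 := by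
  by_cases him : σ.im = 0
  · have hre : σ = (σ.re : ℂ) := by apply Complex.ext <;> simp [him]
    have hpos : 0 < σ.re + τ := by
      rcases hne with h | h
      · have : σ.re ≠ 0 := fun h' => h (by rw [hre, h']; simp)
        have := lt_of_le_of_ne hσ (Ne.symm this)
        linarith
      · have := lt_of_le_of_ne hτ (Ne.symm h)
        linarith
    have := ne_zero_of_mem_segment hd hA hS hyp h₁ h₂ (t := τ / (σ.re + τ))
      ⟨by positivity, by rw [div_le_one hpos]; linarith⟩
    intro h0
    apply this
    have h2 := hA ((σ.re + τ : ℝ) : ℂ)⁻¹ (σ • toC v₁ + (τ : ℂ) • toC v₂)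
    rw [h0, mul_zero] at h2
    rw [← h2]
    congr 1
    have hp : ((σ.re : ℂ) + (τ : ℂ)) ≠ 0 := by exact_mod_cast hpos.ne'
    ext i
    simp only [toC, Pi.smul_apply, Pi.add_apply, smul_eq_mul]
    generalize σ.re = a at hre hp ⊢
    rw [hre]
    push_cast
    field_simp
    ring
  · intro h0
    apply him
    refine (hyp v₁ h₁).2 (τ • v₂) σ ?_
    rw [← h0]
    congr 1
    ext i
    simp only [toC, Pi.smul_apply, Pi.add_apply, smul_eq_mul, Complex.ofReal_mul]
    ring

/-- Gårding's convexity: positive combinations of two directions in a connected set of directions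
of hyperbolicity are directions of hyperbolicity. -/
theorem isHyperbolic_add (hd : Differentiable ℂ A)
    (hA : ∀ (c : ℂ) w, A (c • w) = c ^ n * A w) {S : Set (Fin d → ℝ)} (hS : IsPreconnected S)
    (hyp : ∀ v ∈ S, IsHyperbolic A v) {v₁ v₂ : Fin d → ℝ} (h₁ : v₁ ∈ S) (h₂ : v₂ ∈ S)
    {σ : ℝ} (hσ : 0 ≤ σ) : IsHyperbolic A (σ • v₁ + v₂) := by
  rw [isHyperbolic_iff hA]
  intro y
  have hc := hd.continuous
  have hv₁ : A (toC v₁) ≠ 0 := (hyp v₁ h₁).1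
  -- On large half-circles the term `s v₁` dominates.
  have hev : ∀ᶠ ρ : ℂ in 𝓝 0, ∀ y' ∈ Metric.closedBall (0 : Fin d → ℝ) ‖y‖,
      A (toC v₁ + ρ • (toC v₂ + Complex.I • toC y')) ≠ 0 := by
    refine (isCompact_closedBall _ _).eventually_forall_of_forall_eventually fun y' _ => ?_
    have : ContinuousAt (fun p : ℂ × (Fin d → ℝ) =>
        A (toC v₁ + p.1 • (toC v₂ + Complex.I • toC p.2))) (0, y') := by fun_prop
    exact this.eventually_ne (by simpa using hv₁)
  obtain ⟨δ, hδ, hball⟩ := Metric.eventually_nhds_iff.1 hev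
  obtain ⟨R, hR1, hR2⟩ : ∃ R : ℝ, σ < R ∧ 1 / δ < R :=
    ⟨max σ (1 / δ) + 1, by linarith [le_max_left σ (1 / δ)], by
      linarith [le_max_right σ (1 / δ)]⟩
  have hR0 : 0 < R := lt_of_le_of_lt hσ hR1
  have hg : Continuous fun p : (Fin d → ℝ) × ℂ =>
      A (p.2 • toC v₁ + (toC v₂ + Complex.I • toC p.1)) := by fun_prop
  rcases hσ.eq_or_lt with rfl | hσpos
  · simpa using (isHyperbolic_iff hA v₂).1 (hyp v₂ h₂) y
  -- The zeros of `s ↦ A (s v₁ + v₂ + i y)` cannot enter the half disc as `y` moves from `0`.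
  have key := ne_zero_of_ne_zero_frontier (S := Metric.closedBall (0 : Fin d → ℝ) ‖y‖)
    (convex_closedBall _ _).isPreconnected (isBounded_halfDisc R) hg
    (fun x => hd.comp (by dsimp only; fun_prop)) ?_ (x₀ := 0) (by simp) ?_ y (by simp) (σ : ℂ) ?_
  · simpa [add_assoc] using key
  · intro y' hy' s hs
    rcases of_mem_frontier_halfDisc hR0.ne' hs with hs | ⟨_, hs⟩
    · have := (isHyperbolic_iff hA v₂).1 (hyp v₂ h₂) (y' + s.im • v₁)
      have hsI : s = s.im * Complex.I := by apply Complex.ext <;> simp [hs]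
      convert this using 2
      rw [hsI]
      ext i
      simp [toC]
      ring
    · have hs0 : s ≠ 0 := by
        rintro rfl
        simp at hs
        exact hR0.ne hs
      have h1 := hball (y := s⁻¹) (by
        rw [dist_zero_right, norm_inv, hs]
        rw [one_div] at hR2
        exact inv_lt_of_inv_lt₀ hδ hR2) y' hy'
      intro h0
      apply h1
      have h2 := hA s⁻¹ (s • toC v₁ + (toC v₂ + Complex.I • toC y'))
      rw [h0, mul_zero] at h2
      rw [← h2, smul_add s⁻¹ (s • toC v₁), smul_smul s⁻¹ s, inv_mul_cancel₀ hs0, one_smul]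
  · intro s hs
    have := ne_zero_of_nonneg_comb hd hA hS hyp h₁ h₂ (of_mem_closure_halfDisc hs).1
      zero_le_one (Or.inr one_ne_zero)
    simpa using this
  · refine subset_closure ⟨by simpa using hσpos, ?_⟩
    simpa [abs_of_pos hσpos] using hR1

end Hyperbolic

/-! ### Local hyperbolicity -/

section LocalHyperbolicity

variable {d : ℕ}

theorem norm_re_le (z : Fin d → ℂ) : ‖fun i => (z i).re‖ ≤ ‖z‖ :=
  (pi_norm_le_iff_of_nonneg (norm_nonneg _)).2 fun i =>
    (Complex.abs_re_le_norm (z i)).trans (norm_le_pi_norm z i)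

theorem norm_im_le (z : Fin d → ℂ) : ‖fun i => (z i).im‖ ≤ ‖z‖ :=
  (pi_norm_le_iff_of_nonneg (norm_nonneg _)).2 fun i =>
    (Complex.abs_im_le_norm (z i)).trans (norm_le_pi_norm z i)

variable {f A : (Fin d → ℂ) → ℂ} {z₀ : Fin d → ℂ} {n : ℕ} {g : ℂ × (Fin d → ℂ) → ℂ}

/-- If `f` has no zeros in the real directions near `v`, locally near `z₀ + i ℝ ^ d`, then by
Hurwitz' theorem, applied to the rescalings of `f`, its leading part is hyperbolic in
direction `v`. -/
theorem IsLeadingPart.isHyperbolic (L : IsLeadingPart f z₀ n A g) {v : Fin d → ℝ} {δ : ℝ}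
    (hδ : 0 < δ) (hf : ∀ v' ∈ Metric.ball v δ, ∀ y ∈ Metric.ball (0 : Fin d → ℝ) δ,
      ∀ s ∈ Set.Ioo 0 δ, f (z₀ + Complex.I • toC y + (s : ℂ) • toC v') ≠ 0) :
    IsHyperbolic A v := by
  rw [isHyperbolic_iff L.homogeneous]
  intro y h0
  set w₀ := toC v + Complex.I • toC y with hw₀
  obtain ⟨w₁, hw₁⟩ := L.nontrivial
  have hdφ : Differentiable ℂ fun ζ : ℂ => A (w₀ + ζ • (w₁ - w₀)) :=
    L.differentiable.comp (by fun_prop)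
  -- A zero `w₀` of `A` is isolated on a suitable complex line through it.
  have hiso : ∀ᶠ ζ : ℂ in 𝓝[≠] 0, A (w₀ + ζ • (w₁ - w₀)) ≠ 0 := by
    by_contra hcon
    have h1 : ∃ᶠ ζ : ℂ in 𝓝[≠] 0, A (w₀ + ζ • (w₁ - w₀)) = 0 := hcon
    have h2 := (hdφ.differentiableOn.analyticOnNhd
      isOpen_univ).eqOn_zero_of_preconnected_of_frequently_eq_zero
      isPreconnected_univ (Set.mem_univ (0 : ℂ)) h1 (Set.mem_univ 1)
    apply hw₁
    simpa using h2
  obtain ⟨ρ₀, hρ₀, hball⟩ := Metric.eventually_nhds_iff.1 (eventually_nhdsWithin_iff.1 hiso)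
  have hN : 0 < ‖w₁ - w₀‖ + 1 := by positivity
  have hY : 0 < ‖y‖ + δ + 1 := by positivity
  obtain ⟨ρ, hρ, hρ1, hρ2⟩ : ∃ ρ : ℝ, 0 < ρ ∧ ρ < ρ₀ ∧ ρ * (‖w₁ - w₀‖ + 1) < δ := by
    refine ⟨min (ρ₀ / 2) (δ / (2 * (‖w₁ - w₀‖ + 1))), by positivity, ?_, ?_⟩
    · exact lt_of_le_of_lt (min_le_left _ _) (by linarith)
    · calc _ ≤ δ / (2 * (‖w₁ - w₀‖ + 1)) * (‖w₁ - w₀‖ + 1) := by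
            gcongr
            exact min_le_right _ _
        _ = δ / 2 := by field_simp
        _ < δ := by linarith
  set s₁ := δ / (2 * (‖y‖ + δ + 1)) with hs₁
  have hs₁0 : 0 < s₁ := by positivity
  have hs₁Y : s₁ * (‖y‖ + δ + 1) < δ := by
    rw [hs₁]
    field_simp
    linarith
  have hs₁δ : s₁ < δ := by
    have := norm_nonneg y
    nlinarith
  have hg : Continuous fun p : ℝ × ℂ => g ((p.1 : ℂ), w₀ + p.2 • (w₁ - w₀)) := by
    have := L.continuous
    fun_prop
  -- For `s > 0` the rescaling `g (s, ·)` has no zeros near `w₀`: a complex perturbation of `w₀` moves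
  -- its real part near `v` and changes the imaginary direction by a bounded amount.
  have hpos : ∀ s ∈ Set.Ioc 0 s₁, ∀ ζ ∈ Metric.closedBall (0 : ℂ) ρ,
      g ((s : ℂ), w₀ + ζ • (w₁ - w₀)) ≠ 0 := by
    rintro s ⟨hs0, hs1⟩ ζ hζ h
    have hx := L.expansion (s : ℂ) (w₀ + ζ • (w₁ - w₀))
    rw [h, mul_zero] at hx
    set e := ζ • (w₁ - w₀) with he
    have hen : ‖e‖ < δ := by
      rw [he, norm_smul]
      have : ‖ζ‖ ≤ ρ := by simpa using hζ
      have := norm_nonneg (w₁ - w₀)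
      nlinarith [norm_nonneg ζ]
    refine hf (v + fun i => (e i).re) ?_ (s • (y + fun i => (e i).im)) ?_ s
      ⟨hs0, lt_of_le_of_lt hs1 hs₁δ⟩ ?_
    · rw [mem_ball_iff_norm, add_sub_cancel_left]
      exact lt_of_le_of_lt (norm_re_le e) hen
    · rw [mem_ball_zero_iff, norm_smul, Real.norm_of_nonneg hs0.le]
      have := norm_add_le y fun i => (e i).im
      have := norm_im_le e
      have : ‖y + fun i => (e i).im‖ ≤ ‖y‖ + δ + 1 := by linarith
      calc _ ≤ s₁ * (‖y‖ + δ + 1) := by gcongr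
        _ < δ := hs₁Y
    · rw [← hx]
      congr 1
      ext i
      simp only [hw₀, toC, Pi.add_apply, Pi.smul_apply, smul_eq_mul, Complex.ofReal_add,
        Complex.ofReal_mul]
      linear_combination (s : ℂ) * (Complex.re_add_im (e i))
  have key := ne_zero_of_ne_zero_frontier (S := Set.Icc 0 s₁) isPreconnected_Icc
    (U := Metric.ball (0 : ℂ) ρ) Metric.isBounded_ball hg
    (fun s => (L.differentiable_right s).comp (by fun_prop)) ?_ (x₀ := s₁) ⟨hs₁0.le, le_rfl⟩ ?_
    0 ⟨le_rfl, hs₁0.le⟩ 0 (subset_closure (by simpa using hρ))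
  · apply key
    simpa [L.leading] using h0
  · rintro s ⟨hs0, hs1⟩ ζ hζ
    rw [frontier_ball _ hρ.ne'] at hζ
    rcases hs0.eq_or_lt with rfl | hs0
    · have hζ' : ‖ζ‖ = ρ := by simpa using hζ
      have := hball (y := ζ) (by simpa [hζ'] using hρ1) (by
        rintro rfl
        simp at hζ'
        exact hρ.ne hζ')
      simpa [L.leading] using this
    · exact hpos s ⟨hs0, hs1⟩ ζ (Metric.sphere_subset_closedBall hζ)
  · intro ζ hζ
    exact hpos s₁ ⟨hs₁0, le_rfl⟩ ζ (Metric.closure_ball_subset_closedBall hζ)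

/-- Local hyperbolicity. If `f` has no zeros over the positive multiples of `u`, then near `z₀` it
has no zeros over the cone spanned by `u` and directions close to `v`, for each `v` that lies
in a common connected set of directions of hyperbolicity of the leading part with `u`. -/
theorem IsLeadingPart.exists_ne_zero (L : IsLeadingPart f z₀ n A g) (hfd : Differentiable ℂ f)
    {S : Set (Fin d → ℝ)} (hS : IsPreconnected S) (hyp : ∀ v ∈ S, IsHyperbolic A v)
    {u v : Fin d → ℝ} (hu : u ∈ S) (hv : v ∈ S) {δ : ℝ} (hδ : 0 < δ)
    (htube : ∀ y, ∀ τ ∈ Set.Ioo 0 δ, f (z₀ + Complex.I • toC y + (τ : ℂ) • toC u) ≠ 0) :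
    ∃ ρ > 0, ∀ y ∈ Metric.ball (0 : Fin d → ℝ) ρ, ∀ v' ∈ Metric.ball v ρ, ∀ s ∈ Set.Ioo 0 ρ,
      ∀ τ ∈ Set.Ico 0 ρ,
        f (z₀ + Complex.I • toC y + (s : ℂ) • toC v' + (τ : ℂ) • toC u) ≠ 0 := by
  have hgc := L.continuous
  have hfc := hfd.continuous
  -- Near `z₀` the leading part decides, over the cone of all `s v + τ u` with `s` in the closed
  -- right half plane and `τ ≥ 0`.
  obtain ⟨ρ₁, hρ₁, hlead⟩ : ∃ ρ₁ > 0, ∀ (s : ℂ) (τ : ℝ) (v' : Fin d → ℝ), 0 ≤ s.re → 0 ≤ τ →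
      ‖(s, τ)‖ < ρ₁ → (s, τ) ≠ 0 → dist v' v < ρ₁ →
        f (z₀ + s • toC v' + (τ : ℂ) • toC u) ≠ 0 := by
    have hK : IsCompact (Metric.sphere (0 : ℂ × ℝ) 1 ∩ {p | 0 ≤ p.1.re ∧ 0 ≤ p.2}) := by
      have h1 : IsClosed {p : ℂ × ℝ | 0 ≤ p.1.re} := isClosed_le continuous_const (by fun_prop)
      have h2 : IsClosed {p : ℂ × ℝ | 0 ≤ p.2} := isClosed_le continuous_const (by fun_prop)
      exact (isCompact_sphere _ _).inter_right (h1.inter h2)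
    have hev : ∀ᶠ q : ℝ × (Fin d → ℝ) in 𝓝 (0, v),
        ∀ p ∈ Metric.sphere (0 : ℂ × ℝ) 1 ∩ {p | 0 ≤ p.1.re ∧ 0 ≤ p.2},
          g ((q.1 : ℂ), p.1 • toC q.2 + (p.2 : ℂ) • toC u) ≠ 0 := by
      refine hK.eventually_forall_of_forall_eventually fun p hp => ?_
      have hcont : ContinuousAt (fun x : (ℝ × (Fin d → ℝ)) × (ℂ × ℝ) =>
          g ((x.1.1 : ℂ), x.2.1 • toC x.1.2 + (x.2.2 : ℂ) • toC u)) ((0, v), p) := by fun_prop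
      refine hcont.eventually_ne ?_
      simp only [Complex.ofReal_zero, L.leading]
      refine ne_zero_of_nonneg_comb L.differentiable L.homogeneous hS hyp hv hu hp.2.1 hp.2.2 ?_
      by_contra! hcon
      have : p = 0 := Prod.ext hcon.1 hcon.2
      have h1 := hp.1
      simp [this] at h1
    obtain ⟨ρ₁, hρ₁, hball⟩ := Metric.eventually_nhds_iff.1 hev
    refine ⟨ρ₁, hρ₁, fun s τ v' hs hτ hM hne hv' h0 => ?_⟩
    set M := ‖(s, τ)‖ with hMdef
    have hM0 : 0 < M := norm_pos_iff.2 hne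
    have h1 := hball (y := (M, v')) (by
      rw [Prod.dist_eq]
      refine max_lt ?_ hv'
      simpa [Real.norm_eq_abs, abs_of_pos hM0] using hM) (M⁻¹ • (s, τ)) ⟨by
        rw [mem_sphere_zero_iff_norm, norm_smul, norm_inv, Real.norm_of_nonneg hM0.le, ← hMdef,
          inv_mul_cancel₀ hM0.ne'], by
        simp only [Prod.smul_mk, Set.mem_ofPred_eq, Complex.smul_re, smul_eq_mul]
        constructor <;> positivity⟩
    have hx := L.expansion (M : ℂ)
      ((M⁻¹ • (s, τ)).1 • toC v' + (((M⁻¹ • (s, τ)).2 : ℝ) : ℂ) • toC u)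
    apply mul_ne_zero (pow_ne_zero n (show (M : ℂ) ≠ 0 by exact_mod_cast hM0.ne')) h1
    rw [← hx, ← h0]
    congr 1
    have hMc : (M : ℂ) ≠ 0 := by exact_mod_cast hM0.ne'
    ext i
    simp only [toC, Pi.add_apply, Pi.smul_apply, smul_eq_mul, Prod.smul_mk, Complex.real_smul,
      Complex.ofReal_mul, Complex.ofReal_inv]
    field_simp
    ring
  set R := ρ₁ / 2 with hR
  have hR0 : 0 < R := by positivity
  have hK2 : IsCompact (Metric.sphere (0 : ℂ) R ∩ {s | 0 ≤ s.re}) :=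
    (isCompact_sphere _ _).inter_right (isClosed_le continuous_const (by fun_prop))
  have hG : Continuous fun p : ((Fin d → ℝ) × ℝ × (Fin d → ℝ)) × ℂ =>
      f (z₀ + Complex.I • toC p.1.1 + p.2 • toC p.1.2.2 + (p.1.2.1 : ℂ) • toC u) := by
    fun_prop
  have hev2 : ∀ᶠ q : (Fin d → ℝ) × ℝ × (Fin d → ℝ) in 𝓝 (0, 0, v),
      ∀ s ∈ Metric.sphere (0 : ℂ) R ∩ {s | 0 ≤ s.re},
        f (z₀ + Complex.I • toC q.1 + s • toC q.2.2 + (q.2.1 : ℂ) • toC u) ≠ 0 := by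
    refine hK2.eventually_forall_of_forall_eventually fun s hs => ?_
    refine hG.continuousAt.eventually_ne ?_
    have hsR : ‖s‖ = R := by simpa using hs.1
    have := hlead s 0 v hs.2 le_rfl (by
      rw [Prod.norm_mk, hsR, norm_zero, max_eq_left hR0.le]
      linarith) (by
      intro h
      rw [Prod.mk_eq_zero] at h
      rw [h.1, norm_zero] at hsR
      exact hR0.ne hsR) (by simpa using hρ₁)
    simpa using this
  obtain ⟨ρ₂, hρ₂, hball2⟩ := Metric.eventually_nhds_iff.1 hev2
  obtain ⟨ρ₃, hρ₃, h32, h3δ, h3R⟩ : ∃ ρ₃ > 0, ρ₃ ≤ ρ₂ ∧ ρ₃ ≤ δ ∧ ρ₃ ≤ R :=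
    ⟨min ρ₂ (min δ R), by positivity, min_le_left _ _,
      (min_le_right _ _).trans (min_le_left _ _), (min_le_right _ _).trans (min_le_right _ _)⟩
  have hSp : IsPreconnected (Metric.ball (0 : Fin d → ℝ) ρ₃ ×ˢ (Set.Ioo 0 ρ₃ ×ˢ
      Metric.ball v ρ₃)) :=
    ((convex_ball _ _).prod ((convex_Ioo _ _).prod (convex_ball _ _))).isPreconnected
  -- For fixed `τ > 0`, zeros `s` cannot enter the half disc: the arc is excluded by the leading part,
  -- the imaginary diameter by `htube`.
  have key := ne_zero_of_ne_zero_frontier hSp (isBounded_halfDisc R) hG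
    (fun x => hfd.comp (by dsimp only; fun_prop)) ?_ (x₀ := (0, ρ₃ / 2, v)) ?_ ?_
  · obtain ⟨κ, hκ, hκu⟩ : ∃ κ > 0, κ * ‖u‖ < ρ₃ / 2 := by
      refine ⟨ρ₃ / (2 * (‖u‖ + 1)) , by positivity, ?_⟩
      rw [div_mul_eq_mul_div, div_lt_iff₀ (by positivity)]
      nlinarith [norm_nonneg u]
    refine ⟨min (ρ₃ / 2) (ρ₃ / (2 * κ)), by positivity, fun y hy v' hv' s hs τ hτ => ?_⟩
    have hs2 : s < ρ₃ / 2 := hs.2.trans_le (min_le_left _ _)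
    have hsκ : s * κ < ρ₃ / 2 := by
      have := hs.2.trans_le (min_le_right _ _)
      rw [lt_div_iff₀ (by positivity)] at this
      linarith
    have hτ2 : τ < ρ₃ / 2 := hτ.2.trans_le (min_le_left _ _)
    -- `s v' + τ u = s (v' - κ u) + (τ + s κ) u` makes the coefficient of `u` positive.
    have := key (y, τ + s * κ, v' - κ • u) ⟨?_, ⟨?_, ?_⟩, ?_⟩ (s : ℂ) (subset_closure ⟨?_, ?_⟩)
    · convert this using 2
      ext i
      simp [toC]
      ring
    · refine Metric.ball_subset_ball ?_ hy
      exact (min_le_left _ _).trans (by linarith)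
    · have := mul_pos hs.1 hκ
      have := hτ.1
      show 0 < τ + s * κ
      linarith
    · show τ + s * κ < ρ₃
      linarith
    · rw [mem_ball_iff_norm]
      have h1 : ‖v' - v‖ < ρ₃ / 2 := (mem_ball_iff_norm.1 hv').trans_le (min_le_left _ _)
      calc ‖v' - κ • u - v‖ = ‖(v' - v) - κ • u‖ := by congr 1; abel
        _ ≤ ‖v' - v‖ + ‖κ • u‖ := norm_sub_le _ _
        _ < ρ₃ := by
          rw [norm_smul, Real.norm_of_nonneg hκ.le]
          linarith
    · simpa using hs.1
    · rw [mem_ball_zero_iff, Complex.norm_real, Real.norm_of_nonneg hs.1.le]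
      linarith
  · rintro ⟨y, τ, v'⟩ ⟨hy, hτ, hv'⟩ s hs
    rcases of_mem_frontier_halfDisc hR0.ne' hs with hs | ⟨hs, hs'⟩
    · have := htube (y + s.im • v') τ ⟨hτ.1, hτ.2.trans_le h3δ⟩
      convert this using 2
      have hsI : s = s.im * Complex.I := by apply Complex.ext <;> simp [hs]
      conv_lhs => rw [hsI]
      ext i
      simp [toC]
      ring
    · refine hball2 (y := (y, τ, v')) ?_ s ⟨by simpa using hs', hs⟩
      simp only [Prod.dist_eq]
      refine max_lt (lt_of_lt_of_le hy h32) (max_lt ?_ (lt_of_lt_of_le hv' h32))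
      rw [Real.dist_eq, sub_zero, abs_of_pos hτ.1]
      exact hτ.2.trans_le h32
  · exact ⟨by simpa using hρ₃, ⟨by show 0 < ρ₃ / 2; positivity, by show ρ₃ / 2 < ρ₃; linarith⟩,
      by simpa using hρ₃⟩
  · intro s hs
    obtain ⟨hs1, hs2⟩ := of_mem_closure_halfDisc hs
    have := hlead s (ρ₃ / 2) v hs1 (by positivity) (by
      rw [Prod.norm_mk, Real.norm_of_nonneg (by positivity)]
      exact max_lt (by linarith) (by linarith)) (by
      intro h
      rw [Prod.mk_eq_zero] at h
      linarith [h.2]) (by simpa using hρ₁)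
    simpa using this

end LocalHyperbolicity

/-! ### Components of the complement of an amoeba -/

section Amoeba

variable {d : ℕ}

theorem continuous_cvec : Continuous fun p : (Fin d → ℝ) × (Fin d → ℝ) => cvec p.1 p.2 := by
  unfold cvec
  fun_prop

theorem exists_add_period_mem_cube (y : Fin d → ℝ) :
    ∃ k : Fin d → ℤ, y + (2 * Real.pi) • intVec k ∈ cube d := by
  have hp := Real.two_pi_pos
  refine ⟨fun i => -⌊y i / (2 * Real.pi)⌋, fun i _ => ?_⟩
  have h1 := Int.floor_le (y i / (2 * Real.pi))
  have h2 := Int.lt_floor_add_one (y i / (2 * Real.pi))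
  rw [le_div_iff₀ hp] at h1
  rw [div_lt_iff₀ hp] at h2
  simp only [Pi.add_apply, Pi.smul_apply, intVec, smul_eq_mul, Int.cast_neg]
  constructor <;> nlinarith

/-- The closed cube `[0, 2π] ^ d`. -/
def closedCube (d : ℕ) : Set (Fin d → ℝ) := Set.Icc 0 fun _ => 2 * Real.pi

theorem isCompact_closedCube : IsCompact (closedCube d) := isCompact_Icc

theorem cube_subset_closedCube : cube d ⊆ closedCube d :=
  fun _ hy => ⟨fun i => (hy i trivial).1, fun i => (hy i trivial).2.le⟩

/-- A periodic property holds everywhere if it holds on the closed cube. -/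
theorem forall_of_forall_closedCube {p : (Fin d → ℝ) → Prop}
    (hp : ∀ y (k : Fin d → ℤ), p (y + (2 * Real.pi) • intVec k) → p y)
    (h : ∀ y ∈ closedCube d, p y) (y : Fin d → ℝ) : p y := by
  obtain ⟨k, hk⟩ := exists_add_period_mem_cube y
  exact hp y k (h _ (cube_subset_closedCube hk))

variable (G : Laurent d)

theorem notMem_amoeba_iff (x : Fin d → ℝ) :
    x ∈ (amoeba G)ᶜ ↔ ∀ y, logf G (cvec x y) ≠ 0 := by
  constructor
  · intro hx y h0
    refine hx ⟨cexp (cvec x y), fun i => Complex.exp_ne_zero _, h0, ?_⟩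
    funext i
    simp [reLog, cexp, cvec, Complex.norm_exp]
  · rintro h ⟨Z, hZ, h0, rfl⟩
    apply h fun i => (Z i).arg
    rw [← h0, logf]
    congr 1
    funext i
    simp only [cexp, cvec, reLog]
    exact Complex.exp_log (hZ i)

theorem isOpen_compl_amoeba : IsOpen (amoeba G)ᶜ := by
  rw [isOpen_iff_mem_nhds]
  intro x hx
  rw [notMem_amoeba_iff] at hx
  have hc : Continuous fun p : (Fin d → ℝ) × (Fin d → ℝ) => logf G (cvec p.1 p.2) :=
    (continuous_logf G).comp continuous_cvec
  have := isCompact_closedCube.eventually_forall_of_forall_eventually (x₀ := x)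
    (P := fun x y => logf G (cvec x y) ≠ 0)
    fun y _ => hc.continuousAt.eventually_ne (hx y)
  filter_upwards [this] with x' hx'
  rw [notMem_amoeba_iff]
  refine forall_of_forall_closedCube (fun y k h => ?_) hx'
  rwa [logf_periodic] at h

theorem exists_norm_lower_bound {C : Set (Fin d → ℝ)} (hC : IsCompact C)
    (hCG : C ⊆ (amoeba G)ᶜ) : ∃ c > 0, ∀ x ∈ C, ∀ y, c ≤ ‖logf G (cvec x y)‖ := by
  have hc : Continuous fun p : (Fin d → ℝ) × (Fin d → ℝ) => ‖logf G (cvec p.1 p.2)‖ :=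
    ((continuous_logf G).comp continuous_cvec).norm
  obtain ⟨c, hc0, h⟩ := (hC.prod isCompact_closedCube).exists_forall_le' (a := 0) hc.continuousOn
    fun p hp => norm_pos_iff.2 ((notMem_amoeba_iff G _).1 (hCG hp.1) _)
  refine ⟨c, hc0, fun x hx => forall_of_forall_closedCube (fun y k h => ?_)
    fun y hy => h (x, y) ⟨hx, hy⟩⟩
  rwa [logf_periodic] at h

/-- A lower bound for `|f|` over both ends of a segment in the complement of the amoeba holds over the
segment, by the three lines theorem for `1 / f`. -/
theorem three_lines_lower_bound {x₀ x₁ : Fin d → ℝ} {c : ℝ} (hc : 0 < c)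
    (hseg : ∀ t ∈ Set.Icc (0 : ℝ) 1, x₀ + t • (x₁ - x₀) ∈ (amoeba G)ᶜ)
    (h₀ : ∀ y, c ≤ ‖logf G (cvec x₀ y)‖) (h₁ : ∀ y, c ≤ ‖logf G (cvec x₁ y)‖)
    {t : ℝ} (ht : t ∈ Set.Icc (0 : ℝ) 1) (y : Fin d → ℝ) :
    c ≤ ‖logf G (cvec (x₀ + t • (x₁ - x₀)) y)‖ := by
  have hE : ∀ ζ : ℂ, cvec x₀ y + ζ • toC (x₁ - x₀) =
      cvec (x₀ + ζ.re • (x₁ - x₀)) (y + ζ.im • (x₁ - x₀)) := by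
    intro ζ
    ext i
    simp only [cvec, toC, Pi.add_apply, Pi.smul_apply, Pi.sub_apply, smul_eq_mul]
    push_cast
    linear_combination (-(x₁ i : ℂ) + x₀ i) * (Complex.re_add_im ζ)
  obtain ⟨c', hc', hlow⟩ := exists_norm_lower_bound G
    (C := (fun t : ℝ => x₀ + t • (x₁ - x₀)) '' Set.Icc 0 1)
    (isCompact_Icc.image (by fun_prop)) (by rintro _ ⟨t, ht, rfl⟩; exact hseg t ht)
  have hclo : closure (Complex.re ⁻¹' Set.Ioo (0 : ℝ) 1) ⊆ Complex.re ⁻¹' Set.Icc 0 1 :=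
    closure_minimal (Set.preimage_mono Set.Ioo_subset_Icc_self)
      (isClosed_Icc.preimage Complex.continuous_re)
  have hbd : ∀ ζ ∈ Complex.re ⁻¹' Set.Icc (0 : ℝ) 1,
      c' ≤ ‖logf G (cvec x₀ y + ζ • toC (x₁ - x₀))‖ := by
    intro ζ hζ
    rw [hE]
    exact hlow _ ⟨ζ.re, hζ, rfl⟩ _
  have hdc : DiffContOnCl ℂ (fun ζ : ℂ => (logf G (cvec x₀ y + ζ • toC (x₁ - x₀)))⁻¹)
      (Complex.re ⁻¹' Set.Ioo (0 : ℝ) 1) := by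
    refine DiffContOnCl.inv (Differentiable.diffContOnCl
      ((differentiable_logf G).comp (by fun_prop))) fun ζ hζ => ?_
    exact norm_pos_iff.1 (hc'.trans_le (hbd ζ (hclo hζ)))
  have key := PhragmenLindelof.vertical_strip (z := (t : ℂ)) (C := c⁻¹) hdc ?_ ?_ ?_ ?_ ?_
  · rw [norm_inv, hE] at key
    have hpos : 0 < ‖logf G (cvec (x₀ + t • (x₁ - x₀)) y)‖ :=
      norm_pos_iff.2 ((notMem_amoeba_iff G _).1 (hseg t ht) y)
    refine (inv_le_inv₀ hpos hc).1 ?_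
    simpa using key
  · refine ⟨0, by simpa using Real.pi_pos, 0, ?_⟩
    refine Asymptotics.IsBigO.of_bound c'⁻¹ ?_
    refine Filter.mem_inf_of_right fun ζ hζ => ?_
    simp only [Set.mem_ofPred_eq, norm_inv, zero_mul, Real.exp_zero, norm_one, mul_one]
    exact inv_anti₀ hc' (hbd ζ (Set.preimage_mono Set.Ioo_subset_Icc_self hζ))
  · intro ζ hζ
    rw [norm_inv, hE, hζ]
    refine inv_anti₀ hc ?_
    simpa using h₀ _
  · intro ζ hζ
    rw [norm_inv, hE, hζ]
    refine inv_anti₀ hc ?_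
    simpa using h₁ _
  · simpa using ht.1
  · simpa using ht.2

variable {G} {B : Set (Fin d → ℝ)}

theorem IsAmoebaComplComponent.isOpen (hB : IsAmoebaComplComponent G B) : IsOpen B := by
  obtain ⟨x, _, rfl⟩ := hB
  exact (isOpen_compl_amoeba G).connectedComponentIn

theorem IsAmoebaComplComponent.subset (hB : IsAmoebaComplComponent G B) : B ⊆ (amoeba G)ᶜ := by
  obtain ⟨x, _, rfl⟩ := hB
  exact connectedComponentIn_subset _ _

theorem IsAmoebaComplComponent.nonempty (hB : IsAmoebaComplComponent G B) : B.Nonempty := by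
  obtain ⟨x, hx, rfl⟩ := hB
  exact ⟨x, mem_connectedComponentIn hx⟩

/-- Complement components of amoebas are convex. By the three lines theorem for `1 / f`, the
property that the segment from `x₀` to `x₁` avoids the amoeba persists when `x₁` moves
in the component. -/
theorem IsAmoebaComplComponent.convex (hB : IsAmoebaComplComponent G B) : Convex ℝ B := by
  have hsub := hB.subset
  have hopen := hB.isOpen
  have hpre : IsPreconnected B := by
    obtain ⟨x, _, rfl⟩ := hB
    exact isPreconnected_connectedComponentIn
  have hmax : ∀ S : Set (Fin d → ℝ), IsPreconnected S → S ⊆ (amoeba G)ᶜ → (S ∩ B).Nonempty →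
      S ⊆ B := by
    obtain ⟨x, hx, rfl⟩ := hB
    rintro S hS hSG ⟨p, hpS, hpB⟩
    rw [connectedComponentIn_eq hpB]
    exact hS.subset_connectedComponentIn hpS hSG
  have main : ∀ x₀ ∈ B, ∀ x₁ ∈ B, ∀ t ∈ Set.Icc (0 : ℝ) 1,
      x₀ + t • (x₁ - x₀) ∈ (amoeba G)ᶜ := by
    intro x₀ hx₀
    refine hpre.subset_of_closure_inter_subset
      (u := {x₁ | ∀ t ∈ Set.Icc (0 : ℝ) 1, x₀ + t • (x₁ - x₀) ∈ (amoeba G)ᶜ}) ?_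
      ⟨x₀, hx₀, fun t _ => by simpa using hsub hx₀⟩ ?_
    · rw [isOpen_iff_mem_nhds]
      intro x₁ hx₁
      refine isCompact_Icc.eventually_forall_of_forall_eventually fun t ht => ?_
      have hc : ContinuousAt (fun p : (Fin d → ℝ) × ℝ => x₀ + p.2 • (p.1 - x₀)) (x₁, t) := by
        fun_prop
      exact hc.eventually ((isOpen_compl_amoeba G).mem_nhds (hx₁ t ht))
    · rintro x₁ ⟨hcl, hx₁⟩ t ht
      obtain ⟨r, hr, hrB⟩ := Metric.nhds_basis_closedBall.mem_iff.1 (hopen.mem_nhds hx₁)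
      obtain ⟨c, hc, hlow⟩ := exists_norm_lower_bound G
        (C := {x₀} ∪ Metric.closedBall x₁ r) (isCompact_singleton.union (isCompact_closedBall _ _))
        (Set.union_subset (Set.singleton_subset_iff.2 (hsub hx₀)) (hrB.trans hsub))
      rw [notMem_amoeba_iff]
      intro y
      have hfreq : ∃ᶠ x in 𝓝 x₁, c ≤ ‖logf G (cvec (x₀ + t • (x - x₀)) y)‖ := by
        refine ((mem_closure_iff_frequently.1 hcl).and_eventually
          (Metric.closedBall_mem_nhds x₁ hr)).mono ?_
        rintro x ⟨hx, hxr⟩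
        exact three_lines_lower_bound G hc hx (hlow x₀ (Or.inl rfl)) (hlow x (Or.inr hxr)) ht y
      have hcl' : IsClosed {x | c ≤ ‖logf G (cvec (x₀ + t • (x - x₀)) y)‖} := by
        refine isClosed_le continuous_const (Continuous.norm ((continuous_logf G).comp ?_))
        exact continuous_cvec.comp
          (f := fun x => (x₀ + t • (x - x₀), y)) (by fun_prop)
      exact norm_pos_iff.1 (hc.trans_le (hcl'.mem_of_frequently_of_tendsto hfreq
        Filter.tendsto_id))
  refine convex_iff_segment_subset.2 fun x₀ hx₀ x₁ hx₁ => ?_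
  refine hmax _ (convex_segment _ _).isPreconnected ?_ ⟨x₀, left_mem_segment _ _ _, hx₀⟩
  rw [segment_eq_image']
  rintro _ ⟨t, ht, rfl⟩
  exact main x₀ hx₀ x₁ hx₁ t ht

/-! ### Tangent cones -/

variable {x : Fin d → ℝ}

theorem add_smul_mem_of_le (hB : Convex ℝ B) (ho : IsOpen B) (hx : x ∈ closure B)
    {v : Fin d → ℝ} {ε ε' : ℝ} (hε : x + ε • v ∈ B) (h0 : 0 < ε') (hle : ε' ≤ ε) :
    x + ε' • v ∈ B := by
  rcases hle.eq_or_lt with rfl | hlt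
  · exact hε
  have h := hB.openSegment_closure_interior_subset_interior hx (ho.interior_eq.symm ▸ hε)
  rw [ho.interior_eq] at h
  apply h
  have hε0 : 0 < ε := h0.trans hlt
  rw [openSegment_eq_image']
  refine ⟨ε' / ε, ⟨by positivity, by rwa [div_lt_one hε0]⟩, ?_⟩
  simp only [add_sub_cancel_left, smul_smul]
  rw [div_mul_cancel₀ _ hε0.ne']

theorem mem_tanCone_iff (hB : Convex ℝ B) (ho : IsOpen B) (hx : x ∈ closure B)
    {v : Fin d → ℝ} : v ∈ tanCone B x ↔ ∃ ε : ℝ, 0 < ε ∧ x + ε • v ∈ B := by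
  rw [tanCone, Set.mem_ofPred_eq]
  constructor
  · intro h
    obtain ⟨ε, h1, h2⟩ := (h.and self_mem_nhdsWithin).exists
    exact ⟨ε, Set.mem_Ioi.1 h2, h1⟩
  · rintro ⟨ε, h0, hε⟩
    filter_upwards [Ioc_mem_nhdsGT h0] with ε' hε'
    exact add_smul_mem_of_le hB ho hx hε hε'.1 hε'.2

theorem tanCone_nonempty (hB : Convex ℝ B) (ho : IsOpen B) (hx : x ∈ closure B) :
    (tanCone B x).Nonempty := by
  obtain ⟨b, hb⟩ := closure_nonempty_iff.1 ⟨x, hx⟩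
  exact ⟨b - x, (mem_tanCone_iff hB ho hx).2 ⟨1, one_pos, by simpa using hb⟩⟩

theorem convex_tanCone (hB : Convex ℝ B) : Convex ℝ (tanCone B x) := by
  intro v hv w hw a b ha hb hab
  rw [tanCone, Set.mem_ofPred_eq] at hv hw ⊢
  filter_upwards [hv, hw] with ε h1 h2
  have := hB h1 h2 ha hb hab
  convert this using 1
  have hx' : x = a • x + b • x := by rw [← add_smul, hab, one_smul]
  conv_lhs => rw [hx']
  module

/-- The translates of `x` by small multiples of vectors near `u ∈ tanCone B x` lie in `B`. -/
theorem exists_ball_tanCone (hB : Convex ℝ B) (ho : IsOpen B) (hx : x ∈ closure B)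
    {u : Fin d → ℝ} (hu : u ∈ tanCone B x) :
    ∃ δ > 0, ∀ u' ∈ Metric.ball u δ, ∀ ε ∈ Set.Ioo 0 δ, x + ε • u' ∈ B := by
  obtain ⟨ε, h0, hε⟩ := (mem_tanCone_iff hB ho hx).1 hu
  have hc : ContinuousAt (fun u' : Fin d → ℝ => x + ε • u') u := by fun_prop
  obtain ⟨r, hr, hball⟩ := Metric.eventually_nhds_iff.1 (hc.eventually_mem (ho.mem_nhds hε))
  refine ⟨min r ε, by positivity, fun u' hu' ε' hε' => ?_⟩
  exact add_smul_mem_of_le hB ho hx (hball (lt_of_lt_of_le hu' (min_le_left _ _))) hε'.1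
    (hε'.2.le.trans (min_le_right _ _))

end Amoeba

/-! ### The cones of hyperbolicity -/

section Cones

variable {d : ℕ} {G : Laurent d} {B : Set (Fin d → ℝ)} {x : Fin d → ℝ}

theorem IsAmoebaComplComponent.exists_logf_ne_zero (hB : IsAmoebaComplComponent G B) :
    ∃ z, logf G z ≠ 0 := by
  obtain ⟨b, hb⟩ := hB.nonempty
  exact ⟨_, (notMem_amoeba_iff G b).1 (hB.subset hb) 0⟩

theorem cvec_add_smul_toC (x y v : Fin d → ℝ) (s : ℝ) :
    cvec x y + (s : ℂ) • toC v = cvec (x + s • v) y := by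
  ext i
  simp [cvec, toC]
  ring

theorem cvec_add_I_smul_toC (x y y' : Fin d → ℝ) :
    cvec x y + Complex.I • toC y' = cvec x (y + y') := by
  ext i
  simp [cvec, toC]
  ring

/-- The set of directions of hyperbolicity of the leading part at `exp (x + i y)`. -/
def hypSet (G : Laurent d) (x y : Fin d → ℝ) : Set (Fin d → ℝ) :=
  {v | IsHyperbolic (homPart (logf G) (cvec x y)) v}

theorem isHyperbolic_of_mem_component {u v y : Fin d → ℝ}
    (hv : v ∈ connectedComponentIn (hypSet G x y) u) :
    IsHyperbolic (homPart (logf G) (cvec x y)) v := by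
  have h := connectedComponentIn_subset _ _ hv
  exact h

theorem IsAmoebaComplComponent.exists_tube (hB : IsAmoebaComplComponent G B) (hx : x ∈ closure B)
    {u : Fin d → ℝ} (hu : u ∈ tanCone B x) :
    ∃ δ > 0, ∀ u' ∈ Metric.ball u δ, ∀ y, ∀ s ∈ Set.Ioo (0 : ℝ) δ,
      logf G (cvec (x + s • u') y) ≠ 0 := by
  obtain ⟨δ, hδ, h⟩ := exists_ball_tanCone hB.convex hB.isOpen hx hu
  exact ⟨δ, hδ, fun u' hu' y s hs => (notMem_amoeba_iff G _).1 (hB.subset (h u' hu' s hs)) y⟩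

theorem IsAmoebaComplComponent.tanCone_subset_hypSet (hB : IsAmoebaComplComponent G B)
    (hx : x ∈ closure B) (y : Fin d → ℝ) : tanCone B x ⊆ hypSet G x y := by
  intro u hu
  obtain ⟨g, L⟩ := exists_isLeadingPart G hB.exists_logf_ne_zero (cvec x y)
  obtain ⟨δ, hδ, h⟩ := hB.exists_tube hx hu
  refine L.isHyperbolic hδ fun u' hu' y' _ s hs => ?_
  rw [cvec_add_I_smul_toC, cvec_add_smul_toC]
  exact h u' hu' _ s hs

theorem IsAmoebaComplComponent.mem_hypCone_iff (hB : IsAmoebaComplComponent G B)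
    (hx : x ∈ closure B) {u : Fin d → ℝ} (hu : u ∈ tanCone B x) (y v : Fin d → ℝ) :
    v ∈ hypCone G B x y ↔ v ∈ connectedComponentIn (hypSet G x y) u := by
  simp only [hypCone, Set.mem_iUnion]
  constructor
  · rintro ⟨u', hu', hv⟩
    have h : u' ∈ connectedComponentIn (hypSet G x y) u :=
      (convex_tanCone hB.convex).isPreconnected.subset_connectedComponentIn hu
        (hB.tanCone_subset_hypSet hx y) hu'
    rwa [connectedComponentIn_eq h]
  · exact fun hv => ⟨u, hu, hv⟩

theorem IsAmoebaComplComponent.tanCone_subset_hypCone (hB : IsAmoebaComplComponent G B)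
    (hx : x ∈ closure B) (y : Fin d → ℝ) : tanCone B x ⊆ hypCone G B x y := fun u hu =>
  (hB.mem_hypCone_iff hx hu y u).2
    (mem_connectedComponentIn (hB.tanCone_subset_hypSet hx y hu))

theorem IsHyperbolic.smul {A : (Fin d → ℂ) → ℂ} {n : ℕ}
    (hA : ∀ (c : ℂ) w, A (c • w) = c ^ n * A w) {v : Fin d → ℝ} (h : IsHyperbolic A v) {c : ℝ}
    (hc : c ≠ 0) : IsHyperbolic A (c • v) := by
  rw [isHyperbolic_iff hA] at h ⊢
  intro y
  have hc' : (c : ℂ) ≠ 0 := by exact_mod_cast hc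
  have : toC (c • v) + Complex.I • toC y = (c : ℂ) • (toC v + Complex.I • toC (c⁻¹ • y)) := by
    ext i
    simp only [toC, Pi.add_apply, Pi.smul_apply, smul_eq_mul, Complex.ofReal_mul,
      Complex.ofReal_inv]
    field_simp
  rw [this, hA]
  exact mul_ne_zero (pow_ne_zero _ hc') (h _)

/-- If a segment consists of directions of hyperbolicity and one end lies in the cone, so does the
other end. -/
theorem IsAmoebaComplComponent.mem_hypCone_of_segment (hB : IsAmoebaComplComponent G B)
    (hx : x ∈ closure B) {y v w : Fin d → ℝ} (hv : v ∈ hypCone G B x y)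
    (hseg : segment ℝ v w ⊆ hypSet G x y) : segment ℝ v w ⊆ hypCone G B x y := by
  obtain ⟨u, hu⟩ := tanCone_nonempty hB.convex hB.isOpen hx
  intro p hp
  rw [hB.mem_hypCone_iff hx hu] at hv ⊢
  rw [connectedComponentIn_eq hv]
  exact (convex_segment v w).isPreconnected.subset_connectedComponentIn
    (left_mem_segment ℝ v w) hseg hp

theorem IsAmoebaComplComponent.convex_hypCone (hB : IsAmoebaComplComponent G B)
    (hx : x ∈ closure B) (y : Fin d → ℝ) : Convex ℝ (hypCone G B x y) := by
  refine convex_iff_segment_subset.2 fun v₁ h₁ v₂ h₂ => hB.mem_hypCone_of_segment hx h₁ ?_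
  obtain ⟨u, hu⟩ := tanCone_nonempty hB.convex hB.isOpen hx
  obtain ⟨g, L⟩ := exists_isLeadingPart G hB.exists_logf_ne_zero (cvec x y)
  rw [hB.mem_hypCone_iff hx hu] at h₁ h₂
  have hyp : ∀ v ∈ connectedComponentIn (hypSet G x y) u,
      IsHyperbolic (homPart (logf G) (cvec x y)) v := fun v hv => isHyperbolic_of_mem_component hv
  rintro _ ⟨a, b, ha, hb, hab, rfl⟩
  rcases hb.eq_or_lt with rfl | hb
  · simp only [add_zero] at hab
    subst hab
    simpa using connectedComponentIn_subset _ _ h₁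
  · have := (isHyperbolic_add L.differentiable L.homogeneous isPreconnected_connectedComponentIn
      hyp h₁ h₂ (σ := a / b) (by positivity)).smul L.homogeneous hb.ne'
    rw [smul_add, smul_smul, mul_div_cancel₀ _ hb.ne'] at this
    exact this

theorem IsAmoebaComplComponent.smul_mem_hypCone (hB : IsAmoebaComplComponent G B)
    (hx : x ∈ closure B) {y v : Fin d → ℝ} (hv : v ∈ hypCone G B x y) {c : ℝ} (hc : 0 < c) :
    c • v ∈ hypCone G B x y := by
  refine hB.mem_hypCone_of_segment hx hv ?_ (right_mem_segment ℝ v (c • v))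
  obtain ⟨u, hu⟩ := tanCone_nonempty hB.convex hB.isOpen hx
  obtain ⟨g, L⟩ := exists_isLeadingPart G hB.exists_logf_ne_zero (cvec x y)
  have hv' : IsHyperbolic (homPart (logf G) (cvec x y)) v := by
    rw [hB.mem_hypCone_iff hx hu] at hv
    exact isHyperbolic_of_mem_component hv
  rintro _ ⟨a, b, ha, hb, hab, rfl⟩
  have h0 : a + b * c ≠ 0 := by
    rcases ha.eq_or_lt with rfl | ha
    · have : b = 1 := by linarith
      rw [this]
      simpa using hc.ne'
    · positivity
  have := hv'.smul L.homogeneous h0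
  rw [add_smul, mul_smul] at this
  exact this

/-- Locally uniform absence of zeros of `f` over the cones. -/
theorem IsAmoebaComplComponent.exists_logf_cvec_ne_zero (hB : IsAmoebaComplComponent G B)
    (hx : x ∈ closure B) {u v y₀ : Fin d → ℝ} (hu : u ∈ tanCone B x)
    (hv : v ∈ hypCone G B x y₀) :
    ∃ ρ > 0, ∀ y ∈ Metric.ball y₀ ρ, ∀ v' ∈ Metric.ball v ρ, ∀ t ∈ Set.Icc (0 : ℝ) 1,
      ∀ s ∈ Set.Ioo 0 ρ, logf G (cvec (x + s • ((1 - t) • u + t • v')) y) ≠ 0 := by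
  obtain ⟨g, L⟩ := exists_isLeadingPart G hB.exists_logf_ne_zero (cvec x y₀)
  obtain ⟨δ, hδ, htube⟩ := hB.exists_tube hx hu
  rw [hB.mem_hypCone_iff hx hu] at hv
  obtain ⟨ρ, hρ, h⟩ := L.exists_ne_zero (differentiable_logf G)
    (isPreconnected_connectedComponentIn (F := hypSet G x y₀) (x := u))
    (fun v hv => isHyperbolic_of_mem_component hv)
    (mem_connectedComponentIn (hB.tanCone_subset_hypSet hx y₀ hu)) hv hδ
    fun y τ hτ => by
      rw [cvec_add_I_smul_toC, cvec_add_smul_toC]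
      exact htube u (Metric.mem_ball_self hδ) _ τ hτ
  refine ⟨min δ ρ, by positivity, fun y hy v' hv' t ht s hs => ?_⟩
  have hsδ : s < δ := hs.2.trans_le (min_le_left _ _)
  have hsρ : s < ρ := hs.2.trans_le (min_le_right _ _)
  rcases ht.1.eq_or_lt with rfl | ht0
  · simpa using htube u (Metric.mem_ball_self hδ) y s ⟨hs.1, hsδ⟩
  · have := h (y - y₀) (by
      rw [mem_ball_zero_iff]
      exact (mem_ball_iff_norm.1 hy).trans_le (min_le_right _ _)) v'
      (Metric.ball_subset_ball (min_le_right _ _) hv') (s * t)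
      ⟨mul_pos hs.1 ht0, by nlinarith [ht.2, hs.1]⟩ (s * (1 - t))
      ⟨mul_nonneg hs.1.le (by linarith [ht.2]), by nlinarith [hs.1]⟩
    rw [cvec_add_I_smul_toC, cvec_add_smul_toC, cvec_add_smul_toC] at this
    convert this using 2
    congr 1
    · module
    · abel

/-- Semicontinuity of the cones of hyperbolicity. -/
theorem IsAmoebaComplComponent.eventually_mem_hypCone (hB : IsAmoebaComplComponent G B)
    (hx : x ∈ closure B) {v y₀ : Fin d → ℝ} (hv : v ∈ hypCone G B x y₀) :
    ∀ᶠ y in 𝓝 y₀, v ∈ hypCone G B x y := by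
  obtain ⟨u, hu⟩ := tanCone_nonempty hB.convex hB.isOpen hx
  obtain ⟨ρ, hρ, h⟩ := hB.exists_logf_cvec_ne_zero hx hu hv
  filter_upwards [Metric.ball_mem_nhds y₀ (half_pos hρ)] with y hy
  refine hB.mem_hypCone_of_segment hx (hB.tanCone_subset_hypCone hx y hu) ?_
    (right_mem_segment ℝ u v)
  obtain ⟨g, L⟩ := exists_isLeadingPart G hB.exists_logf_ne_zero (cvec x y)
  rw [segment_eq_image]
  rintro _ ⟨t, ht, rfl⟩
  rcases ht.1.eq_or_lt with rfl | ht0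
  · simpa using hB.tanCone_subset_hypSet hx y hu
  -- The points of the segment from `u` to `v` are directions of hyperbolicity at `y`, by the Hurwitz
  -- argument applied to the absence of zeros near `y₀`.
  refine L.isHyperbolic (δ := min (ρ / 2) (t * ρ)) (by positivity) fun w hw y' hy' s hs => ?_
  rw [cvec_add_I_smul_toC, cvec_add_smul_toC]
  -- A perturbation of `(1 - t) u + t v` is absorbed into `v`.
  have := h (y + y') ?_ (v + t⁻¹ • (w - ((1 - t) • u + t • v))) ?_ t ht s
    ⟨hs.1, hs.2.trans_le ((min_le_left _ _).trans (by linarith))⟩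
  · have hw' : (1 - t) • u + t • (v + t⁻¹ • (w - ((1 - t) • u + t • v))) = w := by
      rw [smul_add t, smul_smul t t⁻¹, mul_inv_cancel₀ ht0.ne']
      module
    rwa [hw'] at this
  · rw [mem_ball_iff_norm] at hy ⊢
    rw [mem_ball_zero_iff] at hy'
    have h2 := hy'.trans_le (min_le_left _ _)
    calc ‖y + y' - y₀‖ = ‖(y - y₀) + y'‖ := by congr 1; abel
      _ ≤ ‖y - y₀‖ + ‖y'‖ := norm_add_le _ _
      _ < ρ := by linarith
  · rw [mem_ball_iff_norm, add_sub_cancel_left, norm_smul, norm_inv, Real.norm_of_nonneg ht0.le]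
    have h2 := (mem_ball_iff_norm.1 hw).trans_le (min_le_right _ _)
    rw [inv_mul_lt_iff₀ ht0]
    exact h2

theorem hypCone_periodic (y : Fin d → ℝ) (k : Fin d → ℤ) :
    hypCone G B x (y + (2 * Real.pi) • intVec k) = hypCone G B x y := by
  have h : homPart (logf G) (cvec x (y + (2 * Real.pi) • intVec k)) =
      homPart (logf G) (cvec x y) := by
    have hp : taylorPart (logf G) (cvec x (y + (2 * Real.pi) • intVec k)) =
        taylorPart (logf G) (cvec x y) := by
      funext n w
      unfold taylorPart
      congr 2
      funext t
      have hw := eq_cvec (t • w)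
      rw [hw]
      have h1 : ∀ y', cvec x y' + cvec (fun i => ((t • w) i).re) (fun i => ((t • w) i).im) =
          cvec (x + fun i => ((t • w) i).re) (y' + fun i => ((t • w) i).im) := by
        intro y'
        ext i
        simp [cvec]
        ring
      rw [h1, h1, add_right_comm, logf_periodic]
    simp only [homPart, vanishDeg, hp]
  simp only [hypCone, h]

end Cones

/-! ### Smooth periodic selections -/

section Selection

variable {d : ℕ}

open scoped Manifold in
/-- Smooth periodic selections of a convex-valued map with locally constant selections. The torus
is embedded in `ℝ ^ (2 d)` by cosines and sines. -/
theorem exists_smooth_periodic_selection (T : (Fin d → ℝ) → Set (Fin d → ℝ))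
    (hconv : ∀ y, Convex ℝ (T y))
    (hper : ∀ y (k : Fin d → ℤ), T (y + (2 * Real.pi) • intVec k) = T y)
    (hloc : ∀ y, ∃ c, ∀ᶠ y' in 𝓝 y, c ∈ T y') :
    ∃ η : (Fin d → ℝ) → (Fin d → ℝ), ContDiff ℝ ∞ η ∧
      (∀ y (k : Fin d → ℤ), η (y + (2 * Real.pi) • intVec k) = η y) ∧ ∀ y, η y ∈ T y := by
  let e : (Fin d → ℝ) → (Fin d → ℝ × ℝ) := fun y i => (Real.cos (y i), Real.sin (y i))
  have he : ContDiff ℝ ∞ e := by fun_prop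
  have heper : ∀ y (k : Fin d → ℤ), e (y + (2 * Real.pi) • intVec k) = e y := by
    intro y k
    funext i
    simp only [e, Pi.add_apply, Pi.smul_apply, smul_eq_mul, intVec]
    rw [mul_comm, Real.cos_add_int_mul_two_pi, Real.sin_add_int_mul_two_pi]
  have heq : ∀ y y', e y = e y' → ∃ k : Fin d → ℤ, y = y' + (2 * Real.pi) • intVec k := by
    intro y y' h
    have : ∀ i, ∃ k : ℤ, y i - y' i = 2 * Real.pi * k := fun i => by
      have hi := congrFun h i
      simp only [e, Prod.mk.injEq] at hi
      exact Real.Angle.angle_eq_iff_two_pi_dvd_sub.1 (Real.Angle.cos_sin_inj hi.1 hi.2)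
    choose k hk using this
    refine ⟨k, funext fun i => ?_⟩
    simp only [Pi.add_apply, Pi.smul_apply, smul_eq_mul, intVec]
    linarith [hk i]
  have hloc' : ∀ p : Fin d → ℝ × ℝ, ∃ c : Fin d → ℝ, ∀ᶠ p' in 𝓝 p,
      c ∈ {v | ∀ y, e y = p' → v ∈ T y} := by
    intro p
    obtain ⟨c, hc⟩ : ∃ c : Fin d → ℝ, ∀ y, e y = p → ∀ᶠ y' in 𝓝 y, c ∈ T y' := by
      by_cases hp : ∃ y, e y = p
      · obtain ⟨y₀, hy₀⟩ := hp
        obtain ⟨c, hc⟩ := hloc y₀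
        refine ⟨c, fun y hy => ?_⟩
        obtain ⟨k, hk⟩ := heq y₀ y (hy₀.trans hy.symm)
        have ht : Filter.Tendsto (fun y' => y' + (2 * Real.pi) • intVec k) (𝓝 y) (𝓝 y₀) := by
          rw [hk]
          exact Continuous.tendsto (by fun_prop) y
        filter_upwards [ht.eventually hc] with y' hy'
        rwa [hper] at hy'
      · exact ⟨0, fun y hy => absurd ⟨y, hy⟩ hp⟩
    refine ⟨c, ?_⟩
    -- `c` is admissible over a neighborhood of `p`, as `e` is proper modulo periods.
    have hcomp : IsCompact (e '' (closedCube d ∩ (interior {y | c ∈ T y})ᶜ)) :=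
      (isCompact_closedCube.inter_right isOpen_interior.isClosed_compl).image he.continuous
    have hpn : p ∉ e '' (closedCube d ∩ (interior {y | c ∈ T y})ᶜ) := by
      rintro ⟨y, ⟨_, hy⟩, hyp⟩
      exact hy (mem_interior_iff_mem_nhds.2 (hc y hyp))
    filter_upwards [hcomp.isClosed.isOpen_compl.mem_nhds hpn] with p' hp'
    intro y hy
    obtain ⟨k, hk⟩ := exists_add_period_mem_cube y
    rw [← hper y k]
    by_contra hcon
    exact hp' ⟨y + (2 * Real.pi) • intVec k, ⟨cube_subset_closedCube hk,
      fun h => hcon (interior_subset (s := {y | c ∈ T y}) h)⟩, (heper y k).trans hy⟩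
  obtain ⟨η, hη⟩ := exists_contMDiffMap_forall_mem_convex_of_local_const (n := ⊤)
    𝓘(ℝ, Fin d → ℝ × ℝ) (t := fun p => {v | ∀ y, e y = p → v ∈ T y})
    (fun p v hv w hw a b ha hb hab y hy => hconv y (hv y hy) (hw y hy) ha hb hab) hloc'
  refine ⟨fun y => η (e y), (contMDiff_iff_contDiff.1 η.contMDiff).comp he, fun y k => ?_,
    fun y => hη (e y) y rfl⟩
  simp only [heper]

theorem pair_smul (r v : Fin d → ℝ) (c : ℝ) : pair r (c • v) = c * pair r v := by
  simp only [pair, Pi.smul_apply, smul_eq_mul, Finset.mul_sum]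
  exact Finset.sum_congr rfl fun i _ => by ring

theorem pair_add (r v w : Fin d → ℝ) : pair r (v + w) = pair r v + pair r w := by
  simp [pair, mul_add, Finset.sum_add_distrib]

variable {G : Laurent d} {B : Set (Fin d → ℝ)} {x r : Fin d → ℝ}

/-- A proper direction with a critical point is nonzero. -/
theorem len_pos_of_proper (hB : IsAmoebaComplComponent G B) (hr : IsProperDirection B r x)
    (hW : (critW G B x r).Nonempty) : 0 < len r := by
  refine lt_of_le_of_ne (Real.sqrt_nonneg _) fun h0 => ?_
  have h1 : ∑ i, r i ^ 2 = 0 :=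
    (Real.sqrt_eq_zero (Finset.sum_nonneg fun i _ => sq_nonneg _)).1 h0.symm
  have hr0 : ∀ i, r i = 0 := fun i => by
    have := (Finset.sum_eq_zero_iff_of_nonneg fun i _ => sq_nonneg (r i)).1 h1 i
      (Finset.mem_univ i)
    exact pow_eq_zero_iff two_ne_zero |>.1 this
  obtain ⟨b, hb⟩ := hB.nonempty
  obtain ⟨y, _, hy, _⟩ := hW
  by_cases hbx : b = x
  · subst hbx
    exact (notMem_amoeba_iff G b).1 (hB.subset hb) y hy
  · have := hr.2 b (subset_closure hb) hbx
    simp [pair, hr0] at this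

theorem exists_isDeformField (hB : IsAmoebaComplComponent G B) (hr : IsProperDirection B r x)
    (hW : (critW G B x r).Nonempty) {U : (Fin d → ℝ) → Set (Fin d → ℝ)}
    (hU : IsNbhdFamily (critW G B x r) U) :
    ∃ η, IsDeformField G B x r (critW G B x r) U η := by
  have hlen := len_pos_of_proper hB hr hW
  obtain ⟨u, hu⟩ := tanCone_nonempty hB.convex hB.isOpen hr.1
  suffices h : ∃ η : (Fin d → ℝ) → (Fin d → ℝ), ContDiff ℝ ∞ η ∧
      (∀ y (k : Fin d → ℤ), η (y + (2 * Real.pi) • intVec k) = η y) ∧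
      ∀ y, η y ∈ hypCone G B x y ∩
        {v | (∀ w ∈ critW G B x r, y ∉ U w) → pair r v = len r} by
    obtain ⟨η, h1, h2, h3⟩ := h
    exact ⟨η, h1, h2, fun y => (h3 y).1, fun y hy => (h3 y).2 hy⟩
  refine exists_smooth_periodic_selection
    (fun y => hypCone G B x y ∩ {v | (∀ w ∈ critW G B x r, y ∉ U w) → pair r v = len r})
    ?_ ?_ ?_
  · refine fun y => (hB.convex_hypCone hr.1 y).inter ?_
    intro v hv w hw a b _ _ hab hy
    rw [pair_add, pair_smul, pair_smul, hv hy, hw hy, ← add_mul, hab, one_mul]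
  · intro y k
    have : (∀ w ∈ critW G B x r, y + (2 * Real.pi) • intVec k ∉ U w) ↔
        ∀ w ∈ critW G B x r, y ∉ U w :=
      forall₂_congr fun w hw => not_congr (hU.periodic w hw y k)
    simp only [hypCone_periodic, this]
  · intro y
    by_cases hy : ∃ w ∈ critW G B x r, y ∈ U w
    · obtain ⟨w, hw, hyw⟩ := hy
      refine ⟨u, ?_⟩
      filter_upwards [(hU.isOpen w hw).mem_nhds hyw] with y' hy'
      exact ⟨hB.tanCone_subset_hypCone hr.1 y' hu, fun h => absurd hy' (h w hw)⟩
    · -- Here `y` is not critical modulo periods, so that some `v` in the cone has `r · v > 0`.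
      obtain ⟨v, hv, hpos⟩ : ∃ v ∈ hypCone G B x y, 0 < pair r v := by
        by_contra! hcon
        obtain ⟨k, hk⟩ := exists_add_period_mem_cube y
        by_cases h0 : logf G (cvec x y) = 0
        · have hmem : y + (2 * Real.pi) • intVec k ∈ critW G B x r := by
            refine ⟨hk, ?_, ?_⟩
            · rwa [logf_periodic]
            · rwa [hypCone_periodic]
          exact hy ⟨_, hmem, (hU.periodic _ hmem y k).1 (hU.mem _ hmem)⟩
        · have hrr : pair r r = len r ^ 2 := by
            rw [len, Real.sq_sqrt (Finset.sum_nonneg fun i _ => sq_nonneg _), pair]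
            exact Finset.sum_congr rfl fun i _ => by ring
          have := hcon r ?_
          · rw [hrr] at this
            nlinarith
          obtain ⟨g, L⟩ := exists_isLeadingPart G hB.exists_logf_ne_zero (cvec x y)
          have hdeg : vanishDeg (logf G) (cvec x y) = 0 := by
            refine Nat.sInf_eq_zero.2 (Or.inl ⟨0, ?_⟩)
            simpa [taylorPart] using h0
          have huniv : hypSet G x y = Set.univ := by
            refine Set.eq_univ_of_forall fun v => ?_
            have hne : ∀ w, homPart (logf G) (cvec x y) w ≠ 0 := fun w => by
              simpa [homPart, hdeg, taylorPart] using h0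
            exact ⟨hne _, fun _ _ h => absurd h (hne _)⟩
          rw [hB.mem_hypCone_iff hr.1 hu, huniv, connectedComponentIn_univ]
          rw [PreconnectedSpace.connectedComponent_eq_univ]
          trivial
      refine ⟨(len r / pair r v) • v, ?_⟩
      filter_upwards [hB.eventually_mem_hypCone hr.1
        (hB.smul_mem_hypCone hr.1 hv (c := len r / pair r v) (by positivity))] with y' hy'
      refine ⟨hy', fun _ => ?_⟩
      rw [pair_smul, div_mul_cancel₀ _ hpos.ne']

end Selection

/-! ### Deformation of chains -/

section Deformation

variable {d : ℕ}

/-- The determinant of a tuple of vectors as a continuous multilinear map over `ℝ`. -/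
def detMul (d : ℕ) : ContinuousMultilinearMap ℝ (fun _ : Fin d => Fin d → ℂ) ℂ :=
  ContinuousMultilinearMap.restrictScalars ℝ
    { toMultilinearMap := (Matrix.detRowAlternating (n := Fin d) (R := ℂ)).toMultilinearMap
      cont := by
        show Continuous fun C : Fin d → Fin d → ℂ => Matrix.det C
        exact Continuous.matrix_det continuous_id }

theorem detMul_apply (C : Fin d → Fin d → ℂ) : detMul d C = (Matrix.of C).det := rfl

theorem detMul_eq_det_transpose (C : Fin d → Fin d → ℂ) :
    detMul d C = (Matrix.of fun i j => C j i).det := by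
  rw [detMul_apply, ← Matrix.det_transpose]
  rfl

/-- Cramer's rule. -/
theorem detMul_mul_apply (C : Fin d → Fin d → ℂ) (V : Fin d → ℂ) (γ : (Fin d → ℂ) →ₗ[ℂ] ℂ) :
    detMul d C * γ V = ∑ j, detMul d (Function.update C j V) * γ (C j) := by
  have h := Matrix.mulVec_cramer (Matrix.of C).transpose V
  have h2 : ∀ j, detMul d (Function.update C j V) =
      Matrix.cramer (Matrix.of C).transpose V j := fun j => by
    rw [Matrix.cramer_transpose_apply]
    rfl
  have h3 : ∑ j, Matrix.cramer (Matrix.of C).transpose V j • C j = detMul d C • V := by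
    rw [Matrix.det_transpose] at h
    rw [detMul_apply, ← h]
    ext i
    simp only [Finset.sum_apply, Pi.smul_apply, smul_eq_mul, Matrix.mulVec, dotProduct,
      Matrix.transpose_apply, Matrix.of_apply]
    exact Finset.sum_congr rfl fun j _ => mul_comm _ _
  rw [← smul_eq_mul, ← map_smul, ← h3, map_sum]
  simp only [map_smul, smul_eq_mul, h2]

/-- Exchanging two columns. -/
theorem detMul_update_update_symm (C : Fin d → Fin d → ℂ) (V W : Fin d → ℂ) {j l : Fin d}
    (hjl : j ≠ l) : detMul d (Function.update (Function.update C j V) l W) =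
      -detMul d (Function.update (Function.update C l V) j W) := by
  have h := (Matrix.detRowAlternating (n := Fin d) (R := ℂ)).map_swap
    (Function.update (Function.update C l V) j W) hjl
  have h2 : (Function.update (Function.update C l V) j W) ∘ Equiv.swap j l =
      Function.update (Function.update C j V) l W := by
    funext i
    by_cases hi : i = j
    · subst hi
      simp [hjl, hjl.symm]
    · by_cases hi' : i = l
      · subst hi'
        simp
      · simp [Equiv.swap_apply_of_ne_of_ne hi hi', hi, hi']
  rw [h2] at h
  exact h

/-- The divergence of the vector field `(g det C, -g det (C; j → V))` vanishes: Cramer's rule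
takes care of the derivatives of `g`, and the second derivatives `H` cancel by symmetry. -/
theorem divergence_eq_zero (C : Fin d → Fin d → ℂ) (V : Fin d → ℂ) (γ : (Fin d → ℂ) →ₗ[ℂ] ℂ)
    (g : ℂ) (v : Fin d → Fin d → ℂ) (H : Fin d → Fin d → Fin d → ℂ)
    (hH : ∀ j l, H j l = H l j) :
    (g * ∑ l, detMul d (Function.update C l (v l)) + detMul d C * γ V) +
      ∑ j, -(g * ∑ l, detMul d (Function.update (Function.update C j V) l
          (if l = j then v j else H j l)) +
        detMul d (Function.update C j V) * γ (C j)) = 0 := by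
  have key : ∑ j, ∑ l, detMul d (Function.update (Function.update C j V) l
      (if l = j then v j else H j l)) = ∑ l, detMul d (Function.update C l (v l)) := by
    have h1 : ∀ j l, detMul d (Function.update (Function.update C j V) l
        (if l = j then v j else H j l)) =
          (if l = j then detMul d (Function.update C j (v j)) else 0) +
          (if l = j then 0 else
            detMul d (Function.update (Function.update C j V) l (H j l))) := by
      intro j l
      by_cases h : l = j
      · subst h
        simp
      · simp [h]
    simp only [h1, Finset.sum_add_distrib, Finset.sum_ite_eq', Finset.mem_univ, if_true]
    have h2 : ∑ j : Fin d, ∑ l : Fin d, (if l = j then 0 else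
        detMul d (Function.update (Function.update C j V) l (H j l))) = 0 := by
      refine self_eq_neg.1 ?_
      conv_lhs => rw [Finset.sum_comm]
      simp only [← Finset.sum_neg_distrib]
      refine Finset.sum_congr rfl fun j _ => Finset.sum_congr rfl fun l _ => ?_
      by_cases h : l = j
      · simp [h]
      · rw [if_neg h, if_neg (Ne.symm h), detMul_update_update_symm C V _ h, hH]
    rw [h2, add_zero]
  rw [Finset.sum_neg_distrib, Finset.sum_add_distrib, ← Finset.mul_sum, key, detMul_mul_apply]
  ring

/-- The tail of a vector as a continuous linear map. -/
def tailL (d : ℕ) : (Fin (d + 1) → ℝ) →L[ℝ] (Fin d → ℝ) :=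
  ContinuousLinearMap.pi fun i => ContinuousLinearMap.proj i.succ

@[simp] theorem tailL_apply (q : Fin (d + 1) → ℝ) : tailL d q = fun i => q i.succ := rfl

/-- Deformation invariance of the integral of a closed form `g dz` over a torus, for the affine
deformation `P + t V`. The function `g` may be multivalued: it is given along the deformation, and
its derivative factors through a complex linear map. -/
theorem integral_deformation {P V : (Fin d → ℝ) → (Fin d → ℂ)} (hP : ContDiff ℝ 2 P)
    (hV : ContDiff ℝ 2 V) {g : ℝ → (Fin d → ℝ) → ℂ}
    (hgc : ContinuousOn (fun p : ℝ × (Fin d → ℝ) => g p.1 p.2) (Set.Icc 0 1 ×ˢ Set.univ))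
    (hgd : ∀ q : Fin (d + 1) → ℝ, q 0 ∈ Set.Ioo (0 : ℝ) 1 → ∃ γ : (Fin d → ℂ) →L[ℂ] ℂ,
      HasFDerivAt (fun q : Fin (d + 1) → ℝ => g (q 0) (tailL d q))
        ((γ.restrictScalars ℝ).comp (fderiv ℝ (fun q : Fin (d + 1) → ℝ =>
          P (tailL d q) + (q 0) • V (tailL d q)) q)) q)
    (hVper : ∀ y (k : Fin d → ℤ), V (y + (2 * Real.pi) • intVec k) = V y)
    (hPper : ∀ y (k : Fin d → ℤ), fderiv ℝ P (y + (2 * Real.pi) • intVec k) = fderiv ℝ P y)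
    (hgper : ∀ t ∈ Set.Icc (0 : ℝ) 1, ∀ y (k : Fin d → ℤ),
      g t (y + (2 * Real.pi) • intVec k) = g t y) :
    ∫ y in closedCube d, g 1 y * detMul d (fun j => fderiv ℝ (fun y => P y + V y) y
        (Pi.single j 1)) =
      ∫ y in closedCube d, g 0 y * detMul d (fun j => fderiv ℝ P y (Pi.single j 1)) := by
  have hPd : Differentiable ℝ P := hP.differentiable (by norm_num)
  have hVd : Differentiable ℝ V := hV.differentiable (by norm_num)
  have hP' : ContDiff ℝ 1 (fderiv ℝ P) := hP.fderiv_right (by norm_num)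
  have hV' : ContDiff ℝ 1 (fderiv ℝ V) := hV.fderiv_right (by norm_num)
  have hP'd : Differentiable ℝ (fderiv ℝ P) := hP'.differentiable (by norm_num)
  have hV'd : Differentiable ℝ (fderiv ℝ V) := hV'.differentiable (by norm_num)
  have hVper' : ∀ y (k : Fin d → ℤ), fderiv ℝ V (y + (2 * Real.pi) • intVec k) =
      fderiv ℝ V y := by
    intro y k
    rw [← fderiv_comp_add_right]
    congr 1
    exact funext fun y => hVper y k
  let C : (Fin (d + 1) → ℝ) → Fin d → Fin d → ℂ := fun q j =>
    fderiv ℝ P (tailL d q) (Pi.single j 1) + (q 0) • fderiv ℝ V (tailL d q) (Pi.single j 1)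
  let W : (Fin (d + 1) → ℝ) → Fin d → ℂ := fun q => V (tailL d q)
  let gq : (Fin (d + 1) → ℝ) → ℂ := fun q => g (q 0) (tailL d q)
  have hCc : Continuous C := by
    have := hP'.continuous
    have := hV'.continuous
    fun_prop
  have hWc : Continuous W := by
    have := hV.continuous
    fun_prop
  let f : Fin (d + 1) → (Fin (d + 1) → ℝ) → ℂ := Fin.cons (fun q => gq q * detMul d (C q))
    fun j q => -(gq q * detMul d (Function.update (C q) j (W q)))
  set a : Fin (d + 1) → ℝ := 0 with ha
  set b : Fin (d + 1) → ℝ := Fin.cons 1 fun _ => 2 * Real.pi with hb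
  have hpi := Real.two_pi_pos
  have hab : a ≤ b := by
    intro i
    refine Fin.cases ?_ (fun j => ?_) i
    · simp [a, b]
    · simpa [a, b] using hpi.le
  have hq0 : ∀ q ∈ Set.Icc a b, q 0 ∈ Set.Icc (0 : ℝ) 1 := fun q hq =>
    ⟨by simpa [a] using hq.1 0, by simpa [b] using hq.2 0⟩
  have hgqc : ContinuousOn gq (Set.Icc a b) := by
    refine hgc.comp (f := fun q : Fin (d + 1) → ℝ => (q 0, tailL d q)) (by fun_prop)
      fun q hq => ⟨hq0 q hq, trivial⟩
  have hfc : ∀ i, ContinuousOn (f i) (Set.Icc a b) := by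
    intro i
    refine Fin.cases ?_ (fun j => ?_) i
    · exact hgqc.mul ((detMul d).cont.comp hCc).continuousOn
    · exact (hgqc.mul ((detMul d).cont.comp (hCc.update j hWc)).continuousOn).neg
  -- The derivatives of the columns and of the deformation field.
  let W' : (Fin (d + 1) → ℝ) → (Fin (d + 1) → ℝ) →L[ℝ] (Fin d → ℂ) := fun q =>
    (fderiv ℝ V (tailL d q)).comp (tailL d)
  have hW' : ∀ q, HasFDerivAt W (W' q) q := fun q =>
    (hVd (tailL d q)).hasFDerivAt.comp q (tailL d).hasFDerivAt
  have hCj : ∀ q j, ∃ C' : (Fin (d + 1) → ℝ) →L[ℝ] (Fin d → ℂ),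
      HasFDerivAt (fun q => C q j) C' q ∧ ∀ w, C' w =
        fderiv ℝ (fderiv ℝ P) (tailL d q) (tailL d w) (Pi.single j 1) +
        ((q 0) • fderiv ℝ (fderiv ℝ V) (tailL d q) (tailL d w) (Pi.single j 1) +
          (w 0) • fderiv ℝ V (tailL d q) (Pi.single j 1)) := by
    intro q j
    have h1 : HasFDerivAt (fun q => fderiv ℝ P (tailL d q) (Pi.single j 1))
        (((ContinuousLinearMap.apply ℝ (Fin d → ℂ) (Pi.single j (1 : ℝ) : Fin d → ℝ)).comp
          (fderiv ℝ (fderiv ℝ P) (tailL d q))).comp (tailL d)) q :=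
      ((ContinuousLinearMap.apply ℝ (Fin d → ℂ)
        (Pi.single j (1 : ℝ) : Fin d → ℝ)).hasFDerivAt.comp _
          (hP'd (tailL d q)).hasFDerivAt).comp q (tailL d).hasFDerivAt
    have h2 : HasFDerivAt (fun q => fderiv ℝ V (tailL d q) (Pi.single j 1))
        (((ContinuousLinearMap.apply ℝ (Fin d → ℂ) (Pi.single j (1 : ℝ) : Fin d → ℝ)).comp
          (fderiv ℝ (fderiv ℝ V) (tailL d q))).comp (tailL d)) q :=
      ((ContinuousLinearMap.apply ℝ (Fin d → ℂ)
        (Pi.single j (1 : ℝ) : Fin d → ℝ)).hasFDerivAt.comp _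
          (hV'd (tailL d q)).hasFDerivAt).comp q (tailL d).hasFDerivAt
    have h3 : HasFDerivAt (fun q : Fin (d + 1) → ℝ => q 0)
        (ContinuousLinearMap.proj (R := ℝ) (0 : Fin (d + 1))) q :=
      hasFDerivAt_apply 0 q
    exact ⟨_, h1.add (h3.smul h2), fun w => rfl⟩
  choose C' hC' hC'w using hCj
  have hdetC : ∀ q, HasFDerivAt (fun q => detMul d (C q))
      (((detMul d).linearDeriv (C q)).comp (ContinuousLinearMap.pi (C' q))) q := fun q =>
    ((detMul d).hasFDerivAt (C q)).comp q (hasFDerivAt_pi.2 fun j => hC' q j)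
  let Cu' : (Fin (d + 1) → ℝ) → Fin d → Fin d → (Fin (d + 1) → ℝ) →L[ℝ] (Fin d → ℂ) :=
    fun q j l => if l = j then W' q else C' q l
  have hdetCu : ∀ q j, HasFDerivAt (fun q => detMul d (Function.update (C q) j (W q)))
      (((detMul d).linearDeriv (Function.update (C q) j (W q))).comp
        (ContinuousLinearMap.pi (Cu' q j))) q := by
    intro q j
    refine ((detMul d).hasFDerivAt (Function.update (C q) j (W q))).comp q
      (hasFDerivAt_pi.2 fun l => ?_)
    by_cases h : l = j
    · subst h
      simpa [Cu'] using hW' q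
    · simpa [Cu', h] using hC' q l
  have hΦ : ∀ q w, fderiv ℝ (fun q : Fin (d + 1) → ℝ => P (tailL d q) + (q 0) • V (tailL d q)) q w =
      fderiv ℝ P (tailL d q) (tailL d w) + ((q 0) • fderiv ℝ V (tailL d q) (tailL d w) +
        (w 0) • V (tailL d q)) := by
    intro q w
    have h1 := (hPd (tailL d q)).hasFDerivAt.comp q (tailL d).hasFDerivAt
    have h3 : HasFDerivAt (fun q : Fin (d + 1) → ℝ => q 0)
        (ContinuousLinearMap.proj (R := ℝ) (0 : Fin (d + 1))) q :=
      hasFDerivAt_apply 0 q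
    have h := (h1.add (h3.smul (hW' q))).fderiv
    have h' := congrArg (fun T => T w) h
    exact h'
  have ht0 : tailL d (Pi.single 0 1) = 0 := by
    ext i
    simp
  have htj : ∀ j : Fin d, tailL d (Pi.single j.succ 1) = Pi.single j 1 := by
    intro j
    ext i
    simp [Pi.single_apply, Fin.succ_inj]
  -- The vector field is divergence free.
  have hdiv : ∀ q : Fin (d + 1) → ℝ, q 0 ∈ Set.Ioo (0 : ℝ) 1 →
      ∃ f' : Fin (d + 1) → (Fin (d + 1) → ℝ) →L[ℝ] ℂ,
        (∀ i, HasFDerivAt (f i) (f' i) q) ∧ ∑ i, f' i (Pi.single i 1) = 0 := by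
    intro q hq
    obtain ⟨γ, hγ⟩ := hgd q hq
    set Γ := (γ.restrictScalars ℝ).comp (fderiv ℝ (fun q : Fin (d + 1) → ℝ =>
      P (tailL d q) + (q 0) • V (tailL d q)) q) with hΓ
    refine ⟨Fin.cons (gq q • ((detMul d).linearDeriv (C q)).comp
          (ContinuousLinearMap.pi (C' q)) + detMul d (C q) • Γ)
        fun j => -(gq q • ((detMul d).linearDeriv (Function.update (C q) j (W q))).comp
          (ContinuousLinearMap.pi (Cu' q j)) + detMul d (Function.update (C q) j (W q)) • Γ),
      fun i => Fin.cases (hγ.mul (hdetC q)) (fun j => (hγ.mul (hdetCu q j)).neg) i, ?_⟩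
    rw [Fin.sum_univ_succ]
    have hsymP : IsSymmSndFDerivAt ℝ P (tailL d q) :=
      hP.contDiffAt.isSymmSndFDerivAt (by simp)
    have hsymV : IsSymmSndFDerivAt ℝ V (tailL d q) :=
      hV.contDiffAt.isSymmSndFDerivAt (by simp)
    have key := divergence_eq_zero (C q) (W q) γ.toLinearMap (gq q)
      (fun l => fderiv ℝ V (tailL d q) (Pi.single l 1))
      (fun j l => fderiv ℝ (fderiv ℝ P) (tailL d q) (Pi.single j 1) (Pi.single l 1) +
        (q 0) • fderiv ℝ (fderiv ℝ V) (tailL d q) (Pi.single j 1) (Pi.single l 1))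
      (fun j l => by rw [hsymP.eq, hsymV.eq])
    rw [← key]
    have hsucc : ∀ j : Fin d, (Pi.single j.succ (1 : ℝ) : Fin (d + 1) → ℝ) 0 = 0 := fun j => by
      simp
    simp only [Fin.cons_zero, Fin.cons_succ, add_apply, neg_apply,
      smul_apply, ContinuousLinearMap.comp_apply, smul_eq_mul,
      hΓ, ContinuousLinearMap.coe_restrictScalars', hΦ, ht0, htj, hsucc, map_zero, smul_zero, zero_smul,
      zero_add, add_zero, Pi.single_eq_same, one_smul, ContinuousMultilinearMap.linearDeriv_apply,
      ContinuousLinearMap.pi_apply, hC'w]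
    congr 1
    · simp [gq, W]
    · refine Finset.sum_congr rfl fun j _ => ?_
      congr 3
      refine Finset.sum_congr rfl fun l _ => ?_
      congr 2
      by_cases h : l = j
      · subst h
        simp only [Cu', if_true, W', ContinuousLinearMap.comp_apply, htj]
      · simp only [Cu', if_neg h, hC'w, htj, hsucc, zero_smul, add_zero]
  choose f' hf' hf'0 using hdiv
  have hIoo : ∀ q ∈ (Set.univ.pi fun i => Set.Ioo (a i) (b i)) \ (∅ : Set (Fin (d + 1) → ℝ)),
      q 0 ∈ Set.Ioo (0 : ℝ) 1 := by
    intro q hq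
    simpa [a, b] using hq.1 0 trivial
  classical
  have hsum : ∀ q : Fin (d + 1) → ℝ, ∑ i, (if h : q 0 ∈ Set.Ioo (0 : ℝ) 1 then f' q h i else 0)
      (Pi.single i 1) = 0 := by
    intro q
    by_cases h : q 0 ∈ Set.Ioo (0 : ℝ) 1
    · simp only [dif_pos h, hf'0]
    · simp only [dif_neg h, zero_apply, Finset.sum_const_zero]
  have hmain := MeasureTheory.integral_divergence_of_hasFDerivAt_off_countable' a b hab f
    (fun i q => if h : q 0 ∈ Set.Ioo (0 : ℝ) 1 then f' q h i else 0) ∅ Set.countable_empty hfc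
    (fun q hq i => by
      have h := hIoo q hq
      simp only [dif_pos h]
      exact hf' q h i)
    (by simp only [hsum]; exact MeasureTheory.integrableOn_zero)
  simp only [hsum, MeasureTheory.integral_zero] at hmain
  rw [Fin.sum_univ_succ] at hmain
  -- The faces in the torus directions cancel in pairs by periodicity.
  have hface : ∀ j : Fin d,
      ((∫ y in Set.Icc (a ∘ j.succ.succAbove) (b ∘ j.succ.succAbove),
          f j.succ (j.succ.insertNth (b j.succ) y)) -
        ∫ y in Set.Icc (a ∘ j.succ.succAbove) (b ∘ j.succ.succAbove),
          f j.succ (j.succ.insertNth (a j.succ) y)) = 0 := by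
    intro j
    rw [sub_eq_zero]
    refine MeasureTheory.setIntegral_congr_fun measurableSet_Icc fun y hy => ?_
    obtain ⟨d', rfl⟩ : ∃ d', d = d' + 1 := ⟨d - 1, by have := j.pos; omega⟩
    set q₁ : Fin (d' + 1 + 1) → ℝ := j.succ.insertNth (b j.succ) y with hq₁
    set q₀ : Fin (d' + 1 + 1) → ℝ := j.succ.insertNth (a j.succ) y with hq₀
    have h0 : q₁ 0 = q₀ 0 := by
      rw [hq₁, hq₀, ← Fin.succ_succAbove_zero j, Fin.insertNth_apply_succAbove,
        Fin.insertNth_apply_succAbove]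
    have h0I : q₀ 0 ∈ Set.Icc (0 : ℝ) 1 := by
      rw [hq₀, ← Fin.succ_succAbove_zero j, Fin.insertNth_apply_succAbove]
      have h1 := hy.1 0
      have h2 := hy.2 0
      simp only [Function.comp_apply, Fin.succ_succAbove_zero] at h1 h2
      exact ⟨by simpa [a] using h1, by simpa [b] using h2⟩
    have htail : tailL (d' + 1) q₁ = tailL (d' + 1) q₀ + (2 * Real.pi) • intVec (Pi.single j 1) := by
      ext i
      simp only [tailL_apply, Pi.add_apply, Pi.smul_apply, intVec, smul_eq_mul]
      by_cases hi : i = j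
      · subst hi
        rw [hq₁, hq₀, Fin.insertNth_apply_same, Fin.insertNth_apply_same]
        simp [a, b]
      · obtain ⟨l, hl⟩ := Fin.exists_succAbove_eq (x := i.succ) (y := j.succ)
          (fun h => hi (Fin.succ_injective _ h))
        rw [← hl, hq₁, hq₀, Fin.insertNth_apply_succAbove, Fin.insertNth_apply_succAbove]
        simp [hi]
    have e1 : gq q₁ = gq q₀ := by
      simp only [gq]
      rw [htail, h0, hgper _ h0I]
    have e2 : C q₁ = C q₀ := by
      funext l
      simp only [C]
      rw [htail, h0, hPper, hVper']
    have e3 : W q₁ = W q₀ := by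
      simp only [W]
      rw [htail, hVper]
    show -(gq q₁ * detMul (d' + 1) (Function.update (C q₁) j (W q₁))) =
      -(gq q₀ * detMul (d' + 1) (Function.update (C q₀) j (W q₀)))
    rw [e1, e2, e3]
  rw [Finset.sum_eq_zero fun j _ => hface j, add_zero] at hmain
  have hIcc : Set.Icc (a ∘ (0 : Fin (d + 1)).succAbove) (b ∘ (0 : Fin (d + 1)).succAbove) =
      closedCube d := by
    simp only [closedCube, a, b]
    congr 1
  have hins : ∀ (c : ℝ) (y : Fin d → ℝ), f 0 ((0 : Fin (d + 1)).insertNth c y) =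
      g c y * detMul d (fun j => fderiv ℝ P y (Pi.single j 1) +
        c • fderiv ℝ V y (Pi.single j 1)) := by
    intro c y
    rw [Fin.insertNth_zero']
    rfl
  simp only [hIcc, hins] at hmain
  have hadd : ∀ y, fderiv ℝ (fun y => P y + V y) y = fderiv ℝ P y + fderiv ℝ V y := fun y =>
    fderiv_fun_add (hPd y) (hVd y)
  have ha0 : a 0 = 0 := rfl
  have hb0 : b 0 = 1 := rfl
  rw [ha0, hb0] at hmain
  simp only [one_smul, zero_smul, add_zero] at hmain
  simp only [hadd, add_apply]
  exact sub_eq_zero.1 hmain.symm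

end Deformation

/-! ### Continuation of logarithms -/

section Continuation

variable {d : ℕ}

theorem contDiff_logf (F : Laurent d) : ContDiff ℂ ∞ (logf F) := by
  have : logf F = fun z => ∑ k ∈ F.coeff.support,
      F.coeff k * Complex.exp (pairC (intVec k) z) := funext (logf_eq_sum F)
  rw [this]
  unfold pairC
  fun_prop

/-- The translation by `2πi k`, which leaves the exponential invariant. -/
def periodC (k : Fin d → ℤ) : Fin d → ℂ := Complex.I • toC ((2 * Real.pi) • intVec k)

theorem cexp_add_periodC (z : Fin d → ℂ) (k : Fin d → ℤ) : cexp (z + periodC k) = cexp z := by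
  have h : z + periodC k =
      cvec (fun i => (z i).re) ((fun i => (z i).im) + (2 * Real.pi) • intVec k) := by
    conv_lhs => rw [eq_cvec z]
    rw [periodC, cvec_add_I_smul_toC]
  rw [h, cvec_add_period, ← eq_cvec]

theorem logf_add_periodC (F : Laurent d) (z : Fin d → ℂ) (k : Fin d → ℤ) :
    logf F (z + periodC k) = logf F z := by
  simp only [logf, cexp_add_periodC]

theorem fderiv_logf_add_periodC (F : Laurent d) (z : Fin d → ℂ) (k : Fin d → ℤ) :
    fderiv ℂ (logf F) (z + periodC k) = fderiv ℂ (logf F) z := by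
  rw [← fderiv_comp_add_right]
  congr 1
  exact funext fun z => logf_add_periodC F z k

/-- The logarithmic derivative of `f` along `t ↦ P y + t V y`, frozen outside `[0, 1]`. -/
def logDerivAlong (F : Laurent d) (P V : (Fin d → ℝ) → (Fin d → ℂ)) (y : Fin d → ℝ) (t : ℝ) : ℂ :=
  fderiv ℂ (logf F) (P y + (max 0 (min t 1)) • V y) (V y) /
    logf F (P y + (max 0 (min t 1)) • V y)

/-- The continuation of the logarithm `ℓ` of `f` along `t ↦ P y + t V y`, as the integral of the
logarithmic derivative. -/
def contLog (F : Laurent d) (ℓ : (Fin d → ℂ) → ℂ) (P V : (Fin d → ℝ) → (Fin d → ℂ)) (t : ℝ)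
    (y : Fin d → ℝ) : ℂ :=
  ℓ (P y) + ∫ τ in (0 : ℝ)..t, logDerivAlong F P V y τ

variable {F : Laurent d} {ℓ : (Fin d → ℂ) → ℂ} {P V : (Fin d → ℝ) → (Fin d → ℂ)}

theorem clamp_mem (t : ℝ) : max 0 (min t 1) ∈ Set.Icc (0 : ℝ) 1 :=
  ⟨le_max_left _ _, max_le zero_le_one (min_le_right _ _)⟩

theorem clamp_eq {t : ℝ} (ht : t ∈ Set.Icc (0 : ℝ) 1) : max 0 (min t 1) = t := by
  rw [min_eq_left ht.2, max_eq_right ht.1]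

theorem continuous_logDerivAlong (hP : Continuous P) (hV : Continuous V)
    (hF : ∀ t ∈ Set.Icc (0 : ℝ) 1, ∀ y, logf F (P y + t • V y) ≠ 0) :
    Continuous fun p : (Fin d → ℝ) × ℝ => logDerivAlong F P V p.1 p.2 := by
  have h1 : Continuous (fderiv ℂ (logf F)) := (contDiff_logf F).continuous_fderiv (by simp)
  have h2 := continuous_logf F
  unfold logDerivAlong
  refine Continuous.div (Continuous.clm_apply ?_ ?_) ?_ fun p => hF _ (clamp_mem _) _
  · fun_prop
  · fun_prop
  · fun_prop

theorem continuous_contLog (hP : Continuous P) (hV : Continuous V)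
    (hF : ∀ t ∈ Set.Icc (0 : ℝ) 1, ∀ y, logf F (P y + t • V y) ≠ 0)
    (hℓ : Continuous fun y => ℓ (P y)) :
    Continuous fun p : ℝ × (Fin d → ℝ) => contLog F ℓ P V p.1 p.2 := by
  have h := continuous_logDerivAlong hP hV hF
  unfold contLog
  refine (hℓ.comp continuous_snd).add ?_
  have h3 : Continuous (Function.uncurry fun (p : ℝ × (Fin d → ℝ)) τ =>
      logDerivAlong F P V p.2 τ) :=
    h.comp (f := fun x : (ℝ × (Fin d → ℝ)) × ℝ => (x.1.2, x.2)) (by fun_prop)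
  exact intervalIntegral.continuous_parametric_intervalIntegral_of_continuous h3 continuous_fst

theorem exp_contLog (hP : Continuous P) (hV : Continuous V)
    (hF : ∀ t ∈ Set.Icc (0 : ℝ) 1, ∀ y, logf F (P y + t • V y) ≠ 0)
    (hℓ : ∀ y, Complex.exp (ℓ (P y)) = logf F (P y)) {t : ℝ} (ht : t ∈ Set.Icc (0 : ℝ) 1)
    (y : Fin d → ℝ) : Complex.exp (contLog F ℓ P V t y) = logf F (P y + t • V y) := by
  have h := (continuous_logDerivAlong hP hV hF).comp (f := fun τ : ℝ => (y, τ)) (by fun_prop)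
  have hL : ∀ t, HasDerivAt (fun t => contLog F ℓ P V t y) (logDerivAlong F P V y t) t := fun t =>
    (intervalIntegral.integral_hasDerivAt_right (h.intervalIntegrable _ _)
      (h.stronglyMeasurableAtFilter _ _) h.continuousAt).const_add _
  have hf : ∀ t : ℝ, HasDerivAt (fun t : ℝ => logf F (P y + t • V y))
      (fderiv ℂ (logf F) (P y + t • V y) (V y)) t := by
    intro t
    have h1 := (differentiable_logf F (P y + t • V y)).hasFDerivAt.restrictScalars ℝ
    have h2 : HasDerivAt (fun t : ℝ => P y + t • V y) (V y) t := by
      simpa using ((hasDerivAt_id t).smul_const (V y)).const_add (P y)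
    exact h1.comp_hasDerivAt t h2
  have hconst := constant_of_has_deriv_right_zero
    (f := fun t => Complex.exp (-contLog F ℓ P V t y) * logf F (P y + t • V y)) (a := 0) (b := 1)
    (fun t _ => ((hL t).neg.cexp.mul (hf t)).continuousAt.continuousWithinAt)
    (fun t ht => by
      refine (((hL t).neg.cexp.mul (hf t)).congr_deriv ?_).hasDerivWithinAt
      have ht' : t ∈ Set.Icc (0 : ℝ) 1 := ⟨ht.1, ht.2.le⟩
      have hne := hF t ht' y
      rw [logDerivAlong, clamp_eq ht']
      field_simp
      ring) t ht
  simp only [contLog, intervalIntegral.integral_same, add_zero, zero_smul] at hconst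
  have hne : logf F (P y) ≠ 0 := by
    simpa using hF 0 ⟨le_rfl, zero_le_one⟩ y
  rw [Complex.exp_neg (ℓ (P y)), hℓ, inv_mul_cancel₀ hne, Complex.exp_neg,
    inv_mul_eq_one₀ (Complex.exp_ne_zero _)] at hconst
  exact hconst

theorem contLog_zero (y : Fin d → ℝ) : contLog F ℓ P V 0 y = ℓ (P y) := by
  simp [contLog]

theorem contLog_add_period (hPper : ∀ y (k : Fin d → ℤ),
      P (y + (2 * Real.pi) • intVec k) = P y + periodC k)
    (hVper : ∀ y (k : Fin d → ℤ), V (y + (2 * Real.pi) • intVec k) = V y) (t : ℝ)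
    (y : Fin d → ℝ) (k : Fin d → ℤ) :
    contLog F ℓ P V t (y + (2 * Real.pi) • intVec k) =
      contLog F ℓ P V t y + (ℓ (P y + periodC k) - ℓ (P y)) := by
  have h : ∀ τ, logDerivAlong F P V (y + (2 * Real.pi) • intVec k) τ =
      logDerivAlong F P V y τ := by
    intro τ
    simp only [logDerivAlong, hPper, hVper, add_right_comm _ (periodC k),
      fderiv_logf_add_periodC, logf_add_periodC]
  simp only [contLog, h, hPper]
  ring

/-! ### Functions with holomorphic derivative along a map -/

variable {E : Type*} [NormedAddCommGroup E] [NormedSpace ℝ E]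

/-- The derivative of `g` at `q` factors through `Φ'` by a complex linear map, as it does for a
function that is locally a holomorphic function of a map with derivative `Φ'`. -/
def HasHolDerivAt (Φ' : E →L[ℝ] (Fin d → ℂ)) (g : E → ℂ) (q : E) : Prop :=
  ∃ γ : (Fin d → ℂ) →L[ℂ] ℂ, HasFDerivAt g ((γ.restrictScalars ℝ).comp Φ') q

variable {Φ' : E →L[ℝ] (Fin d → ℂ)} {g h : E → ℂ} {q : E}

theorem HasHolDerivAt.mul (hg : HasHolDerivAt Φ' g q) (hh : HasHolDerivAt Φ' h q) :
    HasHolDerivAt Φ' (fun q => g q * h q) q := by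
  obtain ⟨γ, hγ⟩ := hg
  obtain ⟨δ, hδ⟩ := hh
  refine ⟨g q • δ + h q • γ, (hγ.mul hδ).congr_fderiv ?_⟩
  ext w
  simp

theorem HasHolDerivAt.exp_const_mul (hg : HasHolDerivAt Φ' g q) (c : ℂ) :
    HasHolDerivAt Φ' (fun q => Complex.exp (c * g q)) q := by
  obtain ⟨γ, hγ⟩ := hg
  refine ⟨(Complex.exp (c * g q) * c) • γ, (hγ.const_mul c).cexp.congr_fderiv ?_⟩
  ext w
  simp [mul_assoc]

theorem HasHolDerivAt.prod {ι : Type*} (S : Finset ι) {g : ι → E → ℂ}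
    (hg : ∀ j, HasHolDerivAt Φ' (g j) q) : HasHolDerivAt Φ' (fun q => ∏ j ∈ S, g j q) q := by
  classical
  induction S using Finset.induction_on with
  | empty =>
    refine ⟨0, ?_⟩
    simp only [Finset.prod_empty]
    exact (hasFDerivAt_const (1 : ℂ) q).congr_fderiv (by ext; simp)
  | insert j S hj ih =>
    simp only [Finset.prod_insert hj]
    exact (hg j).mul ih

theorem HasHolDerivAt.comp {f : (Fin d → ℂ) → ℂ} {Φ : E → (Fin d → ℂ)}
    (hf : DifferentiableAt ℂ f (Φ q)) (hΦ : HasFDerivAt Φ Φ' q) :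
    HasHolDerivAt Φ' (fun q => f (Φ q)) q :=
  ⟨fderiv ℂ f (Φ q), (hf.hasFDerivAt.restrictScalars ℝ).comp q hΦ⟩

/-- A continuous logarithm inherits the property. -/
theorem HasHolDerivAt.log {L : E → ℂ} (hL : ContinuousAt L q)
    (hexp : ∀ᶠ p in 𝓝 q, Complex.exp (L p) = h p) (hh : HasHolDerivAt Φ' h q) :
    HasHolDerivAt Φ' L q := by
  obtain ⟨γ, hγ⟩ := hh
  have hne : h q ≠ 0 := by
    rw [← hexp.self_of_nhds]
    exact Complex.exp_ne_zero _
  have h1 : HasFDerivAt (fun p => h p / h q) ((h q)⁻¹ • ((γ.restrictScalars ℝ).comp Φ')) q := by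
    simpa [div_eq_mul_inv] using hγ.mul_const (h q)⁻¹
  have hlog : HasFDerivAt Complex.log ((1 : ℂ)⁻¹ • (1 : ℂ →L[ℝ] ℂ)) (h q / h q) := by
    rw [div_self hne]
    exact (Complex.hasDerivAt_log (by simp)).complexToReal_fderiv
  have h2 := (hlog.comp q h1).const_add (L q)
  refine ⟨(h q)⁻¹ • γ, (h2.congr_of_eventuallyEq ?_).congr_fderiv ?_⟩
  -- Near `q`, `L - L q` is the principal logarithm of `h / h q`.
  · have him : ContinuousAt (fun p => |(L p - L q).im|) q := by fun_prop
    have hsmall : ∀ᶠ p in 𝓝 q, |(L p - L q).im| < Real.pi := by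
      refine him.eventually (gt_mem_nhds ?_)
      simpa using Real.pi_pos
    filter_upwards [hexp, hsmall] with p hp hp'
    rw [Function.comp_apply, ← hp, ← hexp.self_of_nhds, ← Complex.exp_sub, Complex.log_exp (abs_lt.1 hp').1
      (abs_lt.1 hp').2.le]
    simp
  · ext w
    simp

end Continuation

/-! ### Laurent coefficients as torus integrals -/

section Coefficients

variable {d : ℕ}

theorem integral_Icc_char (m : ℤ) :
    ∫ t in Set.Icc (0 : ℝ) (2 * Real.pi), Complex.exp (((m : ℂ) * Complex.I) * t) =
      if m = 0 then 2 * Real.pi else 0 := by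
  rw [MeasureTheory.integral_Icc_eq_integral_Ioc,
    ← intervalIntegral.integral_of_le Real.two_pi_pos.le]
  by_cases hm : m = 0
  · simp [hm]
  · rw [if_neg hm, integral_exp_mul_complex (by simp [hm])]
    have : Complex.exp ((m : ℂ) * Complex.I * ((2 * Real.pi : ℝ) : ℂ)) = 1 := by
      rw [Complex.exp_eq_one_iff]
      exact ⟨m, by push_cast; ring⟩
    rw [this]
    simp

theorem integral_closedCube_char (m : Fin d → ℤ) :
    ∫ y in closedCube d, ∏ i, Complex.exp (((m i : ℂ) * Complex.I) * y i) =
      if m = 0 then (2 * Real.pi) ^ d else 0 := by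
  have h : closedCube d = Set.univ.pi fun _ : Fin d => Set.Icc (0 : ℝ) (2 * Real.pi) := by
    rw [Set.pi_univ_Icc]
    rfl
  rw [h, MeasureTheory.volume_pi, MeasureTheory.Measure.restrict_pi_pi,
    MeasureTheory.integral_fintype_prod_eq_prod
      (f := fun i (t : ℝ) => Complex.exp (((m i : ℂ) * Complex.I) * t))]
  simp only [integral_Icc_char]
  by_cases hm : m = 0
  · simp [hm]
  · obtain ⟨i, hi⟩ : ∃ i, m i ≠ 0 := by
      by_contra! hcon
      exact hm (funext hcon)
    rw [if_neg hm]
    exact Finset.prod_eq_zero (Finset.mem_univ i) (by simp [hi])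

theorem pairC_cvec (r x y : Fin d → ℝ) :
    pairC r (cvec x y) = (pair r x : ℂ) + (pair r y : ℂ) * Complex.I := by
  simp only [pairC, cvec, pair, mul_add, Finset.sum_add_distrib, Complex.ofReal_sum,
    Complex.ofReal_mul, Finset.sum_mul, mul_assoc]

theorem norm_exp_pairC_cvec (r x y : Fin d → ℝ) :
    ‖Complex.exp (pairC r (cvec x y))‖ = Real.exp (pair r x) := by
  rw [Complex.norm_exp, pairC_cvec]
  simp

theorem norm_exp_neg_pairC_cvec (r x y : Fin d → ℝ) :
    ‖Complex.exp (-pairC r (cvec x y))‖ = Real.exp (-pair r x) := by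
  rw [Complex.norm_exp, pairC_cvec]
  simp

theorem continuous_exp_pairC_cvec (r x : Fin d → ℝ) :
    Continuous fun y => Complex.exp (pairC r (cvec x y)) := by
  unfold pairC cvec
  fun_prop

theorem continuous_exp_neg_pairC_cvec (r x : Fin d → ℝ) :
    Continuous fun y => Complex.exp (-pairC r (cvec x y)) := by
  unfold pairC cvec
  fun_prop

/-- Cauchy's formula for the coefficients of a Laurent series. -/
theorem integral_closedCube_eq_coeff {a : (Fin d → ℤ) → ℂ} {φ : (Fin d → ℂ) → ℂ} {x : Fin d → ℝ}
    (h : ∀ y, HasSum (fun k : Fin d → ℤ => a k * Complex.exp (pairC (intVec k) (cvec x y)))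
      (φ (cvec x y))) (k : Fin d → ℤ) :
    ∫ y in closedCube d, Complex.exp (-pairC (intVec k) (cvec x y)) * φ (cvec x y) =
      (2 * Real.pi) ^ d * a k := by
  have hint : ∀ l : Fin d → ℤ, MeasureTheory.Integrable
      (fun y => Complex.exp (-pairC (intVec k) (cvec x y)) *
        (a l * Complex.exp (pairC (intVec l) (cvec x y))))
      (MeasureTheory.volume.restrict (closedCube d)) := by
    intro l
    refine ContinuousOn.integrableOn_compact isCompact_closedCube (Continuous.continuousOn ?_)
    exact (continuous_exp_neg_pairC_cvec _ _).mul
      (continuous_const.mul (continuous_exp_pairC_cvec _ _))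
  have hnorm : ∀ l y, ‖Complex.exp (-pairC (intVec k) (cvec x y)) *
      (a l * Complex.exp (pairC (intVec l) (cvec x y)))‖ =
        Real.exp (-pair (intVec k) x) * ‖a l * Complex.exp (pairC (intVec l) (cvec x 0))‖ := by
    intro l y
    rw [norm_mul, norm_mul, norm_mul, norm_exp_neg_pairC_cvec, norm_exp_pairC_cvec,
      norm_exp_pairC_cvec]
  have hsum := MeasureTheory.hasSum_integral_of_summable_integral_norm hint (by
    simp only [hnorm, MeasureTheory.integral_const]
    exact ((h 0).summable.norm.mul_left _).mul_left _)
  have htsum : ∀ y, ∑' l, Complex.exp (-pairC (intVec k) (cvec x y)) *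
      (a l * Complex.exp (pairC (intVec l) (cvec x y))) =
        Complex.exp (-pairC (intVec k) (cvec x y)) * φ (cvec x y) := fun y =>
    ((h y).mul_left _).tsum_eq
  simp only [htsum] at hsum
  refine hsum.unique ?_
  have hterm : ∀ l, ∫ y in closedCube d, Complex.exp (-pairC (intVec k) (cvec x y)) *
      (a l * Complex.exp (pairC (intVec l) (cvec x y))) =
        if l = k then (2 * Real.pi) ^ d * a k else 0 := by
    intro l
    have hy : ∀ y, Complex.exp (-pairC (intVec k) (cvec x y)) *
        (a l * Complex.exp (pairC (intVec l) (cvec x y))) =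
          (a l * Complex.exp (pair (intVec (l - k)) x)) *
            ∏ i, Complex.exp ((((l - k) i : ℤ) : ℂ) * Complex.I * y i) := by
      intro y
      rw [mul_left_comm, ← Complex.exp_add, ← Complex.exp_sum, mul_assoc, ← Complex.exp_add]
      congr 2
      simp only [pairC_cvec, pair, intVec, Complex.ofReal_sum, Finset.sum_mul,
        ← Finset.sum_add_distrib, ← Finset.sum_neg_distrib]
      refine Finset.sum_congr rfl fun i _ => ?_
      simp only [Pi.sub_apply]
      push_cast
      ring
    simp only [hy, MeasureTheory.integral_const_mul, integral_closedCube_char, sub_eq_zero]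
    by_cases hl : l = k
    · subst hl
      simp [pair, intVec, mul_comm]
    · simp [hl]
  simp only [hterm]
  exact hasSum_ite_eq k _

/-! ### Euclidean length -/

theorem pair_le_len_mul_len (r v : Fin d → ℝ) : pair r v ≤ len r * len v :=
  Real.sum_mul_le_sqrt_mul_sqrt _ _ _

theorem len_smul {c : ℝ} (hc : 0 ≤ c) (v : Fin d → ℝ) : len (c • v) = c * len v := by
  simp only [len, Pi.smul_apply, smul_eq_mul, mul_pow, ← Finset.mul_sum]
  rw [Real.sqrt_mul (sq_nonneg c), Real.sqrt_sq hc]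

theorem len_nonneg (v : Fin d → ℝ) : 0 ≤ len v := Real.sqrt_nonneg _

@[fun_prop]
theorem continuous_len : Continuous (len (d := d)) := by
  unfold len
  fun_prop

theorem len_neg (v : Fin d → ℝ) : len (-v) = len v := by
  simp [len]

/-- For all `v` in a conical neighborhood of `r`, the pairing with vectors `η` of bounded length
is bounded below by `|v| / 2` as soon as `r · η = |r|`. -/
theorem exists_isConicalNbhd {r : Fin d → ℝ} (hr : 0 < len r) (M : ℝ) :
    ∃ N, IsConicalNbhd N r ∧ ∀ v ∈ N, ∀ η, len η ≤ M → pair r η = len r →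
      len v / 2 ≤ pair v η := by
  -- With `D = |r| v - |v| r` one has `|r| (v · η) = D · η + |v| (r · η)`, and `N` bounds `D · η`.
  refine ⟨{v | M * len (len r • v - len v • r) < len v * len r / 2}, ⟨?_, ?_, ?_⟩, ?_⟩
  · exact isOpen_lt (by fun_prop) (by fun_prop)
  · have : len (0 : Fin d → ℝ) = 0 := by simp [len]
    simp only [Set.mem_ofPred_eq, sub_self, this, mul_zero]
    positivity
  · intro v hv c hc
    simp only [Set.mem_ofPred_eq] at hv ⊢
    have : len r • c • v - len (c • v) • r = c • (len r • v - len v • r) := by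
      rw [len_smul hc.le]
      module
    rw [this, len_smul hc.le, len_smul hc.le]
    nlinarith
  · intro v hv η hη hp
    simp only [Set.mem_ofPred_eq] at hv
    set D := len r • v - len v • r with hD
    have h1 : len r * pair v η = pair D η + len v * pair r η := by
      simp only [pair, hD, Pi.sub_apply, Pi.smul_apply, smul_eq_mul, Finset.mul_sum,
        ← Finset.sum_add_distrib]
      exact Finset.sum_congr rfl fun i _ => by ring
    have h2 : -pair D η ≤ len D * len η := by
      have := pair_le_len_mul_len (-D) η
      rw [len_neg] at this
      simpa [pair] using this
    have h3 : len D * len η ≤ len D * M := mul_le_mul_of_nonneg_left hη (len_nonneg _)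
    have h4 : len r * (len v / 2) ≤ len r * pair v η := by
      rw [h1, hp]
      nlinarith
    exact le_of_mul_le_mul_left h4 hr

end Coefficients

/-! ### The integrand -/

section Integrand

variable {d m : ℕ}

/-- Near a critical point the local integrand is the continued product of powers. -/
theorem localIntegrand_eq {P₀ : (Fin d → ℂ) → ℂ} {F : Fin m → Laurent d} {s : Fin m → ℝ}
    {q : Option (Fin m)} {n : Fin m → ℕ} {z₀ z : Fin d → ℂ} {lam : Fin m → ℂ}
    (hq : ∀ j, q = some j → logf (F j) z₀ = 0)
    (hn : ∀ j, q ≠ some j → logf (F j) z₀ = 0 → s j = -(n j : ℝ))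
    (hlam : ∀ j, Complex.exp (lam j) = logf (F j) z) :
    localIntegrand P₀ F s q n z₀ z lam =
      P₀ (cexp z) * ∏ j, Complex.exp ((s j : ℂ) * lam j) := by
  have hne : ∀ j, logf (F j) z ≠ 0 := fun j => by
    rw [← hlam j]
    exact Complex.exp_ne_zero _
  rw [localIntegrand, div_eq_iff (mul_ne_zero
    (Finset.prod_ne_zero_iff.2 fun j _ => Complex.exp_ne_zero _)
    (Finset.prod_ne_zero_iff.2 fun j _ => pow_ne_zero _ (hne j))), mul_assoc]
  congr 1
  simp only [Finset.prod_filter]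
  rw [← Finset.prod_mul_distrib, ← Finset.prod_mul_distrib]
  refine Finset.prod_congr rfl fun j _ => ?_
  by_cases hB : q = some j
  · have h0 := hq j hB
    simp [h0, hB, ← Complex.exp_add]
  · by_cases hA : logf (F j) z₀ = 0
    · have h1 : Complex.exp ((s j : ℂ) * lam j) * logf (F j) z ^ n j = 1 := by
        rw [hn j hB hA, ← hlam, ← Complex.exp_nat_mul, ← Complex.exp_add]
        push_cast
        rw [neg_mul, neg_add_cancel, Complex.exp_zero]
      simp [hA, hB, h1]
    · simp [hA, hB]

theorem isOpen_tube {B : Set (Fin d → ℝ)} (hB : IsOpen B) : IsOpen (tube B) :=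
  hB.preimage (f := fun z : Fin d → ℂ => fun i => (z i).re) (by fun_prop)

theorem convex_tube {B : Set (Fin d → ℝ)} (hB : Convex ℝ B) : Convex ℝ (tube B) := by
  intro z hz w hw a b ha hb hab
  have := hB hz hw ha hb hab
  show (fun i => ((a • z + b • w) i).re) ∈ B
  convert this using 1
  ext i
  simp

theorem add_periodC_mem_tube {B : Set (Fin d → ℝ)} {z : Fin d → ℂ} (hz : z ∈ tube B)
    (k : Fin d → ℤ) : z + periodC k ∈ tube B := by
  show (fun i => ((z + periodC k) i).re) ∈ B
  have h : (fun i => ((z + periodC k) i).re) = fun i => (z i).re := by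
    ext i
    simp [periodC, toC]
  rw [h]
  exact hz

theorem exp_pairC_add_periodC (l k : Fin d → ℤ) (z : Fin d → ℂ) :
    Complex.exp (pairC (intVec l) (z + periodC k)) = Complex.exp (pairC (intVec l) z) := by
  rw [Complex.exp_eq_exp_iff_exists_int]
  refine ⟨∑ i, l i * k i, ?_⟩
  simp only [pairC, periodC, toC, intVec, Pi.add_apply, Pi.smul_apply, smul_eq_mul, mul_add,
    Finset.sum_add_distrib]
  push_cast
  rw [Finset.sum_mul]
  congr 1
  refine Finset.sum_congr rfl fun i _ => ?_
  ring

/-- The increment of a logarithm over a period is constant on the tube. -/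
theorem log_increment_eq {B : Set (Fin d → ℝ)} (ho : IsOpen B) (hc : Convex ℝ B)
    {F : Laurent d} {ℓ : (Fin d → ℂ) → ℂ} (hℓ : AnalyticOnNhd ℂ ℓ (tube B))
    (hexp : ∀ z ∈ tube B, Complex.exp (ℓ z) = logf F z) (k : Fin d → ℤ) {z w : Fin d → ℂ}
    (hz : z ∈ tube B) (hw : w ∈ tube B) :
    ℓ (z + periodC k) - ℓ z = ℓ (w + periodC k) - ℓ w := by
  have hδ : AnalyticOnNhd ℂ (fun z => ℓ (z + periodC k) - ℓ z) (tube B) := by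
    intro p hp
    have h1 : AnalyticAt ℂ (fun z : Fin d → ℂ => z + periodC k) p := by fun_prop
    exact (AnalyticAt.comp (g := ℓ) (f := fun z => z + periodC k)
      (hℓ _ (add_periodC_mem_tube hp k)) h1).sub (hℓ p hp)
  have h1 : ∀ p ∈ tube B, Complex.exp (ℓ (p + periodC k) - ℓ p) = 1 := by
    intro p hp
    rw [Complex.exp_sub, hexp _ (add_periodC_mem_tube hp k), hexp p hp, logf_add_periodC,
      div_self]
    rw [← hexp p hp]
    exact Complex.exp_ne_zero _
  -- The increment is analytic with exponential `1`, hence locally constant.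
  set δ := fun z => ℓ (z + periodC k) - ℓ z with hδdef
  have hev : δ =ᶠ[𝓝 w] fun _ => δ w := by
    have hcont : ContinuousAt (fun p => |(δ p - δ w).im|) w := by
      have := (hδ w hw).continuousAt
      fun_prop
    have hsmall : ∀ᶠ p in 𝓝 w, |(δ p - δ w).im| < Real.pi := by
      refine hcont.eventually (gt_mem_nhds ?_)
      simpa using Real.pi_pos
    filter_upwards [hsmall, (isOpen_tube ho).mem_nhds hw] with p hp hpB
    have h2 := Complex.log_exp (abs_lt.1 hp).1 (abs_lt.1 hp).2.le
    rw [Complex.exp_sub, h1 p hpB, h1 w hw, div_self one_ne_zero, Complex.log_one] at h2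
    exact sub_eq_zero.1 h2.symm
  exact hδ.eqOn_of_preconnected_of_eventuallyEq analyticOnNhd_const
    (convex_tube hc).isPreconnected hw hev hz

/-- Although the logarithms may increase over a period, the continued product of powers with `P₀`
is periodic, since it is so on the tube, where it has a Laurent expansion. -/
theorem continued_product_periodic {P₀ : (Fin d → ℂ) → ℂ} {F : Fin m → Laurent d} {s : Fin m → ℝ}
    {B : Set (Fin d → ℝ)} {ℓ : Fin m → (Fin d → ℂ) → ℂ} {a : (Fin d → ℤ) → ℂ}
    (ho : IsOpen B) (hc : Convex ℝ B) (hℓ : ∀ j, AnalyticOnNhd ℂ (ℓ j) (tube B))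
    (hexp : ∀ j, ∀ z ∈ tube B, Complex.exp (ℓ j z) = logf (F j) z)
    (hlaurent : ∀ z ∈ tube B, HasSum (fun k : Fin d → ℤ => a k * Complex.exp (pairC (intVec k) z))
      (P₀ (cexp z) * ∏ j, Complex.exp ((s j : ℂ) * ℓ j z)))
    {P V : (Fin d → ℝ) → (Fin d → ℂ)} (hPB : ∀ y, P y ∈ tube B)
    (hPper : ∀ y (k : Fin d → ℤ), P (y + (2 * Real.pi) • intVec k) = P y + periodC k)
    (hVper : ∀ y (k : Fin d → ℤ), V (y + (2 * Real.pi) • intVec k) = V y)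
    (hP₀ : ∀ t ∈ Set.Icc (0 : ℝ) 1, ∀ y, AnalyticAt ℂ P₀ (cexp (P y + t • V y)))
    {t : ℝ} (ht : t ∈ Set.Icc (0 : ℝ) 1) (y : Fin d → ℝ) (k : Fin d → ℤ) :
    P₀ (cexp (P (y + (2 * Real.pi) • intVec k) + t • V (y + (2 * Real.pi) • intVec k))) *
        ∏ j, Complex.exp ((s j : ℂ) *
          contLog (F j) (ℓ j) P V t (y + (2 * Real.pi) • intVec k)) =
      P₀ (cexp (P y + t • V y)) *
        ∏ j, Complex.exp ((s j : ℂ) * contLog (F j) (ℓ j) P V t y) := by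
  rw [hPper, hVper, add_right_comm, cexp_add_periodC]
  by_cases hex : ∃ z ∈ tube B, P₀ (cexp z) ≠ 0
  · obtain ⟨z, hz, hz0⟩ := hex
    have h1 := hlaurent (z + periodC k) (add_periodC_mem_tube hz k)
    simp only [exp_pairC_add_periodC, cexp_add_periodC] at h1
    have h2 := mul_left_cancel₀ hz0 (h1.unique (hlaurent z hz))
    have h3 : ∏ j, Complex.exp ((s j : ℂ) * (ℓ j (z + periodC k) - ℓ j z)) = 1 := by
      have hne : ∏ j, Complex.exp ((s j : ℂ) * ℓ j z) ≠ 0 :=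
        Finset.prod_ne_zero_iff.2 fun j _ => Complex.exp_ne_zero _
      refine mul_right_cancel₀ hne ?_
      rw [one_mul, ← Finset.prod_mul_distrib, ← h2]
      refine Finset.prod_congr rfl fun j _ => ?_
      rw [← Complex.exp_add]
      ring_nf
    congr 1
    rw [← mul_one (∏ j, Complex.exp ((s j : ℂ) * contLog (F j) (ℓ j) P V t y)), ← h3,
      ← Finset.prod_mul_distrib]
    refine Finset.prod_congr rfl fun j _ => ?_
    rw [contLog_add_period hPper hVper,
      log_increment_eq ho hc (hℓ j) (hexp j) k (hPB y) hz, ← Complex.exp_add, mul_add]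
  · -- If `P₀ ∘ exp` vanishes on the tube, then it vanishes along the deformation.
    push Not at hex
    have han : AnalyticOnNhd ℂ (fun ζ : ℂ => P₀ (cexp (P y + ζ • V y)))
        (Complex.ofReal '' Set.Icc (0 : ℝ) 1) := by
      rintro _ ⟨τ, hτ, rfl⟩
      have hin : Differentiable ℂ fun ζ : ℂ => cexp (P y + ζ • V y) := by
        unfold cexp
        simp only [Pi.add_apply, Pi.smul_apply, smul_eq_mul]
        fun_prop
      exact AnalyticAt.comp (g := P₀) (by simpa using hP₀ τ hτ y) (hin.analyticAt _)
    have hev : (fun ζ : ℂ => P₀ (cexp (P y + ζ • V y))) =ᶠ[𝓝 0] 0 := by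
      have hcont : ContinuousAt (fun ζ : ℂ => P y + ζ • V y) 0 := by fun_prop
      filter_upwards [hcont.eventually_mem ((isOpen_tube ho).mem_nhds (by simpa using hPB y))]
        with ζ hζ
      exact hex _ hζ
    have hzero := han.eqOn_zero_of_preconnected_of_eventuallyEq_zero
      (isPreconnected_Icc.image _ Complex.continuous_ofReal.continuousOn)
      ⟨0, ⟨le_rfl, zero_le_one⟩, by simp⟩ hev ⟨t, ht, rfl⟩
    have h0 : P₀ (cexp (P y + t • V y)) = 0 := by simpa using hzero
    rw [h0, zero_mul, zero_mul]

theorem closedCube_ae_eq_cube : closedCube d =ᵐ[MeasureTheory.volume] cube d := by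
  have := MeasureTheory.Measure.univ_pi_Ico_ae_eq_Icc
    (μ := fun _ : Fin d => (MeasureTheory.volume : MeasureTheory.Measure ℝ))
    (f := 0) (g := fun _ => 2 * Real.pi)
  exact this.symm

theorem measurableSet_cube : MeasurableSet (cube d) :=
  MeasurableSet.univ_pi fun _ => measurableSet_Ico

theorem volume_real_cube : MeasureTheory.volume.real (cube d) = (2 * Real.pi) ^ d := by
  rw [MeasureTheory.measureReal_def, cube, Real.volume_pi_Ico_toReal]
  · simp
  · intro i
    exact Real.two_pi_pos.le

/-- Replacing the integral over the cube by the sum of the integrals over the closures of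
disjoint open sets `U w` only costs integrals over sets disjoint from the `U w`: the rest of the
cube, and the boundaries, which may have positive measure. -/
theorem norm_integral_cube_sub_sum_le {ι : Type*} (W : Finset ι) {U : ι → Set (Fin d → ℝ)}
    (hU : ∀ w ∈ W, IsOpen (U w)) (hdisj : (W : Set ι).PairwiseDisjoint U)
    {h : (Fin d → ℝ) → ℂ} (hh : Continuous h) {b : ℝ} (hb0 : 0 ≤ b)
    (hb : ∀ y ∈ cube d, (∀ w ∈ W, y ∉ U w) → ‖h y‖ ≤ b) :
    ‖(∫ y in cube d, h y) - ∑ w ∈ W, ∫ y in closure (U w) ∩ cube d, h y‖ ≤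
      (1 + W.card) * ((2 * Real.pi) ^ d * b) := by
  have hint : MeasureTheory.IntegrableOn h (cube d) :=
    (hh.continuousOn.integrableOn_compact isCompact_closedCube).mono_set cube_subset_closedCube
  have hfin : MeasureTheory.volume (cube d) ≠ ⊤ :=
    ((MeasureTheory.measure_mono cube_subset_closedCube).trans_lt
      isCompact_closedCube.measure_lt_top).ne
  have hsmall : ∀ S ⊆ cube d, MeasurableSet S → (∀ y ∈ S, ∀ w ∈ W, y ∉ U w) →
      ‖∫ y in S, h y‖ ≤ (2 * Real.pi) ^ d * b := by
    intro S hS _ hSU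
    have hlt : MeasureTheory.volume S < ⊤ :=
      (MeasureTheory.measure_mono hS).trans_lt hfin.lt_top
    refine (MeasureTheory.norm_setIntegral_le_of_norm_le_const hlt
      fun y hy => hb y (hS hy) (hSU y hy)).trans ?_
    rw [mul_comm, ← volume_real_cube]
    exact mul_le_mul_of_nonneg_right (MeasureTheory.measureReal_mono hS hfin) hb0
  have hUm : ∀ w ∈ W, MeasurableSet (U w ∩ cube d) := fun w hw =>
    (hU w hw).measurableSet.inter measurableSet_cube
  set T := ⋃ w ∈ W, U w ∩ cube d with hT
  have hTm : MeasurableSet T := Finset.measurableSet_biUnion _ hUm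
  have hTsub : T ⊆ cube d := Set.iUnion₂_subset fun w _ => Set.inter_subset_right
  have h1 : ∫ y in cube d, h y = (∑ w ∈ W, ∫ y in U w ∩ cube d, h y) + ∫ y in cube d \ T, h y := by
    rw [← MeasureTheory.integral_biUnion_finset W hUm
      (fun w hw w' hw' hne => (hdisj hw hw' hne).mono Set.inter_subset_left Set.inter_subset_left)
      fun w _ => hint.mono_set Set.inter_subset_right, MeasureTheory.setIntegral_sdiff hTm hint hTsub]
    ring
  have h2 : ∀ w ∈ W, ∫ y in closure (U w) ∩ cube d, h y =
      (∫ y in U w ∩ cube d, h y) + ∫ y in (closure (U w) ∩ cube d) \ (U w ∩ cube d), h y := by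
    intro w hw
    rw [MeasureTheory.setIntegral_sdiff (hUm w hw) (hint.mono_set Set.inter_subset_right)
      (Set.inter_subset_inter_left _ subset_closure)]
    ring
  have h3 : (∫ y in cube d, h y) - ∑ w ∈ W, ∫ y in closure (U w) ∩ cube d, h y =
      (∫ y in cube d \ T, h y) -
        ∑ w ∈ W, ∫ y in (closure (U w) ∩ cube d) \ (U w ∩ cube d), h y := by
    rw [h1, Finset.sum_congr rfl h2, Finset.sum_add_distrib]
    ring
  rw [h3]
  refine (norm_sub_le _ _).trans ?_
  rw [add_mul, one_mul]
  refine add_le_add (hsmall _ Set.sdiff_subset (measurableSet_cube.diff hTm) ?_) ?_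
  · intro y hy w hw hyw
    exact hy.2 (Set.mem_biUnion hw ⟨hyw, hy.1⟩)
  · refine (norm_sum_le _ _).trans ?_
    rw [← nsmul_eq_mul]
    refine Finset.sum_le_card_nsmul _ _ _ fun w hw => ?_
    refine hsmall _ (Set.sdiff_subset.trans Set.inter_subset_right)
      ((isClosed_closure.measurableSet.inter measurableSet_cube).diff (hUm w hw)) ?_
    intro y hy w' hw' hyw'
    by_cases hww : w = w'
    · subst hww
      exact hy.2 ⟨hyw', hy.1.2⟩
    · obtain ⟨p, hp1, hp2⟩ := mem_closure_iff.1 hy.1.1 (U w') (hU w' hw') hyw'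
      exact Set.disjoint_left.1 (hdisj hw hw' hww) hp2 hp1

end Integrand

/-! ### Coefficients as integrals over the deformed torus -/

section DeformedTorus

variable {d m : ℕ}

theorem homotopy_eq (x u : Fin d → ℝ) (η : (Fin d → ℝ) → (Fin d → ℝ)) (ε t : ℝ)
    (y : Fin d → ℝ) :
    homotopy x u η ε t y = cvec (x + ε • u) y + t • toC (ε • (η y - u)) := by
  ext i
  simp only [homotopy, cvec, toC, Pi.add_apply, Pi.smul_apply, Pi.sub_apply, smul_eq_mul,
    Complex.real_smul]
  push_cast
  ring

theorem cvec_period (x y : Fin d → ℝ) (k : Fin d → ℤ) :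
    cvec x (y + (2 * Real.pi) • intVec k) = cvec x y + periodC k := by
  rw [periodC, cvec_add_I_smul_toC]

theorem hasFDerivAt_cvec (x y : Fin d → ℝ) :
    HasFDerivAt (cvec x) (ContinuousLinearMap.pi fun i =>
      (ContinuousLinearMap.proj (R := ℝ) (φ := fun _ : Fin d => ℝ) i).smulRight Complex.I) y := by
  refine hasFDerivAt_pi.2 fun i => ?_
  have h : HasFDerivAt (fun y : Fin d → ℝ => y i)
      (ContinuousLinearMap.proj (R := ℝ) (φ := fun _ : Fin d => ℝ) i) y := hasFDerivAt_apply i y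
  have h2 := (h.smul_const Complex.I).const_add (x i : ℂ)
  simpa only [cvec, Complex.real_smul] using h2

theorem detMul_fderiv_cvec (x y : Fin d → ℝ) :
    detMul d (fun j => fderiv ℝ (cvec x) y (Pi.single j 1)) = Complex.I ^ d := by
  rw [detMul_eq_det_transpose, (hasFDerivAt_cvec x y).fderiv]
  have : (Matrix.of fun i j : Fin d => (ContinuousLinearMap.pi fun i =>
      (ContinuousLinearMap.proj (R := ℝ) (φ := fun _ : Fin d => ℝ) i).smulRight Complex.I)
        (Pi.single j 1) i) = Matrix.diagonal fun _ : Fin d => Complex.I := by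
    ext i j
    simp [Matrix.diagonal_apply, Pi.single_apply]
  rw [this, Matrix.det_diagonal]
  simp

/-- The Laurent coefficients as integrals over the deformed torus. -/
theorem coeff_eq_integral_deformed {P₀ : (Fin d → ℂ) → ℂ} {F : Fin m → Laurent d} {s : Fin m → ℝ}
    {B : Set (Fin d → ℝ)} {ℓ : Fin m → (Fin d → ℂ) → ℂ} {a : (Fin d → ℤ) → ℂ}
    (ho : IsOpen B) (hc : Convex ℝ B) (hℓ : ∀ j, AnalyticOnNhd ℂ (ℓ j) (tube B))
    (hexp : ∀ j, ∀ z ∈ tube B, Complex.exp (ℓ j z) = logf (F j) z)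
    (hlaurent : ∀ z ∈ tube B, HasSum (fun k : Fin d → ℤ => a k * Complex.exp (pairC (intVec k) z))
      (P₀ (cexp z) * ∏ j, Complex.exp ((s j : ℂ) * ℓ j z)))
    {x₀ : Fin d → ℝ} (hx₀ : x₀ ∈ B) {V : (Fin d → ℝ) → (Fin d → ℂ)} (hV : ContDiff ℝ 2 V)
    (hVper : ∀ y (k : Fin d → ℤ), V (y + (2 * Real.pi) • intVec k) = V y)
    (hP₀ : ∀ t ∈ Set.Icc (0 : ℝ) 1, ∀ y, AnalyticAt ℂ P₀ (cexp (cvec x₀ y + t • V y)))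
    (hF : ∀ j, ∀ t ∈ Set.Icc (0 : ℝ) 1, ∀ y, logf (F j) (cvec x₀ y + t • V y) ≠ 0)
    (k : Fin d → ℤ) :
    a k = (1 / (2 * Real.pi * Complex.I)) ^ d * ∫ y in closedCube d,
      (Complex.exp (-pairC (intVec k) (cvec x₀ y + V y)) * (P₀ (cexp (cvec x₀ y + V y)) *
        ∏ j, Complex.exp ((s j : ℂ) * contLog (F j) (ℓ j) (cvec x₀) V 1 y))) *
        detMul d (fun j => fderiv ℝ (fun y => cvec x₀ y + V y) y (Pi.single j 1)) := by
  have hPB : ∀ y, cvec x₀ y ∈ tube B := fun y => by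
    show (fun i => (cvec x₀ y i).re) ∈ B
    simpa [cvec] using hx₀
  have hPsm : ContDiff ℝ 2 (cvec x₀) := by
    rw [contDiff_pi]
    intro i
    have : ContDiff ℝ 2 fun y : Fin d → ℝ => (x₀ i : ℂ) + (y i) • Complex.I := by fun_prop
    simpa only [cvec, Complex.real_smul] using this
  have hPc := hPsm.continuous
  have hVc := hV.continuous
  have hℓc : ∀ j, Continuous fun y => ℓ j (cvec x₀ y) := fun j => by
    rw [continuous_iff_continuousAt]
    exact fun y => (hℓ j _ (hPB y)).continuousAt.comp hPc.continuousAt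
  have hLc : ∀ j, Continuous fun p : ℝ × (Fin d → ℝ) =>
      contLog (F j) (ℓ j) (cvec x₀) V p.1 p.2 := fun j =>
    continuous_contLog hPc hVc (hF j) (hℓc j)
  set g : ℝ → (Fin d → ℝ) → ℂ := fun t y =>
    Complex.exp (-pairC (intVec k) (cvec x₀ y + t • V y)) * (P₀ (cexp (cvec x₀ y + t • V y)) *
      ∏ j, Complex.exp ((s j : ℂ) * contLog (F j) (ℓ j) (cvec x₀) V t y)) with hg
  have hcexp : Differentiable ℂ (cexp (d := d)) := by
    unfold cexp
    fun_prop
  have hpair : Differentiable ℂ fun z : Fin d → ℂ => Complex.exp (-pairC (intVec k) z) := by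
    unfold pairC
    fun_prop
  have key := integral_deformation hPsm hV (g := g) ?_ ?_ hVper ?_ ?_
  · have h0 : ∀ y, g 0 y * detMul d (fun j => fderiv ℝ (cvec x₀) y (Pi.single j 1)) =
        (Complex.exp (-pairC (intVec k) (cvec x₀ y)) * (P₀ (cexp (cvec x₀ y)) *
          ∏ j, Complex.exp ((s j : ℂ) * ℓ j (cvec x₀ y)))) * Complex.I ^ d := by
      intro y
      rw [detMul_fderiv_cvec]
      simp only [hg, contLog_zero, zero_smul, add_zero]
    have h1 : ∀ y, g 1 y = Complex.exp (-pairC (intVec k) (cvec x₀ y + V y)) *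
        (P₀ (cexp (cvec x₀ y + V y)) *
          ∏ j, Complex.exp ((s j : ℂ) * contLog (F j) (ℓ j) (cvec x₀) V 1 y)) := by
      intro y
      simp only [hg, one_smul]
    simp only [h1, h0] at key
    rw [key, MeasureTheory.integral_mul_const,
      integral_closedCube_eq_coeff (φ := fun z => P₀ (cexp z) *
        ∏ j, Complex.exp ((s j : ℂ) * ℓ j z)) (fun y => hlaurent _ (hPB y))]
    have hpi : (Real.pi : ℂ) ≠ 0 := by exact_mod_cast Real.pi_ne_zero
    rw [div_pow, mul_pow _ Complex.I, one_pow]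
    have := pow_ne_zero d Complex.I_ne_zero
    have := pow_ne_zero d (mul_ne_zero two_ne_zero hpi)
    field_simp
  · have hΦ : Continuous fun p : ℝ × (Fin d → ℝ) => cvec x₀ p.2 + p.1 • V p.2 := by fun_prop
    have h2 : Continuous fun p : ℝ × (Fin d → ℝ) => cexp (cvec x₀ p.2 + p.1 • V p.2) :=
      hcexp.continuous.comp hΦ
    have h3 : ContinuousOn (fun p : ℝ × (Fin d → ℝ) => P₀ (cexp (cvec x₀ p.2 + p.1 • V p.2)))
        (Set.Icc 0 1 ×ˢ Set.univ) := by
      intro p hp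
      have h4 : ContinuousAt P₀ (cexp (cvec x₀ p.2 + p.1 • V p.2)) :=
        (hP₀ p.1 hp.1 p.2).continuousAt
      exact (h4.comp_of_eq h2.continuousAt rfl).continuousWithinAt
    have h5 : Continuous fun p : ℝ × (Fin d → ℝ) =>
        ∏ j, Complex.exp ((s j : ℂ) * contLog (F j) (ℓ j) (cvec x₀) V p.1 p.2) :=
      continuous_finsetProd _ fun j _ =>
        Complex.continuous_exp.comp (continuous_const.mul (hLc j))
    exact (hpair.continuous.comp hΦ).continuousOn.mul (h3.mul h5.continuousOn)
  · intro q hq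
    have hqI : q 0 ∈ Set.Icc (0 : ℝ) 1 := ⟨hq.1.le, hq.2.le⟩
    have hPd : Differentiable ℝ (cvec x₀) := hPsm.differentiable (by norm_num)
    have hVd : Differentiable ℝ V := hV.differentiable (by norm_num)
    have hΦ : HasFDerivAt (fun q : Fin (d + 1) → ℝ => cvec x₀ (tailL d q) + (q 0) • V (tailL d q))
        (fderiv ℝ (fun q : Fin (d + 1) → ℝ => cvec x₀ (tailL d q) + (q 0) • V (tailL d q)) q)
        q := by
      have h3 : Differentiable ℝ fun q : Fin (d + 1) → ℝ => q 0 := by fun_prop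
      have h1 : Differentiable ℝ fun q : Fin (d + 1) → ℝ => cvec x₀ (tailL d q) :=
        hPd.comp (tailL d).differentiable
      have h2 : Differentiable ℝ fun q : Fin (d + 1) → ℝ => V (tailL d q) :=
        hVd.comp (tailL d).differentiable
      exact ((h1 q).fun_add ((h3 q).fun_smul (h2 q))).hasFDerivAt
    refine HasHolDerivAt.mul (HasHolDerivAt.comp (hpair _) hΦ) (HasHolDerivAt.mul
      (HasHolDerivAt.comp (f := fun z => P₀ (cexp z))
        ((hP₀ _ hqI _).differentiableAt.comp _ (hcexp _)) hΦ)
      (HasHolDerivAt.prod _ fun j => HasHolDerivAt.exp_const_mul (HasHolDerivAt.log ?_ ?_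
        (HasHolDerivAt.comp (differentiable_logf (F j) _) hΦ)) _))
    · exact ((hLc j).comp (f := fun q : Fin (d + 1) → ℝ => (q 0, tailL d q))
        (by fun_prop)).continuousAt
    · have hcont : ContinuousAt (fun q : Fin (d + 1) → ℝ => q 0) q :=
        (continuous_apply 0).continuousAt
      filter_upwards [hcont.eventually_mem (isOpen_Ioo.mem_nhds hq)] with p hp
      exact exp_contLog hPc hVc (hF j) (fun y => hexp j _ (hPB y)) ⟨hp.1.le, hp.2.le⟩ _
  · intro y k
    rw [(hasFDerivAt_cvec _ _).fderiv, (hasFDerivAt_cvec _ _).fderiv]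
  · intro t ht y l
    have h1 := continued_product_periodic ho hc hℓ hexp hlaurent hPB (cvec_period x₀) hVper hP₀
      ht y l
    have h2 : Complex.exp (-pairC (intVec k) (cvec x₀ (y + (2 * Real.pi) • intVec l) +
        t • V (y + (2 * Real.pi) • intVec l))) =
          Complex.exp (-pairC (intVec k) (cvec x₀ y + t • V y)) := by
      rw [cvec_period, hVper, add_right_comm, Complex.exp_neg, exp_pairC_add_periodC,
        ← Complex.exp_neg]
    simp only [hg]
    rw [h1, h2]

end DeformedTorus

/-! ### The homotopy and the error estimate -/

section Homotopy

variable {d m : ℕ}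

theorem homotopy_add_period {x u : Fin d → ℝ} {η : (Fin d → ℝ) → (Fin d → ℝ)}
    (hη : ∀ (y : Fin d → ℝ) (k : Fin d → ℤ), η (y + (2 * Real.pi) • intVec k) = η y)
    (ε t : ℝ) (y : Fin d → ℝ) (k : Fin d → ℤ) :
    homotopy x u η ε t (y + (2 * Real.pi) • intVec k) = homotopy x u η ε t y + periodC k := by
  simp only [homotopy, hη, cvec_period]

/-- For small `ε > 0`, the homotopy avoids the zeros of `f`. -/
theorem eventually_logf_homotopy_ne_zero {G : Laurent d} {B : Set (Fin d → ℝ)} {x u : Fin d → ℝ}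
    {η : (Fin d → ℝ) → (Fin d → ℝ)} (hB : IsAmoebaComplComponent G B) (hx : x ∈ closure B)
    (hu : u ∈ tanCone B x) (hηc : Continuous η)
    (hη : ∀ (y : Fin d → ℝ) (k : Fin d → ℤ), η (y + (2 * Real.pi) • intVec k) = η y)
    (hcone : ∀ y, η y ∈ hypCone G B x y) :
    ∀ᶠ ε : ℝ in 𝓝 0, 0 < ε → ∀ t ∈ Set.Icc (0 : ℝ) 1, ∀ y,
      logf G (homotopy x u η ε t y) ≠ 0 := by
  have h : ∀ᶠ ε : ℝ in 𝓝 0, ∀ y ∈ closedCube d, 0 < ε → ∀ t ∈ Set.Icc (0 : ℝ) 1,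
      logf G (homotopy x u η ε t y) ≠ 0 := by
    refine isCompact_closedCube.eventually_forall_of_forall_eventually fun y₀ _ => ?_
    obtain ⟨ρ, hρ, h⟩ := hB.exists_logf_cvec_ne_zero hx hu (hcone y₀)
    have h1 : ∀ᶠ p : ℝ × (Fin d → ℝ) in 𝓝 (0, y₀), p.1 < ρ :=
      continuous_fst.continuousAt.eventually (gt_mem_nhds hρ)
    have h2 : ∀ᶠ p : ℝ × (Fin d → ℝ) in 𝓝 (0, y₀), p.2 ∈ Metric.ball y₀ ρ :=
      continuous_snd.continuousAt.eventually_mem (Metric.ball_mem_nhds _ hρ)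
    have h3 : ∀ᶠ p : ℝ × (Fin d → ℝ) in 𝓝 (0, y₀), η p.2 ∈ Metric.ball (η y₀) ρ :=
      (hηc.comp continuous_snd).continuousAt.eventually_mem (Metric.ball_mem_nhds _ hρ)
    filter_upwards [h1, h2, h3] with p hp1 hp2 hp3 hpos t ht
    exact h p.2 hp2 (η p.2) hp3 t ht p.1 ⟨hpos, hp1⟩
  filter_upwards [h] with ε hε hpos t ht
  refine forall_of_forall_closedCube (fun y k h => ?_) fun y hy => hε y hy hpos t ht
  rwa [homotopy_add_period hη, logf_add_periodC] at h

/-- For small `ε`, the numerator is analytic along the homotopy. -/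
theorem eventually_analyticAt_homotopy {P₀ : (Fin d → ℂ) → ℂ} {x u : Fin d → ℝ}
    {η : (Fin d → ℝ) → (Fin d → ℝ)} (hηc : Continuous η)
    (hη : ∀ (y : Fin d → ℝ) (k : Fin d → ℤ), η (y + (2 * Real.pi) • intVec k) = η y)
    (hP₀ : ∀ y, AnalyticAt ℂ P₀ (cexp (cvec x y))) :
    ∀ᶠ ε : ℝ in 𝓝 0, ∀ t ∈ Set.Icc (0 : ℝ) 1, ∀ y,
      AnalyticAt ℂ P₀ (cexp (homotopy x u η ε t y)) := by
  have hc : Continuous fun p : ℝ × ℝ × (Fin d → ℝ) => cexp (homotopy x u η p.1 p.2.1 p.2.2) := by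
    unfold homotopy cvec cexp
    fun_prop
  have h : ∀ᶠ ε : ℝ in 𝓝 0, ∀ q ∈ Set.Icc (0 : ℝ) 1 ×ˢ closedCube d,
      AnalyticAt ℂ P₀ (cexp (homotopy x u η ε q.1 q.2)) := by
    refine (isCompact_Icc.prod isCompact_closedCube).eventually_forall_of_forall_eventually
      fun q _ => ?_
    have h0 : cexp (homotopy x u η 0 q.1 q.2) ∈ {Z | AnalyticAt ℂ P₀ Z} := by
      simpa [homotopy] using hP₀ q.2
    exact hc.continuousAt.eventually_mem ((isOpen_analyticAt ℂ P₀).mem_nhds h0)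
  filter_upwards [h] with ε hε t ht
  refine forall_of_forall_closedCube (fun y k h => ?_) fun y hy => hε (t, y) ⟨ht, hy⟩
  rwa [homotopy_add_period hη, cexp_add_periodC] at h

/-- The localization estimate for a fixed deformation. -/
theorem exists_localization {P₀ : (Fin d → ℂ) → ℂ} {F : Fin m → Laurent d}
    {s : Fin m → ℝ} {B : Set (Fin d → ℝ)} {ℓ : Fin m → (Fin d → ℂ) → ℂ}
    {a : (Fin d → ℤ) → ℂ} {r xmax : Fin d → ℝ} {qi : (Fin d → ℝ) → Option (Fin m)}
    {nn : (Fin d → ℝ) → Fin m → ℕ} (H : Hyps P₀ F s B ℓ a r xmax qi nn)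
    {U : (Fin d → ℝ) → Set (Fin d → ℝ)} (hU : IsNbhdFamily (critW (∏ j, F j) B xmax r) U)
    {η : (Fin d → ℝ) → (Fin d → ℝ)}
    (hη : IsDeformField (∏ j, F j) B xmax r (critW (∏ j, F j) B xmax r) U η)
    {N : Set (Fin d → ℝ)}
    (hN : ∀ v ∈ N, ∀ y, pair r (η y) = len r → len v / 2 ≤ pair v (η y))
    {u : Fin d → ℝ} {ε : ℝ} (hε : 0 < ε) (huB : xmax + ε • u ∈ B)
    (hG : ∀ t ∈ Set.Icc (0 : ℝ) 1, ∀ y, logf (∏ j, F j) (homotopy xmax u η ε t y) ≠ 0)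
    (hP₀ : ∀ t ∈ Set.Icc (0 : ℝ) 1, ∀ y, AnalyticAt ℂ P₀ (cexp (homotopy xmax u η ε t y))) :
    ∃ L : Fin m → ℝ → (Fin d → ℝ) → ℂ,
      (∀ j, IsContinuedLog (logf (F j)) (ℓ j) (homotopy xmax u η ε) (L j)) ∧
      ∃ β : ℝ, 0 < β ∧ ∃ R : ℝ, ∀ k : Fin d → ℤ, intVec k ∈ N → R ≤ len (intVec k) →
        ‖a k - ∑ w ∈ H.crit_finite.toFinset,
            contrib P₀ F s (qi w) (nn w) (cvec xmax w) (homotopy xmax u η ε 1) (fun j => L j 1)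
              (U w) (intVec k)‖
          ≤ Real.exp (-β * len (intVec k)) * Real.exp (-pair (intVec k) xmax) := by
  have hB := H.component
  set x₀ := xmax + ε • u with hx₀
  set V : (Fin d → ℝ) → (Fin d → ℂ) := fun y => toC (ε • (η y - u)) with hVdef
  have hΦ : ∀ t y, homotopy xmax u η ε t y = cvec x₀ y + t • V y := homotopy_eq xmax u η ε
  have hΦ1 : homotopy xmax u η ε 1 = fun y => cvec x₀ y + V y := by
    funext y
    rw [hΦ, one_smul]
  have hΦ1' : ∀ y, cvec x₀ y + V y = cvec (xmax + ε • η y) y := by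
    intro y
    have := congrFun hΦ1 y
    rw [← this]
    simp [homotopy]
  have hV : ContDiff ℝ ∞ V := by
    have := hη.smooth
    rw [contDiff_pi]
    intro i
    have h1 : ContDiff ℝ ∞ fun y => (ε • (η y - u)) i := by fun_prop
    exact Complex.ofRealCLM.contDiff.comp h1
  have hVper : ∀ y (k : Fin d → ℤ), V (y + (2 * Real.pi) • intVec k) = V y := by
    intro y k
    simp only [hVdef, hη.periodic]
  have hPB : ∀ y, cvec x₀ y ∈ tube B := fun y => by
    show (fun i => (cvec x₀ y i).re) ∈ B
    simpa [cvec] using huB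
  have hF : ∀ j, ∀ t ∈ Set.Icc (0 : ℝ) 1, ∀ y, logf (F j) (cvec x₀ y + t • V y) ≠ 0 := by
    intro j t ht y
    have := hG t ht y
    rw [logf_prod, Finset.prod_ne_zero_iff, hΦ] at this
    exact this j (Finset.mem_univ j)
  simp only [hΦ] at hP₀
  have hPc : Continuous (cvec x₀) := by
    unfold cvec
    fun_prop
  have hVc : Continuous V := hV.continuous
  have hℓc : ∀ j, Continuous fun y => ℓ j (cvec x₀ y) := fun j => by
    rw [continuous_iff_continuousAt]
    exact fun y => (H.branch_analytic j _ (hPB y)).continuousAt.comp hPc.continuousAt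
  have hLc : ∀ j, Continuous fun p : ℝ × (Fin d → ℝ) =>
      contLog (F j) (ℓ j) (cvec x₀) V p.1 p.2 := fun j =>
    continuous_contLog hPc hVc (hF j) (hℓc j)
  have hLexp : ∀ j, ∀ t ∈ Set.Icc (0 : ℝ) 1, ∀ y,
      Complex.exp (contLog (F j) (ℓ j) (cvec x₀) V t y) = logf (F j) (cvec x₀ y + t • V y) :=
    fun j t ht y => exp_contLog hPc hVc (hF j) (fun y => H.branch_exp j _ (hPB y)) ht y
  refine ⟨fun j => contLog (F j) (ℓ j) (cvec x₀) V, fun j => ⟨(hLc j).continuousOn, ?_, ?_⟩, ?_⟩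
  · intro t ht y
    rw [hΦ, hLexp j t ht y]
  · intro y
    simp only [hΦ, contLog_zero, zero_smul, add_zero]
  set J : (Fin d → ℝ) → ℂ := fun y => (P₀ (cexp (cvec x₀ y + V y)) *
    ∏ j, Complex.exp ((s j : ℂ) * contLog (F j) (ℓ j) (cvec x₀) V 1 y)) *
      detMul d (fun j => fderiv ℝ (fun y => cvec x₀ y + V y) y (Pi.single j 1)) with hJ
  have hPsm : ContDiff ℝ ∞ (cvec x₀) := by
    rw [contDiff_pi]
    intro i
    have : ContDiff ℝ ∞ fun y : Fin d → ℝ => (x₀ i : ℂ) + (y i) • Complex.I := by fun_prop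
    simpa only [cvec, Complex.real_smul] using this
  have hJc : Continuous J := by
    refine (Continuous.mul ?_ ?_).mul ((detMul d).cont.comp ?_)
    · rw [continuous_iff_continuousAt]
      intro y
      have h1 : Continuous fun y => cexp (cvec x₀ y + V y) := by
        unfold cexp
        fun_prop
      have h2 : ContinuousAt P₀ (cexp (cvec x₀ y + V y)) := by
        have := (hP₀ 1 ⟨zero_le_one, le_rfl⟩ y).continuousAt
        rwa [one_smul] at this
      exact h2.comp_of_eq h1.continuousAt rfl
    · refine continuous_finsetProd _ fun j _ => ?_
      exact Complex.continuous_exp.comp (continuous_const.mul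
        ((hLc j).comp (f := fun y : Fin d → ℝ => ((1 : ℝ), y)) (by fun_prop)))
    · have := (hPsm.add hV).continuous_fderiv (by simp)
      exact continuous_pi fun j => this.clm_apply continuous_const
  obtain ⟨M, hM⟩ := isCompact_closedCube.exists_bound_of_continuousOn hJc.continuousOn
  have hM0 : 0 ≤ M := (norm_nonneg _).trans (hM 0 ⟨le_rfl, fun _ => Real.two_pi_pos.le⟩)
  set W := H.crit_finite.toFinset with hW
  have hWmem : ∀ w, w ∈ W ↔ w ∈ critW (∏ j, F j) B xmax r := fun w => by simp [hW]
  set K : ℝ := (1 + W.card) * M with hK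
  -- The integrand decays at rate `ε / 2`; half of that rate absorbs the constant `K` once
  -- `ε / 4 * len ≥ K`.
  refine ⟨ε / 4, by positivity, 4 / ε * K, fun k hkN hkR => ?_⟩
  set h : (Fin d → ℝ) → ℂ := fun y =>
    Complex.exp (-pairC (intVec k) (cvec x₀ y + V y)) * J y with hh
  have hhc : Continuous h := by
    refine Continuous.mul ?_ hJc
    unfold pairC
    fun_prop
  have hcoef : a k = (1 / (2 * Real.pi * Complex.I)) ^ d * ∫ y in cube d, h y := by
    rw [coeff_eq_integral_deformed hB.isOpen hB.convex H.branch_analytic H.branch_exp H.laurent huB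
      (contDiff_infty.1 hV 2) hVper hP₀ hF k, MeasureTheory.setIntegral_congr_set closedCube_ae_eq_cube]
    simp only [hh, hJ, mul_assoc]
  have hcontrib : ∀ w ∈ W, contrib P₀ F s (qi w) (nn w) (cvec xmax w) (homotopy xmax u η ε 1)
      (fun j => contLog (F j) (ℓ j) (cvec x₀) V 1) (U w) (intVec k) =
        (1 / (2 * Real.pi * Complex.I)) ^ d * ∫ y in closure (U w) ∩ cube d, h y := by
    intro w hw
    rw [hWmem] at hw
    rw [contrib, chainIntegral]
    congr 2
    funext y
    rw [hΦ1, localIntegrand_eq (fun j hj => (H.quadratic w hw j hj).1)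
      (fun j hj h0 => (H.linear w hw j hj h0).2.2) fun j => by
        rw [hLexp j 1 ⟨zero_le_one, le_rfl⟩ y, one_smul]]
    simp only [hh, hJ, detMul_eq_det_transpose, mul_assoc]
  rw [hcoef, Finset.sum_congr rfl hcontrib, ← Finset.mul_sum, ← mul_sub, norm_mul]
  -- Off the neighborhoods `pair r (η y) = len r`, so `N` gives the decay of the integrand there.
  have hest := norm_integral_cube_sub_sum_le W (U := U)
    (fun w hw => hU.isOpen w ((hWmem w).1 hw))
    (fun w hw w' hw' hne => hU.disjoint ((hWmem w).1 hw) ((hWmem w').1 hw') hne) hhc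
    (b := M * (Real.exp (-ε / 2 * len (intVec k)) * Real.exp (-pair (intVec k) xmax)))
    (by positivity) (by
      intro y hy hyU
      have hp := hN _ hkN y (hη.pair_eq y fun w hw => hyU w ((hWmem w).2 hw))
      simp only [hh, norm_mul]
      rw [mul_comm M, ← Real.exp_add, hΦ1', norm_exp_neg_pairC_cvec, pair_add, pair_smul]
      refine mul_le_mul (Real.exp_le_exp.2 ?_) (hM y (cube_subset_closedCube hy))
        (norm_nonneg _) (Real.exp_pos _).le
      nlinarith)
  have hnorm : ‖(1 / (2 * Real.pi * Complex.I) : ℂ) ^ d‖ * (2 * Real.pi) ^ d = 1 := by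
    have hpi := Real.two_pi_pos
    have : ‖(2 * Real.pi * Complex.I : ℂ)‖ = 2 * Real.pi := by
      rw [norm_mul, Complex.norm_I, mul_one, ← Complex.ofReal_ofNat, ← Complex.ofReal_mul,
        Complex.norm_real, Real.norm_of_nonneg hpi.le]
    rw [norm_pow, norm_div, norm_one, this, ← mul_pow, one_div_mul_cancel hpi.ne', one_pow]
  set l := len (intVec k) with hl
  have hKexp : K ≤ Real.exp (ε / 4 * l) := by
    have h1 : K ≤ ε / 4 * l := by
      calc K = ε / 4 * (4 / ε * K) := by field_simp
        _ ≤ ε / 4 * l := by gcongr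
    have := Real.add_one_le_exp (ε / 4 * l)
    linarith
  calc _ ≤ ‖(1 / (2 * Real.pi * Complex.I) : ℂ) ^ d‖ * ((1 + W.card) * ((2 * Real.pi) ^ d *
        (M * (Real.exp (-ε / 2 * l) * Real.exp (-pair (intVec k) xmax))))) := by
        gcongr
    _ = (‖(1 / (2 * Real.pi * Complex.I) : ℂ) ^ d‖ * (2 * Real.pi) ^ d) * K *
        Real.exp (-ε / 2 * l) * Real.exp (-pair (intVec k) xmax) := by
        rw [hK]
        ring
    _ ≤ 1 * Real.exp (ε / 4 * l) * Real.exp (-ε / 2 * l) *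
        Real.exp (-pair (intVec k) xmax) := by
        rw [hnorm]
        gcongr
    _ = Real.exp (-(ε / 4) * l) * Real.exp (-pair (intVec k) xmax) := by
        rw [one_mul, ← Real.exp_add]
        congr 2
        ring

end Homotopy

end QuadPoint

end

theorem theorem3p2 {d m : ℕ} (P₀ : (Fin d → ℂ) → ℂ) (F : Fin m → QuadPoint.Laurent d)
    (s : Fin m → ℝ) (B : Set (Fin d → ℝ)) (ℓ : Fin m → (Fin d → ℂ) → ℂ)
    (a : (Fin d → ℤ) → ℂ) (r xmax : Fin d → ℝ)
    (qi : (Fin d → ℝ) → Option (Fin m)) (nn : (Fin d → ℝ) → Fin m → ℕ)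
    (H : QuadPoint.Hyps P₀ F s B ℓ a r xmax qi nn)
    (U : (Fin d → ℝ) → Set (Fin d → ℝ))
    (hU : QuadPoint.IsNbhdFamily (QuadPoint.critW (∏ j, F j) B xmax r) U) :
    (QuadPoint.tanCone B xmax).Nonempty ∧
    (∃ η, QuadPoint.IsDeformField (∏ j, F j) B xmax r
      (QuadPoint.critW (∏ j, F j) B xmax r) U η) ∧
    ∀ η, QuadPoint.IsDeformField (∏ j, F j) B xmax r
        (QuadPoint.critW (∏ j, F j) B xmax r) U η →
      ∃ N : Set (Fin d → ℝ), QuadPoint.IsConicalNbhd N r ∧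
        ∀ u ∈ QuadPoint.tanCone B xmax, ∃ ε₀ : ℝ, 0 < ε₀ ∧ ∀ ε : ℝ, 0 < ε → ε < ε₀ →
          (∀ y, QuadPoint.homotopy xmax u η ε 0 y ∈ QuadPoint.tube B) ∧
          (∀ t ∈ Set.Icc (0 : ℝ) 1, ∀ y,
            AnalyticAt ℂ P₀ (QuadPoint.cexp (QuadPoint.homotopy xmax u η ε t y))) ∧
          ∃ L : Fin m → ℝ → (Fin d → ℝ) → ℂ,
            (∀ j, QuadPoint.IsContinuedLog (QuadPoint.logf (F j)) (ℓ j)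
              (QuadPoint.homotopy xmax u η ε) (L j)) ∧
            ∃ β : ℝ, 0 < β ∧ ∃ R : ℝ, ∀ k : Fin d → ℤ, QuadPoint.intVec k ∈ N →
              R ≤ QuadPoint.len (QuadPoint.intVec k) →
              ‖a k - ∑ w ∈ H.crit_finite.toFinset,
                  QuadPoint.contrib P₀ F s (qi w) (nn w) (QuadPoint.cvec xmax w)
                    (QuadPoint.homotopy xmax u η ε 1) (fun j => L j 1) (U w)
                    (QuadPoint.intVec k)‖
                ≤ Real.exp (-β * QuadPoint.len (QuadPoint.intVec k)) *
                  Real.exp (-QuadPoint.pair (QuadPoint.intVec k) xmax) := by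
  have hB := H.component
  have hx := H.proper.1
  refine ⟨QuadPoint.tanCone_nonempty hB.convex hB.isOpen hx,
    QuadPoint.exists_isDeformField hB H.proper H.crit_nonempty hU, fun η hη => ?_⟩
  have hηc := hη.smooth.continuous
  obtain ⟨M, hM⟩ : ∃ M, ∀ y, QuadPoint.len (η y) ≤ M := by
    obtain ⟨M, hM⟩ := QuadPoint.isCompact_closedCube.exists_bound_of_continuousOn
      (QuadPoint.continuous_len.comp hηc).continuousOn (s := QuadPoint.closedCube d)
    refine ⟨M, QuadPoint.forall_of_forall_closedCube (fun y k h => ?_)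
      fun y hy => (le_abs_self _).trans (hM y hy)⟩
    rwa [hη.periodic] at h
  obtain ⟨N, hNnbhd, hN⟩ := QuadPoint.exists_isConicalNbhd
    (QuadPoint.len_pos_of_proper hB H.proper H.crit_nonempty) M
  refine ⟨N, hNnbhd, fun u hu => ?_⟩
  have hP₀ : ∀ y, AnalyticAt ℂ P₀ (QuadPoint.cexp (QuadPoint.cvec xmax y)) := by
    intro y
    refine H.numerator_analytic _ (fun i => Complex.exp_ne_zero _) (Or.inr ?_)
    funext i
    simp [QuadPoint.reLog, QuadPoint.cexp, QuadPoint.cvec, Complex.norm_exp]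
  have hev : ∀ᶠ ε : ℝ in 𝓝[>] 0, xmax + ε • u ∈ B ∧
      (∀ t ∈ Set.Icc (0 : ℝ) 1, ∀ y,
        QuadPoint.logf (∏ j, F j) (QuadPoint.homotopy xmax u η ε t y) ≠ 0) ∧
      ∀ t ∈ Set.Icc (0 : ℝ) 1, ∀ y,
        AnalyticAt ℂ P₀ (QuadPoint.cexp (QuadPoint.homotopy xmax u η ε t y)) := by
    have h1 : ∀ᶠ ε : ℝ in 𝓝[>] 0, xmax + ε • u ∈ B := hu
    filter_upwards [h1, nhdsWithin_le_nhds (QuadPoint.eventually_logf_homotopy_ne_zero hB hx hu hηc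
      hη.periodic hη.mem_cone), nhdsWithin_le_nhds (QuadPoint.eventually_analyticAt_homotopy
        hηc hη.periodic hP₀ (u := u)), self_mem_nhdsWithin] with ε h1 h2 h3 h4
    exact ⟨h1, h2 h4, h3⟩
  obtain ⟨ε₀, hε₀, hall⟩ := mem_nhdsGT_iff_exists_Ioo_subset.1 hev
  refine ⟨ε₀, hε₀, fun ε hε hεlt => ?_⟩
  obtain ⟨h1, h2, h3⟩ := hall ⟨hε, hεlt⟩
  refine ⟨fun y => ?_, h3, QuadPoint.exists_localization H hU hη
    (fun v hv y hp => hN v hv (η y) (hM y) hp) hε h1 h2 h3⟩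
  show (fun i => (QuadPoint.homotopy xmax u η ε 0 y i).re) ∈ B
  have : (fun i => (QuadPoint.homotopy xmax u η ε 0 y i).re) = xmax + ε • u := by
    ext i
    simp [QuadPoint.homotopy, QuadPoint.cvec]
  rw [this]
  exact h1
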